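/- **Theorem 2.** Write $\hat a$ for the skew-symmetric $3\times3$ matrix with $\hat a b=a\times b$, $\vee$ for the inverse of $a\mapsto\hat a$, $e_3=(0,0,1)^T$. Let $m_L,m_Q,L,g>0$, let $J_L$ be a symmetric positive-definite $3\times 3$ matrix and $r_1,\dots,r_4\in\mathbb R^3$ such that $\mathcal P=\begin{bmatrix} I&\cdots&I\\ \hat r_1&\cdots&\hat r_4\end{bmatrix}\in\mathbb R^{6\times12}$ has rank $6$; put $m_{\rm eff}=4m_Q+m_L$, $J_{\rm eff}=J_L-\sum_j m_Q\hat r_j^2$. Consider the reduced model (rigid load, four quadrotors, inelastic cables) with disturbances $\Delta x_L,\Delta R_L,\Delta q_j$, on $(x_L,v_L)\in\mathbb R^6$, $R_L\in SO(3)$, $\Omega_L\in\mathbb R^3$, $q_j\in S^2$, $\omega_j\perp q_j$ ($j=1,\dots,4$): $$\dot x_L=v_L,\quad \dot R_L=R_L\hat\Omega_L,\quad \dot q_j=\omega_j\times q_j,$$ $$m_{\rm eff}(\dot v_L+ge_3)=\sum_j\big(u_j-m_QR_L(\hat\Omega_L^2+\dot{\hat\Omega}_L)r_j+m_QL\ddot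 q_j\big)+\Delta x_L,$$ $$J_{\rm eff}\dot\Omega_L+\hat\Omega_LJ_{\rm eff}\Omega_L=\sum_j m_Q\hat r_jR_L^T\big(-ge_3-\dot v_L+L\ddot q_j+\tfrac1{m_Q}u_j\big)+\Delta R_L,$$ $$\dot\omega_j=\tfrac1L\hat q_j\big(\dot v_L+R_L(\hat\Omega_L^2+\dot{\hat\Omega}_L)r_j+ge_3-\tfrac1{m_Q}u_j\big)+\Delta q_j .$$ Let a desired motion $\tilde x_L\in C^4$, $\tilde v_L=\dot{\tilde x}_L$, $\tilde R_L\in SO(3)$, $\dot{\tilde R}_L=\tilde R_L\hat{\tilde\Omega}_L$, $\tilde\Omega_L\in C^3$ be given, with $\dot{\tilde v}_L,\ddot{\tilde v}_L,\tilde\Omega_L,\dot{\tilde\Omega}_L,\ddot{\tilde\Omega}_L$ bounded on $t\ge 0$. The load errors are $e_{x_L}=x_L-\tilde x_L$, $e_{v_L}=v_L-\tilde v_L$, $e_{R_L}=\frac12(\tilde R_L^TR_L-R_L^T\tilde R_L)^\vee$, $e_{\Omega_L}=\Omega_L-R_L^T\tilde R_L\tilde\Omega_L$. For gains $k_{x_L},k_{v_L},k_{R_L},k_{\Omega_L},k_q,k_\omega$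 let $$\tilde F=m_L(-k_{x_L}e_{x_L}-k_{v_L}e_{v_L}+\dot{\tilde v}_L+ge_3),$$ $$\tilde M=-k_{R_L}e_{R_L}-k_{\Omega_L}e_{\Omega_L}+(R_L^T\tilde R_L\tilde\Omega_L)^\wedge J_LR_L^T\tilde R_L\tilde\Omega_L+J_LR_L^T\tilde R_L\dot{\tilde\Omega}_L,$$ $$(\tilde\mu_1,\dots,\tilde\mu_4)=\mathrm{diag}(R_L,\dots,R_L)\,\mathcal P^T(\mathcal P\mathcal P^T)^{-1}(R_L^T\tilde F,\tilde M),\qquad \tilde q_j=-\tilde\mu_j/\|\tilde\mu_j\|,$$ let $\tilde\omega_j\perp\tilde q_j$ be the angular velocity of $\tilde q_j$ along the motion ($\dot{\tilde q}_j=\tilde\omega_j\times\tilde q_j$), and $e_{q_j}=\tilde q_j\times q_j$, $e_{\omega_j}=\omega_j+\hat q_j^2\tilde\omega_j$, $\Psi_{R_L}=\frac12\mathrm{Tr}(I-\tilde R_L^TR_L)$, $\Psi_{q_j}=1-\tilde q_j^Tq_j$. The control law is $u_j=u_j^\parallel+u_j^\perp$ with $a_j=\dot v_L+ge_3+R_L\hat\Omega_L^2r_j-R_L\hat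 r_j\dot\Omega_L$ and $$u_j^\parallel=q_jq_j^T\tilde\mu_j+m_QL\|\omega_j\|^2q_j+m_Qq_jq_j^Ta_j,$$ $$u_j^\perp=m_QL\hat q_j\big(-k_qe_{q_j}-k_\omega e_{\omega_j}-(q_j^T\tilde\omega_j)\dot q_j-\hat q_j^2\dot{\tilde\omega}_j\big)-m_Q\hat q_j^2a_j .$$ Let $\|e\|$ be the Euclidean norm of the vector of all errors $e_{x_L},e_{v_L},e_{R_L},e_{\Omega_L},e_{q_j},e_{\omega_j}$. There is $\alpha_0>0$ such that for all $\psi_{q_1},\dots,\psi_{q_4}\in(0,1)$ with $\alpha_j:=\sqrt{\psi_{q_j}(2-\psi_{q_j})}<\alpha_0$ the following two statements hold. (a) For all disturbance bounds $\bar x_L,\bar R_L,\bar q_j\in\mathbb R$, all $e_{x_{\max}}>0$, $\psi_{R_L}\in(0,1)$, $c>0$, $m>0$, and every $b>0$, there are positive gains and a $T\ge0$ such that, for every initial time $t_0\ge 0$, every end time $t_1>t_0$ and all disturbances with $\|\Delta x_L\|\le\bar x_L$, $\|\Delta R_L\|\le\bar R_L$, $\|\Delta q_j\|\le\bar q_j$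 on $[t_0,t_1)$, every closed-loop trajectory on $[t_0,t_1)$ along which $\|\tilde\mu_j\|\ge m$ for $j=1,\dots,4$ (so that the control law is non-degenerate) and which starts with $\|e_{x_L}\|<e_{x_{\max}}$, $\Psi_{R_L}<\psi_{R_L}$, $\Psi_{q_j}<\psi_{q_j}$ and $\|e_{v_L}\|,\|e_{\Omega_L}\|,\|e_{\omega_j}\|\le c$ satisfies $\|e(t)\|\le b$ for all $t\in[t_0+T,t_1)$. That is, the tracking errors are uniformly ultimately bounded with an arbitrarily small ultimate bound. (b) If the nominal cable forces (the $\tilde\mu_j$ for vanishing load errors) are bounded away from $0$ for $t\ge0$, then there is $\delta>0$ such that for every $b>0$ there are positive gains, $c>0$ and $T\ge 0$ for which the conclusion of (a) holds with $\bar x_L=\bar R_L=\bar q_j=\delta$ and $e_{x_{\max}}=\psi_{R_L}=c$, without any condition on $\tilde\mu_j$ along the trajectories. -/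

import Mathlib

/-! Cooperative transport of a rigid load by four quadrotors with inelastic cables:
reduced dynamics with disturbances, geometric tracking control law, tracking errors. -/

open Matrix

noncomputable section

namespace LoadTransport

/-- Euclidean three-space. -/
abbrev E3 : Type := EuclideanSpace ℝ (Fin 3)

/-- Real `3 × 3` matrices. -/
abbrev M3 : Type := Matrix (Fin 3) (Fin 3) ℝ

/-- The hat map: `act (hat a) b` is the cross product `a × b`. -/
def hat (a : E3) : M3 :=
  !![0, -a 2, a 1;
     a 2, 0, -a 0;
     -a 1, a 0, 0]

/-- The inverse of the hat map, on skew-symmetric matrices. -/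
def vee (A : M3) : E3 := !₂[A 2 1, A 0 2, A 1 0]

/-- A matrix applied to a vector of Euclidean three-space. -/
def act (A : M3) (a : E3) : E3 := WithLp.toLp 2 (A *ᵥ a.ofLp)

/-- The cross product. -/
def cross (a b : E3) : E3 := act (hat a) b

/-- The scalar product `aᵀ b`. -/
def dot (a b : E3) : ℝ := inner ℝ a b

/-- The upward unit vector. -/
def e3 : E3 := !₂[0, 0, 1]

/-- The grasp matrix: first block row `I ⋯ I`, second block row `r̂₁ ⋯ r̂₄`. -/
def grasp (r : Fin 4 → E3) : Matrix (Fin 3 ⊕ Fin 3) (Fin 4 × Fin 3) ℝ :=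
  Matrix.of fun a p =>
    Sum.elim (fun i => (1 : M3) i p.2) (fun i => hat (r p.1) i p.2) a

/-- Physical parameters: load mass `mL`, quadrotor mass `mQ`, cable length `L`, gravitational
acceleration `g`, load inertia `J` and attachment points `r j` (in the load frame). -/
structure Params where
  mL : ℝ
  mQ : ℝ
  L : ℝ
  g : ℝ
  J : M3
  r : Fin 4 → E3
  mL_pos : 0 < mL
  mQ_pos : 0 < mQ
  L_pos : 0 < L
  g_pos : 0 < g
  J_posDef : J.PosDef
  rank_grasp : (grasp r).rank = 6

/-- The effective mass `4 m_Q + m_L`. -/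
def Params.mEff (S : Params) : ℝ := 4 * S.mQ + S.mL

/-- The effective inertia `J_L - ∑ m_Q r̂_j²`. -/
def Params.JEff (S : Params) : M3 := S.J - ∑ j, S.mQ • (hat (S.r j) * hat (S.r j))

/-- A desired load motion: position `x`, attitude `R`, body angular velocity `Ω`. The desired
velocity and acceleration are the derivatives of `x`. -/
structure Desired where
  x : ℝ → E3
  R : ℝ → M3
  Ω : ℝ → E3
  x_smooth : ContDiff ℝ 4 x
  Ω_smooth : ContDiff ℝ 3 Ω
  R_mem : ∀ t, R t ∈ Matrix.specialOrthogonalGroup (Fin 3) ℝ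
  R_kin : ∀ t i k, HasDerivAt (fun s => R s i k) ((R t * hat (Ω t)) i k) t
  bounded : ∃ B : ℝ, ∀ t, 0 ≤ t →
    ‖iteratedDeriv 2 x t‖ ≤ B ∧ ‖iteratedDeriv 3 x t‖ ≤ B ∧
    ‖Ω t‖ ≤ B ∧ ‖deriv Ω t‖ ≤ B ∧ ‖iteratedDeriv 2 Ω t‖ ≤ B

/-- Controller gains. -/
structure Gains where
  kx : ℝ
  kv : ℝ
  kR : ℝ
  kΩ : ℝ
  kq : ℝ
  kω : ℝ

/-- All gains are positive. -/
def Gains.Positive (K : Gains) : Prop :=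
  0 < K.kx ∧ 0 < K.kv ∧ 0 < K.kR ∧ 0 < K.kΩ ∧ 0 < K.kq ∧ 0 < K.kω

/-- The time histories that occur in the closed loop. The state is `x, v, R, Ω, q, ω`; the
remaining functions are derived from it (see `IsTrajectory`): the load accelerations `dv`, `dΩ`,
the cable accelerations `dω`, `ddq`, the angular velocity `ωd j` of the desired direction of
cable `j`, and the derivative `dωd j` of the latter. -/
structure Motion where
  x : ℝ → E3
  v : ℝ → E3
  R : ℝ → M3
  Ω : ℝ → E3
  q : Fin 4 → ℝ → E3
  ω : Fin 4 → ℝ → E3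
  dv : ℝ → E3
  dΩ : ℝ → E3
  dω : Fin 4 → ℝ → E3
  ddq : Fin 4 → ℝ → E3
  ωd : Fin 4 → ℝ → E3
  dωd : Fin 4 → ℝ → E3

section ControlLaw

variable (S : Params) (D : Desired) (K : Gains) (M : Motion)

/-- Position error. -/
def errX (t : ℝ) : E3 := M.x t - D.x t

/-- Velocity error. -/
def errV (t : ℝ) : E3 := M.v t - deriv D.x t

/-- Attitude error. -/
def errR (t : ℝ) : E3 := (1 / 2 : ℝ) • vee ((D.R t)ᵀ * M.R t - (M.R t)ᵀ * D.R t)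

/-- The desired angular velocity of the load, in the actual load frame. -/
def transportedΩ (t : ℝ) : E3 := act ((M.R t)ᵀ * D.R t) (D.Ω t)

/-- Angular velocity error. -/
def errΩ (t : ℝ) : E3 := M.Ω t - transportedΩ D M t

/-- The commanded force on the load. -/
def desForce (t : ℝ) : E3 :=
  S.mL • (-(K.kx • errX D M t) - K.kv • errV D M t + iteratedDeriv 2 D.x t + S.g • e3)

/-- The commanded moment on the load (in the load frame). -/
def desMoment (t : ℝ) : E3 :=
  -(K.kR • errR D M t) - K.kΩ • errΩ D M t
    + cross (transportedΩ D M t) (act S.J (transportedΩ D M t))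
    + act (S.J * (M.R t)ᵀ * D.R t) (deriv D.Ω t)

/-- The commanded cable forces `μ̃_j`: the minimum-norm distribution
`diag(R_L, …, R_L) Pᵀ (P Pᵀ)⁻¹ (R_Lᵀ F̃, M̃)` of the commanded force and moment. -/
def desTension (j : Fin 4) (t : ℝ) : E3 :=
  act (M.R t) (WithLp.toLp 2 fun i =>
    (((grasp S.r)ᵀ * (grasp S.r * (grasp S.r)ᵀ)⁻¹) *ᵥ
      Sum.elim (act (M.R t)ᵀ (desForce S D K M t)).ofLp (desMoment S D K M t).ofLp) (j, i))

/-- The desired cable directions `q̃_j = -μ̃_j / ‖μ̃_j‖`. -/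
def desCable (j : Fin 4) (t : ℝ) : E3 :=
  -(‖desTension S D K M j t‖⁻¹ • desTension S D K M j t)

/-- Cable direction error `q̃_j × q_j`. -/
def errQ (j : Fin 4) (t : ℝ) : E3 := cross (desCable S D K M j t) (M.q j t)

/-- Cable angular velocity error `ω_j + q̂_j² ω̃_j`. -/
def errω (j : Fin 4) (t : ℝ) : E3 :=
  M.ω j t + act (hat (M.q j t) * hat (M.q j t)) (M.ωd j t)

/-- The acceleration term
`a_j = dv_L/dt + g e₃ + R_L Ω̂_L² r_j - R_L r̂_j dΩ_L/dt`. -/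
def accel (j : Fin 4) (t : ℝ) : E3 :=
  M.dv t + S.g • e3 + act (M.R t * hat (M.Ω t) * hat (M.Ω t)) (S.r j)
    - act (M.R t * hat (S.r j)) (M.dΩ t)

/-- The control component parallel to the cable. -/
def uPar (j : Fin 4) (t : ℝ) : E3 :=
  dot (M.q j t) (desTension S D K M j t) • M.q j t
    + (S.mQ * S.L * ‖M.ω j t‖ ^ 2) • M.q j t
    + (S.mQ * dot (M.q j t) (accel S M j t)) • M.q j t

/-- The control component perpendicular to the cable. -/
def uPerp (j : Fin 4) (t : ℝ) : E3 :=
  (S.mQ * S.L) • act (hat (M.q j t))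
      (-(K.kq • errQ S D K M j t) - K.kω • errω M j t
        - dot (M.q j t) (M.ωd j t) • cross (M.ω j t) (M.q j t)
        - act (hat (M.q j t) * hat (M.q j t)) (M.dωd j t))
    - S.mQ • act (hat (M.q j t) * hat (M.q j t)) (accel S M j t)

/-- The control input (thrust vector) of quadrotor `j`. -/
def control (j : Fin 4) (t : ℝ) : E3 := uPar S D K M j t + uPerp S D K M j t

/-- The configuration error function of the load attitude. -/
def ΨR (t : ℝ) : ℝ := (1 / 2) * Matrix.trace (1 - (D.R t)ᵀ * M.R t)

/-- The configuration error function of cable `j`. -/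
def Ψq (j : Fin 4) (t : ℝ) : ℝ := 1 - dot (desCable S D K M j t) (M.q j t)

/-- The Euclidean norm of the vector of all tracking errors. -/
def errNorm (t : ℝ) : ℝ :=
  √(‖errX D M t‖ ^ 2 + ‖errV D M t‖ ^ 2 + ‖errR D M t‖ ^ 2 + ‖errΩ D M t‖ ^ 2
    + ∑ j, (‖errQ S D K M j t‖ ^ 2 + ‖errω M j t‖ ^ 2))

/-- `M` is a trajectory, on the time set `I`, of the reduced model with disturbances `δx`, `δR`,
`δq j` in closed loop with the control law. -/
structure IsTrajectory (δx δR : ℝ → E3) (δq : Fin 4 → ℝ → E3) (I : Set ℝ) : Prop where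
  R_mem : ∀ t ∈ I, M.R t ∈ Matrix.specialOrthogonalGroup (Fin 3) ℝ
  q_norm : ∀ t ∈ I, ∀ j, ‖M.q j t‖ = 1
  ω_tangent : ∀ t ∈ I, ∀ j, dot (M.ω j t) (M.q j t) = 0
  -- The acceleration functions are the derivatives of the velocities.
  v_deriv : ∀ t ∈ I, HasDerivWithinAt M.v (M.dv t) I t
  Ω_deriv : ∀ t ∈ I, HasDerivWithinAt M.Ω (M.dΩ t) I t
  ω_deriv : ∀ t ∈ I, ∀ j, HasDerivWithinAt (M.ω j) (M.dω j t) I t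
  dq_deriv : ∀ t ∈ I, ∀ j,
    HasDerivWithinAt (fun s => cross (M.ω j s) (M.q j s)) (M.ddq j t) I t
  -- The desired cable directions move with angular velocity `ωd j`.
  desCable_deriv : ∀ t ∈ I, ∀ j,
    HasDerivWithinAt (desCable S D K M j) (cross (M.ωd j t) (desCable S D K M j t)) I t
  ωd_tangent : ∀ t ∈ I, ∀ j, dot (M.ωd j t) (desCable S D K M j t) = 0
  ωd_deriv : ∀ t ∈ I, ∀ j, HasDerivWithinAt (M.ωd j) (M.dωd j t) I t
  -- Kinematics.
  x_kin : ∀ t ∈ I, HasDerivWithinAt M.x (M.v t) I t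
  R_kin : ∀ t ∈ I, ∀ i k,
    HasDerivWithinAt (fun s => M.R s i k) ((M.R t * hat (M.Ω t)) i k) I t
  q_kin : ∀ t ∈ I, ∀ j, HasDerivWithinAt (M.q j) (cross (M.ω j t) (M.q j t)) I t
  -- Dynamics.
  v_dyn : ∀ t ∈ I, S.mEff • (M.dv t + S.g • e3) =
    (∑ j, (control S D K M j t
      - S.mQ • act (M.R t * (hat (M.Ω t) * hat (M.Ω t) + hat (M.dΩ t))) (S.r j)
      + (S.mQ * S.L) • M.ddq j t)) + δx t
  Ω_dyn : ∀ t ∈ I, act S.JEff (M.dΩ t) + act (hat (M.Ω t) * S.JEff) (M.Ω t) =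
    (∑ j, S.mQ • act (hat (S.r j) * (M.R t)ᵀ)
      (-(S.g • e3) - M.dv t + S.L • M.ddq j t + (1 / S.mQ) • control S D K M j t)) + δR t
  ω_dyn : ∀ t ∈ I, ∀ j, M.dω j t =
    (1 / S.L) • act (hat (M.q j t))
      (M.dv t + act (M.R t * (hat (M.Ω t) * hat (M.Ω t) + hat (M.dΩ t))) (S.r j)
        + S.g • e3 - (1 / S.mQ) • control S D K M j t) + δq j t

/-- At time `t` the errors lie in the domain
`‖e_x‖ < ex`, `Ψ_R < ψR`, `Ψ_{q_j} < ψq j`, and the velocity errors are at most `c`. -/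
def InDomain (ex ψR : ℝ) (ψq : Fin 4 → ℝ) (c t : ℝ) : Prop :=
  ‖errX D M t‖ < ex ∧ ΨR D M t < ψR ∧ (∀ j, Ψq S D K M j t < ψq j) ∧
  ‖errV D M t‖ ≤ c ∧ ‖errΩ D M t‖ ≤ c ∧ ∀ j, ‖errω M j t‖ ≤ c

end ControlLaw

/-- The motion without any tracking error of the load (its accelerations and the cables play no
role in the commanded forces). -/
def Desired.motion (D : Desired) : Motion where
  x := D.x
  v := deriv D.x
  R := D.R
  Ω := D.Ω
  q := 0
  ω := 0
  dv := 0
  dΩ := 0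
  dω := 0
  ddq := 0
  ωd := 0
  dωd := 0

/-- The nominal cable forces: the commanded cable forces when the load follows its desired motion
exactly (the load errors vanish, so the gains are irrelevant and are set to zero). -/
def nominalTension (S : Params) (D : Desired) (j : Fin 4) (t : ℝ) : E3 :=
  desTension S D ⟨0, 0, 0, 0, 0, 0⟩ D.motion j t

/-- Uniform ultimate boundedness, with ultimate bound `b`, of the tracking errors for all
disturbances with bounds `xbar`, `Rbar`, `qbar j` and all initial errors in the domain: the time
`T` after which the bound holds depends neither on the initial time, nor on the trajectory, nor on
the disturbances. The motions considered are those with commanded cable forces of norm at least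
`m` (no restriction if `m = 0`); they need not be defined for all times, and the bound holds for as
long as they last. -/
def UniformlyUltimatelyBounded (S : Params) (D : Desired) (K : Gains)
    (xbar Rbar : ℝ) (qbar : Fin 4 → ℝ) (m ex ψR : ℝ) (ψq : Fin 4 → ℝ) (c b : ℝ) : Prop :=
  ∃ T : ℝ, 0 ≤ T ∧
    ∀ t₀ t₁ : ℝ, 0 ≤ t₀ → t₀ < t₁ →
    ∀ (δx δR : ℝ → E3) (δq : Fin 4 → ℝ → E3),
    (∀ t ∈ Set.Ico t₀ t₁, ‖δx t‖ ≤ xbar ∧ ‖δR t‖ ≤ Rbar ∧ ∀ j, ‖δq j t‖ ≤ qbar j) →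
    ∀ M : Motion, IsTrajectory S D K M δx δR δq (Set.Ico t₀ t₁) →
    (∀ t ∈ Set.Ico t₀ t₁, ∀ j, m ≤ ‖desTension S D K M j t‖) →
    InDomain S D K M ex ψR ψq c t₀ →
    ∀ t ∈ Set.Ico t₀ t₁, t₀ + T ≤ t → errNorm S D K M t ≤ b

end LoadTransport

end

open Matrix

noncomputable section

namespace LoadTransport

/-! The control law inverts the cable and load dynamics. Perpendicular to the cable it cancels
everything but a commanded angular acceleration (`dω_eq`). Each cable then transmits to the load its
commanded force `μ̃_j`, up to `(q_j q_jᵀ - I) μ̃_j` and a disturbance (`cable_force`). The load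
therefore obeys a PD loop for a body of mass `mL` and inertia `J`, perturbed by terms of size
`‖μ̃_j‖ ‖e_{q_j}‖ + d`.

The gains are `lam², lam` (position), `ρ², ρ` (attitude) and `ν², ν` (cables). Quadratic Lyapunov
functions with small cross terms are used for the load (`loadV`) and for each cable (`cableV`). The
feedback part of `μ̃_j` grows with the gains exactly as the square root of the dissipation does. A
bound `α` on the cable errors that is small independently of the gains is thus absorbed, and only a
constant `resid` remains (`loadV_decay`). Its effect on the errors is of order `1 / lam`, which
makes the ultimate bound arbitrarily small.

The cable functions decay at rate `ν / 64` as long as `‖ω̃_j‖ ≤ ν` (`cableV_decay`). On a level set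
of `loadV` where the `μ̃_j` stay away from zero, `ω̃_j` is bounded independently of `ν`
(`exists_ωd_bound`): the derivative of `μ̃_j` involves the cables only through the unit vectors
`q_j`. So `ν` can be chosen last.

The load estimate needs small cable errors and the cable estimate needs a bounded load. This circle
is closed by `barrier`: no Lyapunov function can be the first to leave its level.
`exists_cable_gain` carries this out. For (a), `ρ` is a large multiple of `lam`, so that large
initial position errors fit below a level that keeps `Ψ_R` below `3 / 2`. For (b), `ρ = lam` and the
level is twice the equilibrium value; there the `μ̃_j` differ from their nominal values by a
multiple of `resid` independent of the gains, which small `α₀` and `δ` keep below half the nominal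
size. -/

/-! ### Vector algebra: scalar product, cross product, matrices acting on vectors. -/

theorem E3.ext_iff {a b : E3} : a = b ↔ a 0 = b 0 ∧ a 1 = b 1 ∧ a 2 = b 2 := by
  constructor
  · rintro rfl; simp
  · rintro ⟨h0, h1, h2⟩
    ext i; fin_cases i <;> assumption

theorem act_apply (A : M3) (a : E3) (i : Fin 3) :
    act A a i = A i 0 * a 0 + A i 1 * a 1 + A i 2 * a 2 := by
  simp [act, Matrix.mulVec, dotProduct, Fin.sum_univ_three]

theorem cross_zero_apply (a b : E3) : cross a b 0 = a 1 * b 2 - a 2 * b 1 := by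
  simp [cross, act_apply, hat]; ring

theorem cross_one_apply (a b : E3) : cross a b 1 = a 2 * b 0 - a 0 * b 2 := by
  simp [cross, act_apply, hat]; ring

theorem cross_two_apply (a b : E3) : cross a b 2 = a 0 * b 1 - a 1 * b 0 := by
  simp [cross, act_apply, hat]; ring

theorem dot_eq (a b : E3) : dot a b = a 0 * b 0 + a 1 * b 1 + a 2 * b 2 := by
  simp [dot, PiLp.inner_apply, Fin.sum_univ_three]; ring

theorem norm_sq_eq (a : E3) : ‖a‖ ^ 2 = a 0 ^ 2 + a 1 ^ 2 + a 2 ^ 2 := by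
  simp [EuclideanSpace.norm_sq_eq, Fin.sum_univ_three]

theorem dot_self (a : E3) : dot a a = ‖a‖ ^ 2 := by
  rw [dot_eq, norm_sq_eq]; ring

theorem dot_comm (a b : E3) : dot a b = dot b a := by
  rw [dot_eq, dot_eq]; ring

theorem abs_dot_le (a b : E3) : |dot a b| ≤ ‖a‖ * ‖b‖ := abs_real_inner_le_norm a b

theorem dot_le (a b : E3) : dot a b ≤ ‖a‖ * ‖b‖ := real_inner_le_norm a b

theorem neg_le_dot (a b : E3) : -(‖a‖ * ‖b‖) ≤ dot a b := neg_le_of_abs_le (abs_dot_le a b)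

theorem norm_cross_sq (a b : E3) : ‖cross a b‖ ^ 2 = ‖a‖ ^ 2 * ‖b‖ ^ 2 - dot a b ^ 2 := by
  simp only [norm_sq_eq, dot_eq, cross_zero_apply, cross_one_apply, cross_two_apply]; ring

theorem norm_cross_le (a b : E3) : ‖cross a b‖ ≤ ‖a‖ * ‖b‖ := by
  apply le_of_sq_le_sq _ (by positivity)
  rw [norm_cross_sq, mul_pow]; nlinarith [sq_nonneg (dot a b)]

theorem cross_cross (a b c : E3) : cross a (cross b c) = dot a c • b - dot a b • c := by
  simp only [E3.ext_iff, cross_zero_apply, cross_one_apply, cross_two_apply, dot_eq,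
    PiLp.sub_apply, PiLp.smul_apply, smul_eq_mul]
  refine ⟨?_, ?_, ?_⟩ <;> ring

theorem cross_self (a : E3) : cross a a = 0 := by
  simp only [E3.ext_iff, cross_zero_apply, cross_one_apply, cross_two_apply, PiLp.zero_apply]
  refine ⟨?_, ?_, ?_⟩ <;> ring

theorem cross_anticomm (a b : E3) : cross a b = -cross b a := by
  simp only [E3.ext_iff, cross_zero_apply, cross_one_apply, cross_two_apply, PiLp.neg_apply]
  refine ⟨?_, ?_, ?_⟩ <;> ring

theorem cross_add (a b c : E3) : cross a (b + c) = cross a b + cross a c := by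
  simp only [E3.ext_iff, cross_zero_apply, cross_one_apply, cross_two_apply, PiLp.add_apply]
  refine ⟨?_, ?_, ?_⟩ <;> ring

theorem add_cross (a b c : E3) : cross (a + b) c = cross a c + cross b c := by
  simp only [E3.ext_iff, cross_zero_apply, cross_one_apply, cross_two_apply, PiLp.add_apply]
  refine ⟨?_, ?_, ?_⟩ <;> ring

theorem cross_sub (a b c : E3) : cross a (b - c) = cross a b - cross a c := by
  simp only [E3.ext_iff, cross_zero_apply, cross_one_apply, cross_two_apply, PiLp.sub_apply]
  refine ⟨?_, ?_, ?_⟩ <;> ring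

theorem sub_cross (a b c : E3) : cross (a - b) c = cross a c - cross b c := by
  simp only [E3.ext_iff, cross_zero_apply, cross_one_apply, cross_two_apply, PiLp.sub_apply]
  refine ⟨?_, ?_, ?_⟩ <;> ring

theorem cross_smul (k : ℝ) (a b : E3) : cross a (k • b) = k • cross a b := by
  simp only [E3.ext_iff, cross_zero_apply, cross_one_apply, cross_two_apply, PiLp.smul_apply,
    smul_eq_mul]
  refine ⟨?_, ?_, ?_⟩ <;> ring

theorem smul_cross (k : ℝ) (a b : E3) : cross (k • a) b = k • cross a b := by
  simp only [E3.ext_iff, cross_zero_apply, cross_one_apply, cross_two_apply, PiLp.smul_apply,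
    smul_eq_mul]
  refine ⟨?_, ?_, ?_⟩ <;> ring

theorem cross_neg (a b : E3) : cross a (-b) = -cross a b := by
  simpa using cross_smul (-1) a b

theorem dot_cross_self_left (a b : E3) : dot a (cross a b) = 0 := by
  simp only [dot_eq, cross_zero_apply, cross_one_apply, cross_two_apply]; ring

theorem dot_cross_self_right (a b : E3) : dot b (cross a b) = 0 := by
  simp only [dot_eq, cross_zero_apply, cross_one_apply, cross_two_apply]; ring

theorem dot_cross_rotate (a b c : E3) : dot a (cross b c) = dot b (cross c a) := by
  simp only [dot_eq, cross_zero_apply, cross_one_apply, cross_two_apply]; ring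

theorem dot_add (a b c : E3) : dot a (b + c) = dot a b + dot a c := inner_add_right a b c
theorem add_dot (a b c : E3) : dot (a + b) c = dot a c + dot b c := inner_add_left a b c
theorem dot_sub (a b c : E3) : dot a (b - c) = dot a b - dot a c := inner_sub_right a b c
theorem sub_dot (a b c : E3) : dot (a - b) c = dot a c - dot b c := inner_sub_left a b c
theorem dot_neg (a b : E3) : dot a (-b) = -dot a b := inner_neg_right a b
theorem dot_smul (k : ℝ) (a b : E3) : dot a (k • b) = k * dot a b := real_inner_smul_right a b k
theorem smul_dot (k : ℝ) (a b : E3) : dot (k • a) b = k * dot a b := real_inner_smul_left a b k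

theorem act_add (A : M3) (a b : E3) : act A (a + b) = act A a + act A b := by
  simp [act, Matrix.mulVec_add]

theorem act_sub (A : M3) (a b : E3) : act A (a - b) = act A a - act A b := by
  simp [act, Matrix.mulVec_sub]

theorem act_smul (A : M3) (k : ℝ) (a : E3) : act A (k • a) = k • act A a := by
  simp [act, Matrix.mulVec_smul]

theorem act_neg (A : M3) (a : E3) : act A (-a) = -act A a := by
  simp [act, Matrix.mulVec_neg]

theorem act_mul (A B : M3) (a : E3) : act (A * B) a = act A (act B a) := by
  simp [act, Matrix.mulVec_mulVec]

theorem add_act (A B : M3) (a : E3) : act (A + B) a = act A a + act B a := by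
  simp [act, Matrix.add_mulVec]

theorem sub_act (A B : M3) (a : E3) : act (A - B) a = act A a - act B a := by
  simp [act, Matrix.sub_mulVec]

theorem smul_act (k : ℝ) (A : M3) (a : E3) : act (k • A) a = k • act A a := by
  simp [act, Matrix.smul_mulVec]

theorem one_act (a : E3) : act 1 a = a := by
  simp [act]

theorem act_hat (a b : E3) : act (hat a) b = cross a b := rfl

theorem dot_act (A : M3) (a b : E3) : dot a (act A b) = dot (act Aᵀ a) b := by
  simp only [dot_eq, act_apply, Matrix.transpose_apply]; ring

/-- A matrix as a linear map of `E3`. -/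
def actLin (A : M3) : E3 →ₗ[ℝ] E3 where
  toFun := act A
  map_add' := act_add A
  map_smul' k a := act_smul A k a

theorem act_sum {ι : Type*} (A : M3) (s : Finset ι) (f : ι → E3) :
    act A (∑ j ∈ s, f j) = ∑ j ∈ s, act A (f j) := map_sum (actLin A) f s

theorem sum_act {ι : Type*} (s : Finset ι) (A : ι → M3) (a : E3) :
    act (∑ j ∈ s, A j) a = ∑ j ∈ s, act (A j) a := by
  classical
  induction s using Finset.induction_on with
  | empty => simp [act]
  | insert i s hi ih => rw [Finset.sum_insert hi, Finset.sum_insert hi, add_act, ih]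

theorem exists_norm_act_le (A : M3) : ∃ C : ℝ, 0 < C ∧ ∀ a, ‖act A a‖ ≤ C * ‖a‖ := by
  obtain ⟨C, hC, h⟩ := (LinearMap.toContinuousLinearMap (actLin A)).bound
  exact ⟨C, hC, h⟩

/-! ### Rotation matrices and the attitude error functions. -/

section Rotation

variable {R Q : M3}

theorem rot_transpose_mul (hR : R ∈ Matrix.specialOrthogonalGroup (Fin 3) ℝ) : Rᵀ * R = 1 :=
  (Matrix.mem_orthogonalGroup_iff' (Fin 3) ℝ).1 (Matrix.mem_specialOrthogonalGroup_iff.1 hR).1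

theorem rot_mul_transpose (hR : R ∈ Matrix.specialOrthogonalGroup (Fin 3) ℝ) : R * Rᵀ = 1 :=
  (Matrix.mem_orthogonalGroup_iff (Fin 3) ℝ).1 (Matrix.mem_specialOrthogonalGroup_iff.1 hR).1

theorem rot_transpose_mem (hR : R ∈ Matrix.specialOrthogonalGroup (Fin 3) ℝ) :
    Rᵀ ∈ Matrix.specialOrthogonalGroup (Fin 3) ℝ := by
  rw [Matrix.mem_specialOrthogonalGroup_iff, Matrix.mem_orthogonalGroup_iff]
  refine ⟨?_, ?_⟩
  · simpa using rot_transpose_mul hR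
  · rw [Matrix.det_transpose]; exact (Matrix.mem_specialOrthogonalGroup_iff.1 hR).2

theorem rot_adjugate (hR : R ∈ Matrix.specialOrthogonalGroup (Fin 3) ℝ) : R.adjugate = Rᵀ := by
  have h := Matrix.mul_adjugate R
  rw [(Matrix.mem_specialOrthogonalGroup_iff.1 hR).2, one_smul] at h
  calc R.adjugate = (Rᵀ * R) * R.adjugate := by rw [rot_transpose_mul hR, one_mul]
    _ = Rᵀ := by rw [mul_assoc, h, mul_one]

/-- The adjugate of a rotation is its transpose, so each row is the cross product of the next two in
cyclic order. This is the form in which determinant one is used, both for the equivariance of the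
cross product and for the norm of `rotErr`. -/
theorem rot_cofactor (hR : R ∈ Matrix.specialOrthogonalGroup (Fin 3) ℝ) :
    (R 0 0 = R 1 1 * R 2 2 - R 1 2 * R 2 1 ∧ R 0 1 = R 1 2 * R 2 0 - R 1 0 * R 2 2 ∧
      R 0 2 = R 1 0 * R 2 1 - R 1 1 * R 2 0) ∧
    (R 1 0 = R 2 1 * R 0 2 - R 2 2 * R 0 1 ∧ R 1 1 = R 2 2 * R 0 0 - R 2 0 * R 0 2 ∧
      R 1 2 = R 2 0 * R 0 1 - R 2 1 * R 0 0) ∧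
    (R 2 0 = R 0 1 * R 1 2 - R 0 2 * R 1 1 ∧ R 2 1 = R 0 2 * R 1 0 - R 0 0 * R 1 2 ∧
      R 2 2 = R 0 0 * R 1 1 - R 0 1 * R 1 0) := by
  have h := rot_adjugate hR
  rw [Matrix.adjugate_fin_three] at h
  have e : ∀ i j, R i j = (Rᵀ) j i := fun i j => rfl
  refine ⟨⟨?_, ?_, ?_⟩, ⟨?_, ?_, ?_⟩, ?_, ?_, ?_⟩ <;>
  · conv_lhs => rw [e, ← h]
    simp
    try ring

theorem norm_act_rot (hR : R ∈ Matrix.specialOrthogonalGroup (Fin 3) ℝ) (a : E3) :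
    ‖act R a‖ = ‖a‖ := by
  have : ‖act R a‖ ^ 2 = ‖a‖ ^ 2 := by
    rw [← dot_self, dot_act, ← act_mul, rot_transpose_mul hR, one_act, dot_self]
  exact (pow_left_inj₀ (norm_nonneg _) (norm_nonneg _) two_ne_zero).1 this

theorem act_rot_cross (hR : R ∈ Matrix.specialOrthogonalGroup (Fin 3) ℝ) (a b : E3) :
    act R (cross a b) = cross (act R a) (act R b) := by
  obtain ⟨⟨h1, h2, h3⟩, ⟨h4, h5, h6⟩, h7, h8, h9⟩ := rot_cofactor hR
  simp only [E3.ext_iff, cross_zero_apply, cross_one_apply, cross_two_apply, act_apply]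
  refine ⟨?_, ?_, ?_⟩
  · rw [h1, h2, h3]; ring
  · rw [h4, h5, h6]; ring
  · rw [h7, h8, h9]; ring

theorem matrix_ext_act {A B : M3} (h : ∀ a, act A a = act B a) : A = B := by
  apply Matrix.ext_of_mulVec_single
  intro j
  simpa [act] using h (WithLp.toLp 2 (Pi.single j 1))

theorem rot_mul_hat (hR : R ∈ Matrix.specialOrthogonalGroup (Fin 3) ℝ) (a : E3) :
    R * hat a = hat (act R a) * R := by
  apply matrix_ext_act
  intro b
  rw [act_mul, act_mul, act_hat, act_hat, act_rot_cross hR]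

theorem rot_row_sq (hR : R ∈ Matrix.specialOrthogonalGroup (Fin 3) ℝ) (i : Fin 3) :
    R i 0 ^ 2 + R i 1 ^ 2 + R i 2 ^ 2 = 1 := by
  have h := congrFun (congrFun (rot_mul_transpose hR) i) i
  rw [Matrix.mul_apply, Fin.sum_univ_three] at h
  simp only [Matrix.transpose_apply, Matrix.one_apply_eq] at h
  linarith

theorem rot_entry_le (hR : R ∈ Matrix.specialOrthogonalGroup (Fin 3) ℝ) (i j : Fin 3) :
    |R i j| ≤ 1 := by
  have h := rot_row_sq hR i
  rw [← sq_le_one_iff_abs_le_one]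
  fin_cases j <;> simp only [Fin.zero_eta, Fin.mk_one, Fin.reduceFinMk] <;>
    nlinarith [sq_nonneg (R i 0), sq_nonneg (R i 1), sq_nonneg (R i 2)]

/-- The attitude error function of a relative rotation. -/
def rotΨ (Q : M3) : ℝ := (1 / 2) * Matrix.trace (1 - Q)

/-- The attitude error vector of a relative rotation. -/
def rotErr (Q : M3) : E3 := (1 / 2 : ℝ) • vee (Q - Qᵀ)

theorem rotΨ_eq (Q : M3) : rotΨ Q = (1 / 2) * (3 - (Q 0 0 + Q 1 1 + Q 2 2)) := by
  simp [rotΨ, Matrix.trace, Fin.sum_univ_three]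

theorem rotErr_zero (Q : M3) : rotErr Q 0 = (1 / 2) * (Q 2 1 - Q 1 2) := by
  simp [rotErr, vee]

theorem rotErr_one (Q : M3) : rotErr Q 1 = (1 / 2) * (Q 0 2 - Q 2 0) := by
  simp [rotErr, vee]

theorem rotErr_two (Q : M3) : rotErr Q 2 = (1 / 2) * (Q 1 0 - Q 0 1) := by
  simp [rotErr, vee]

theorem rotΨ_transpose (Q : M3) : rotΨ Qᵀ = rotΨ Q := by
  simp [rotΨ_eq]

theorem rotΨ_nonneg (hQ : Q ∈ Matrix.specialOrthogonalGroup (Fin 3) ℝ) : 0 ≤ rotΨ Q := by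
  rw [rotΨ_eq]
  have h0 := (abs_le.1 (rot_entry_le hQ 0 0)).2
  have h1 := (abs_le.1 (rot_entry_le hQ 1 1)).2
  have h2 := (abs_le.1 (rot_entry_le hQ 2 2)).2
  linarith

/-- For a rotation by the angle `θ`, `rotΨ` is `1 - cos θ` and the error vector has length `|sin
θ|`. The error vector controls `rotΨ` only away from `rotΨ = 2`, which is why `Ψ_R` has to be kept
below `3 / 2` later. -/
theorem norm_rotErr_sq (hQ : Q ∈ Matrix.specialOrthogonalGroup (Fin 3) ℝ) :
    ‖rotErr Q‖ ^ 2 = rotΨ Q * (2 - rotΨ Q) := by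
  obtain ⟨⟨h1, -, -⟩, ⟨-, h5, -⟩, -, -, h9⟩ := rot_cofactor hQ
  have r0 := rot_row_sq hQ 0
  have r1 := rot_row_sq hQ 1
  have r2 := rot_row_sq hQ 2
  rw [norm_sq_eq, rotErr_zero, rotErr_one, rotErr_two, rotΨ_eq]
  linear_combination (1 / 4) * (r0 + r1 + r2) + (1 / 2) * (-h1 - h5 - h9)

/-- Row `i` of `Q - 1` has squared length `2 - 2 Q i i`, so the squared Frobenius norm of `Q - 1` is
`4 * rotΨ Q`; the rest is Cauchy–Schwarz in each row. -/
theorem norm_act_sub_self_le (hQ : Q ∈ Matrix.specialOrthogonalGroup (Fin 3) ℝ) (a : E3) :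
    ‖act Q a - a‖ ≤ 2 * √(rotΨ Q) * ‖a‖ := by
  apply le_of_sq_le_sq _ (by positivity)
  have hs : (2 * √(rotΨ Q) * ‖a‖) ^ 2 = 4 * rotΨ Q * ‖a‖ ^ 2 := by
    rw [mul_pow, mul_pow, Real.sq_sqrt (rotΨ_nonneg hQ)]; ring
  rw [hs, norm_sq_eq, norm_sq_eq, rotΨ_eq]
  simp only [PiLp.sub_apply, act_apply]
  have r0 := rot_row_sq hQ 0
  have r1 := rot_row_sq hQ 1
  have r2 := rot_row_sq hQ 2
  have cs : ∀ x y z : ℝ, (x * a 0 + y * a 1 + z * a 2) ^ 2 ≤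
      (x ^ 2 + y ^ 2 + z ^ 2) * (a 0 ^ 2 + a 1 ^ 2 + a 2 ^ 2) := by
    intro x y z
    nlinarith [sq_nonneg (x * a 1 - y * a 0), sq_nonneg (x * a 2 - z * a 0),
      sq_nonneg (y * a 2 - z * a 1)]
  have c0 := cs (Q 0 0 - 1) (Q 0 1) (Q 0 2)
  have c1 := cs (Q 1 0) (Q 1 1 - 1) (Q 1 2)
  have c2 := cs (Q 2 0) (Q 2 1) (Q 2 2 - 1)
  have e0 : (Q 0 0 - 1) ^ 2 + Q 0 1 ^ 2 + Q 0 2 ^ 2 = 2 - 2 * Q 0 0 := by linarith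
  have e1 : Q 1 0 ^ 2 + (Q 1 1 - 1) ^ 2 + Q 1 2 ^ 2 = 2 - 2 * Q 1 1 := by linarith
  have e2 : Q 2 0 ^ 2 + Q 2 1 ^ 2 + (Q 2 2 - 1) ^ 2 = 2 - 2 * Q 2 2 := by linarith
  rw [e0] at c0; rw [e1] at c1; rw [e2] at c2
  linarith

end Rotation

/-! ### Derivatives of products, of rotated vectors and of attitude errors. -/

section Calculus

variable {I : Set ℝ} {t : ℝ}

theorem hasDerivWithinAt_E3 {f : ℝ → E3} {f' : E3} :
    HasDerivWithinAt f f' I t ↔ ∀ i, HasDerivWithinAt (fun s => f s i) (f' i) I t := by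
  constructor
  · intro h i
    exact (PiLp.hasFDerivAt_apply (𝕜 := ℝ) 2 (f t) i).comp_hasDerivWithinAt t h
  · intro h
    have h' : HasDerivWithinAt (fun s => (f s).ofLp) f'.ofLp I t := hasDerivWithinAt_pi.2 h
    exact (PiLp.hasFDerivAt_toLp (𝕜 := ℝ) 2 _).comp_hasDerivWithinAt t h'

theorem hasDerivWithinAt_E3' {f : ℝ → E3} {f' : E3} :
    HasDerivWithinAt f f' I t ↔ HasDerivWithinAt (fun s => f s 0) (f' 0) I t ∧
      HasDerivWithinAt (fun s => f s 1) (f' 1) I t ∧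
      HasDerivWithinAt (fun s => f s 2) (f' 2) I t := by
  rw [hasDerivWithinAt_E3, Fin.forall_fin_succ, Fin.forall_fin_two]
  rfl

theorem hasDerivWithinAt_dot {f g : ℝ → E3} {f' g' : E3} (hf : HasDerivWithinAt f f' I t)
    (hg : HasDerivWithinAt g g' I t) :
    HasDerivWithinAt (fun s => dot (f s) (g s)) (dot f' (g t) + dot (f t) g') I t := by
  have := HasDerivWithinAt.inner ℝ hf hg
  rw [_root_.add_comm] at this
  exact this

theorem hasDerivWithinAt_cross {f g : ℝ → E3} {f' g' : E3} (hf : HasDerivWithinAt f f' I t)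
    (hg : HasDerivWithinAt g g' I t) :
    HasDerivWithinAt (fun s => cross (f s) (g s)) (cross f' (g t) + cross (f t) g') I t := by
  have F := hasDerivWithinAt_E3.1 hf
  have G := hasDerivWithinAt_E3.1 hg
  rw [hasDerivWithinAt_E3']
  simp only [cross_zero_apply, cross_one_apply, cross_two_apply, PiLp.add_apply]
  refine ⟨?_, ?_, ?_⟩
  · exact (((F 1).mul (G 2)).sub ((F 2).mul (G 1))).congr_deriv (by ring)
  · exact (((F 2).mul (G 0)).sub ((F 0).mul (G 2))).congr_deriv (by ring)
  · exact (((F 0).mul (G 1)).sub ((F 1).mul (G 0))).congr_deriv (by ring)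

theorem hasDerivWithinAt_act_const (A : M3) {f : ℝ → E3} {f' : E3}
    (hf : HasDerivWithinAt f f' I t) :
    HasDerivWithinAt (fun s => act A (f s)) (act A f') I t :=
  (LinearMap.toContinuousLinearMap (actLin A)).hasFDerivAt.comp_hasDerivWithinAt t hf

theorem hasDerivWithinAt_act {A : ℝ → M3} {A' : M3} {f : ℝ → E3} {f' : E3}
    (hA : ∀ i k, HasDerivWithinAt (fun s => A s i k) (A' i k) I t)
    (hf : HasDerivWithinAt f f' I t) :
    HasDerivWithinAt (fun s => act (A s) (f s)) (act A' (f t) + act (A t) f') I t := by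
  have F := hasDerivWithinAt_E3.1 hf
  rw [hasDerivWithinAt_E3]
  intro i
  simp only [act_apply, PiLp.add_apply]
  exact ((((hA i 0).mul (F 0)).add ((hA i 1).mul (F 1))).add ((hA i 2).mul (F 2))).congr_deriv
    (by ring)

theorem hasDerivWithinAt_transpose {A : ℝ → M3} {A' : M3}
    (hA : ∀ i k, HasDerivWithinAt (fun s => A s i k) (A' i k) I t) :
    ∀ i k, HasDerivWithinAt (fun s => (A s)ᵀ i k) (A'ᵀ i k) I t := fun i k => hA k i

theorem hasDerivWithinAt_matrix_mul {A B : ℝ → M3} {A' B' : M3}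
    (hA : ∀ i k, HasDerivWithinAt (fun s => A s i k) (A' i k) I t)
    (hB : ∀ i k, HasDerivWithinAt (fun s => B s i k) (B' i k) I t) :
    ∀ i k, HasDerivWithinAt (fun s => (A s * B s) i k) ((A' * B t + A t * B') i k) I t := by
  intro i k
  simp only [Matrix.mul_apply, Fin.sum_univ_three, Matrix.add_apply]
  exact ((((hA i 0).mul (hB 0 k)).add ((hA i 1).mul (hB 1 k))).add
    ((hA i 2).mul (hB 2 k))).congr_deriv (by ring)

theorem hat_transpose (a : E3) : (hat a)ᵀ = -hat a := by
  ext i j; fin_cases i <;> fin_cases j <;> simp [hat]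

/-- Derivative of a vector rotated into the inertial frame. -/
theorem hasDerivWithinAt_act_rot {A : ℝ → M3} {w : E3} {f : ℝ → E3} {f' : E3}
    (hA : ∀ i k, HasDerivWithinAt (fun s => A s i k) ((A t * hat w) i k) I t)
    (hf : HasDerivWithinAt f f' I t) :
    HasDerivWithinAt (fun s => act (A s) (f s))
      (act (A t) (cross w (f t) + f')) I t := by
  refine (hasDerivWithinAt_act hA hf).congr_deriv ?_
  rw [act_mul, act_hat, act_add]

/-- Derivative of a vector rotated into the body frame. -/
theorem hasDerivWithinAt_act_rot_transpose {A : ℝ → M3} {w : E3} {f : ℝ → E3} {f' : E3}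
    (hA : ∀ i k, HasDerivWithinAt (fun s => A s i k) ((A t * hat w) i k) I t)
    (hf : HasDerivWithinAt f f' I t) :
    HasDerivWithinAt (fun s => act (A s)ᵀ (f s))
      (-cross w (act (A t)ᵀ (f t)) + act (A t)ᵀ f')
      I t := by
  refine (hasDerivWithinAt_act (hasDerivWithinAt_transpose hA) hf).congr_deriv ?_
  rw [Matrix.transpose_mul, hat_transpose, neg_mul, ← act_hat, ← act_mul]
  congr 1
  rw [show -(hat w * (A t)ᵀ) = (-1 : ℝ) • (hat w * (A t)ᵀ) by simp, smul_act]; simp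

theorem rotΨ_hasDeriv {Q : ℝ → M3} {e : E3}
    (hQ : ∀ i k, HasDerivWithinAt (fun s => Q s i k) ((Q t * hat e) i k) I t) :
    HasDerivWithinAt (fun s => rotΨ (Q s)) (dot (rotErr (Q t)) e) I t := by
  simp only [rotΨ_eq]
  refine (((((hQ 0 0).add (hQ 1 1)).add (hQ 2 2)).const_sub 3).const_mul (1 / 2)).congr_deriv ?_
  simp only [dot_eq, rotErr_zero, rotErr_one, rotErr_two, Matrix.mul_apply, Fin.sum_univ_three]
  simp [hat]; ring

/-- The derivative of the attitude error vector of the relative rotation `Q` whose relative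
angular velocity is `e`. -/
def rotErrDeriv (Q : M3) (e : E3) : E3 := rotErr (Q * hat e)

theorem rotErr_hasDeriv {Q : ℝ → M3} {e : E3}
    (hQ : ∀ i k, HasDerivWithinAt (fun s => Q s i k) ((Q t * hat e) i k) I t) :
    HasDerivWithinAt (fun s => rotErr (Q s)) (rotErrDeriv (Q t) e) I t := by
  rw [hasDerivWithinAt_E3']
  simp only [rotErrDeriv, rotErr_zero, rotErr_one, rotErr_two]
  exact ⟨((hQ 2 1).sub (hQ 1 2)).const_mul _, ((hQ 0 2).sub (hQ 2 0)).const_mul _,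
    ((hQ 1 0).sub (hQ 0 1)).const_mul _⟩

theorem abs_apply_le_norm (e : E3) (i : Fin 3) : |e i| ≤ ‖e‖ := PiLp.norm_apply_le e i

theorem norm_rotErrDeriv_le {Q : M3} (hQ : Q ∈ Matrix.specialOrthogonalGroup (Fin 3) ℝ) (e : E3) :
    ‖rotErrDeriv Q e‖ ≤ 4 * ‖e‖ := by
  have hp : ∀ i j k, |Q i j * e k| ≤ ‖e‖ := fun i j k => by
    rw [abs_mul]
    calc |Q i j| * |e k| ≤ 1 * ‖e‖ :=
          mul_le_mul (rot_entry_le hQ i j) (abs_apply_le_norm e k) (abs_nonneg _) zero_le_one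
      _ = ‖e‖ := one_mul _
  have hc : ∀ a b c d : ℝ, |a| ≤ ‖e‖ → |b| ≤ ‖e‖ → |c| ≤ ‖e‖ → |d| ≤ ‖e‖ →
      (1 / 2 * (a + b - (c + d))) ^ 2 ≤ 4 * ‖e‖ ^ 2 := by
    intro a b c d ha hb hc hd
    rw [abs_le] at ha hb hc hd
    nlinarith [norm_nonneg e]
  apply le_of_sq_le_sq _ (by positivity)
  rw [norm_sq_eq]
  simp only [rotErrDeriv, rotErr_zero, rotErr_one, rotErr_two, Matrix.mul_apply,
    Fin.sum_univ_three]
  simp only [hat, Matrix.of_apply, Matrix.cons_val', Matrix.cons_val_zero, Matrix.cons_val_one,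
    Matrix.cons_val_two, Matrix.head_cons, Matrix.tail_cons]
  have n := fun i j k => (abs_neg (Q i j * e k)).le.trans (hp i j k)
  have h0 := hc _ _ _ _ (n 2 0 2) (hp 2 2 0) (hp 1 0 1) (n 1 1 0)
  have h1 := hc _ _ _ _ (hp 0 0 1) (n 0 1 0) (hp 2 1 2) (n 2 2 1)
  have h2 := hc _ _ _ _ (hp 1 1 2) (n 1 2 1) (n 0 0 2) (hp 0 2 0)
  nlinarith [norm_nonneg e]

end Calculus

/-! ### Cancellations produced by the control law. -/

section CableAlgebra

variable {q a w ω δ μ : E3} {mQ L : ℝ}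

theorem cross_cross_cross_unit (hq : ‖q‖ = 1) (a : E3) :
    cross q (cross q (cross q a)) = -cross q a := by
  rw [cross_cross, dot_cross_self_left, dot_self, hq]; simp

/-- A thrust with perpendicular part `m_Q L q̂ w - m_Q q̂² a` cancels the cable dynamics up to `w`. -/
theorem cable_accel_eq (hq : ‖q‖ = 1) (hm : mQ ≠ 0) (hL : L ≠ 0) (k : ℝ)
    (hw : dot q w = 0) :
    (1 / L) • cross q (a - (1 / mQ) • (k • q + ((mQ * L) • cross q w - mQ • cross q (cross q a))))
      = w := by
  have h1 : cross q (cross q w) = -w := by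
    rw [cross_cross, hw, dot_self, hq]; simp
  rw [cross_sub, cross_smul, cross_add, cross_sub, cross_smul, cross_smul, cross_smul, cross_self,
    cross_cross_cross_unit hq, h1]
  simp only [smul_sub, smul_add, smul_neg, smul_smul, smul_zero]
  have e1 : 1 / L * (1 / mQ * (mQ * L)) = 1 := by field_simp
  have e2 : 1 / L * (1 / mQ * mQ) = 1 / L := by field_simp
  rw [e1, e2]; module

/-- The thrust that produces `w` cancels the inertial reaction to `w`, the `‖ω‖²` term cancels the
centripetal acceleration, and the two parts containing `a` recombine to `mQ • a`. The result does
not contain `w`: the cable gains do not enter the load dynamics, so they can be chosen after the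
load gains. -/
theorem cable_force_eq (hq : ‖q‖ = 1) (hω : dot ω q = 0) :
    ((dot q μ) • q + (mQ * L * ‖ω‖ ^ 2) • q + (mQ * dot q a) • q
        + ((mQ * L) • cross q w - mQ • cross q (cross q a)))
      - mQ • a + (mQ * L) • (cross (w + δ) q + cross ω (cross ω q))
      = dot q μ • q + (mQ * L) • cross δ q := by
  rw [cross_cross ω ω q, hω, cross_cross q q a, dot_self, hq, add_cross, cross_anticomm w q, dot_self]
  module

end CableAlgebra

/-! ### Closed-loop dynamics of the cables and of the load. -/

section ClosedLoop

variable {S : Params} {D : Desired} {K : Gains} {M : Motion} {δx δR : ℝ → E3}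
  {δq : Fin 4 → ℝ → E3} {t₀ t₁ t : ℝ}

/-- The attitude of the load relative to the desired attitude. -/
def relRot (D : Desired) (M : Motion) (t : ℝ) : M3 := (D.R t)ᵀ * M.R t

theorem relRot_transpose : (relRot D M t)ᵀ = (M.R t)ᵀ * D.R t := by
  simp [relRot]

theorem errR_eq : errR D M t = rotErr (relRot D M t) := by
  rw [rotErr, relRot_transpose]; rfl

theorem transportedΩ_eq : transportedΩ D M t = act (relRot D M t)ᵀ (D.Ω t) := by
  rw [relRot_transpose]; rfl

/-- The force `(q_j q_jᵀ - I) μ̃_j + m_Q L δ_j × q_j`: what cable `j` exerts on the load in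
excess of the commanded force. -/
def cablePert (S : Params) (D : Desired) (K : Gains) (M : Motion) (δq : Fin 4 → ℝ → E3)
    (j : Fin 4) (t : ℝ) : E3 :=
  cross (M.q j t) (cross (M.q j t) (desTension S D K M j t))
    + (S.mQ * S.L) • cross (δq j t) (M.q j t)

/-- The commanded cable angular acceleration. -/
def cableCmd (S : Params) (D : Desired) (K : Gains) (M : Motion) (j : Fin 4) (t : ℝ) : E3 :=
  -(K.kq • errQ S D K M j t) - K.kω • errω M j t
    - dot (M.q j t) (M.ωd j t) • cross (M.ω j t) (M.q j t)
    - cross (M.q j t) (cross (M.q j t) (M.dωd j t))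

theorem accel_eq (j : Fin 4) :
    M.dv t + act (M.R t * (hat (M.Ω t) * hat (M.Ω t) + hat (M.dΩ t))) (S.r j) + S.g • e3
      = accel S M j t := by
  have : act (hat (M.dΩ t)) (S.r j) = -act (hat (S.r j)) (M.dΩ t) := cross_anticomm _ _
  rw [accel, act_mul, add_act, act_add, this, act_neg, act_mul (M.R t * hat (M.Ω t)),
    act_mul (M.R t) (hat (M.Ω t)), act_mul (hat (M.Ω t)), act_mul (M.R t) (hat (S.r j))]
  abel

theorem control_eq (j : Fin 4) :
    control S D K M j t =
      dot (M.q j t) (desTension S D K M j t) • M.q j t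
        + (S.mQ * S.L * ‖M.ω j t‖ ^ 2) • M.q j t
        + (S.mQ * dot (M.q j t) (accel S M j t)) • M.q j t
      + ((S.mQ * S.L) • cross (M.q j t) (cableCmd S D K M j t)
        - S.mQ • cross (M.q j t) (cross (M.q j t) (accel S M j t))) := by
  rw [control, uPar, uPerp, act_mul, act_mul]
  rfl

theorem errω_eq (j : Fin 4) :
    errω M j t = M.ω j t + cross (M.q j t) (cross (M.q j t) (M.ωd j t)) := by
  rw [errω, act_mul]; rfl

variable (h : IsTrajectory S D K M δx δR δq (Set.Ico t₀ t₁)) (ht : t ∈ Set.Ico t₀ t₁)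
include h ht

theorem relRot_mem : relRot D M t ∈ Matrix.specialOrthogonalGroup (Fin 3) ℝ :=
  mul_mem (rot_transpose_mem (D.R_mem t)) (h.R_mem t ht)

theorem dot_q_errω (j : Fin 4) : dot (M.q j t) (errω M j t) = 0 := by
  rw [errω_eq, dot_add, dot_comm, h.ω_tangent t ht j, dot_cross_self_left, add_zero]

theorem dot_q_cableCmd (j : Fin 4) : dot (M.q j t) (cableCmd S D K M j t) = 0 := by
  rw [cableCmd, dot_sub, dot_sub, dot_sub, dot_neg, dot_smul, dot_smul, dot_smul,
    dot_q_errω h ht, errQ, dot_cross_self_right, dot_cross_self_right, dot_cross_self_left]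
  ring

theorem dω_eq (j : Fin 4) : M.dω j t = cableCmd S D K M j t + δq j t := by
  have e : ∀ u : E3, M.dv t + act (M.R t * (hat (M.Ω t) * hat (M.Ω t) + hat (M.dΩ t))) (S.r j)
      + S.g • e3 - u = accel S M j t - u := fun u => by rw [accel_eq]
  rw [h.ω_dyn t ht j, e, control_eq, ← add_smul, ← add_smul, act_hat,
    cable_accel_eq (h.q_norm t ht j) S.mQ_pos.ne' S.L_pos.ne' _ (dot_q_cableCmd h ht j)]

/-- Derivatives within a half-open interval are unique, also at its left end, so the product rule
identifies the cable acceleration. -/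
theorem ddq_eq (j : Fin 4) :
    M.ddq j t = cross (M.dω j t) (M.q j t) + cross (M.ω j t) (cross (M.ω j t) (M.q j t)) := by
  have h1 := hasDerivWithinAt_cross (h.ω_deriv t ht j) (h.q_kin t ht j)
  exact (uniqueDiffOn_Ico t₀ t₁ t ht).eq_deriv _ (h.dq_deriv t ht j) h1

theorem cable_force (j : Fin 4) :
    control S D K M j t - S.mQ • accel S M j t + (S.mQ * S.L) • M.ddq j t
      = desTension S D K M j t + cablePert S D K M δq j t := by
  have hq := h.q_norm t ht j
  rw [ddq_eq h ht, dω_eq h ht, control_eq, cable_force_eq hq (h.ω_tangent t ht j),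
    cablePert, cross_cross _ _ (desTension S D K M j t), dot_self, hq]
  module

/-- The inertial and gravity terms of the four quadrotors account for the part `4 * mQ` of the
effective mass, leaving the bare mass of the load. -/
theorem load_force :
    S.mL • (M.dv t + S.g • e3) =
      ∑ j, desTension S D K M j t + (∑ j, cablePert S D K M δq j t + δx t) := by
  rw [← add_assoc, ← Finset.sum_add_distrib]
  have hv := h.v_dyn t ht
  have hs : ∀ j, control S D K M j t
      - S.mQ • act (M.R t * (hat (M.Ω t) * hat (M.Ω t) + hat (M.dΩ t))) (S.r j)
      + (S.mQ * S.L) • M.ddq j t = desTension S D K M j t + cablePert S D K M δq j t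
        + S.mQ • (M.dv t + S.g • e3) := fun j => by
    rw [← cable_force h ht, ← accel_eq]; module
  rw [Finset.sum_congr rfl fun j _ => hs j, Finset.sum_add_distrib, Params.mEff] at hv
  simp only [Finset.sum_const, Finset.card_univ, Fintype.card_fin] at hv
  have e : ∀ a b d : E3, (4 * S.mQ + S.mL) • a = b + 4 • S.mQ • a + d → S.mL • a = b + d := by
    intro a b d hh
    rw [← sub_eq_zero] at hh ⊢
    rw [← hh]; module
  exact e _ _ _ hv

theorem load_moment :
    act S.J (M.dΩ t) + cross (M.Ω t) (act S.J (M.Ω t)) =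
      ∑ j, cross (S.r j) (act (M.R t)ᵀ (desTension S D K M j t))
      + (∑ j, cross (S.r j) (act (M.R t)ᵀ (cablePert S D K M δq j t)) + δR t) := by
  have hΩ := h.Ω_dyn t ht
  have hRR := rot_transpose_mul (h.R_mem t ht)
  have hs : ∀ j, S.mQ • act (hat (S.r j) * (M.R t)ᵀ)
      (-(S.g • e3) - M.dv t + S.L • M.ddq j t + (1 / S.mQ) • control S D K M j t)
      = cross (S.r j) (act (M.R t)ᵀ (desTension S D K M j t))
        + cross (S.r j) (act (M.R t)ᵀ (cablePert S D K M δq j t))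
        + S.mQ • cross (S.r j) (cross (M.Ω t) (cross (M.Ω t) (S.r j))
          + cross (M.dΩ t) (S.r j)) := fun j => by
    have e1 : S.mQ • (-(S.g • e3) - M.dv t + S.L • M.ddq j t + (1 / S.mQ) • control S D K M j t)
        = desTension S D K M j t + cablePert S D K M δq j t
          + S.mQ • act (M.R t) (cross (M.Ω t) (cross (M.Ω t) (S.r j))
          + cross (M.dΩ t) (S.r j)) := by
      rw [← cable_force h ht, ← accel_eq, act_mul, add_act, act_mul]
      have : S.mQ • (1 / S.mQ) • control S D K M j t = control S D K M j t := by
        rw [smul_smul, mul_one_div_cancel S.mQ_pos.ne', one_smul]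
      rw [smul_add, this]
      simp only [act_hat]
      module
    rw [← act_smul, e1, act_mul, act_hat, act_add, act_add, act_smul, ← act_mul, hRR, one_act,
      cross_add, cross_add, cross_smul]
  have hJ : ∀ a, act S.JEff a = act S.J a - ∑ j, S.mQ • cross (S.r j) (cross (S.r j) a) := by
    intro a
    rw [Params.JEff, sub_act, sum_act]
    congr 1
    exact Finset.sum_congr rfl fun j _ => by rw [smul_act, act_mul]; rfl
  rw [Finset.sum_congr rfl fun j _ => hs j, Finset.sum_add_distrib, Finset.sum_add_distrib,
    act_mul, act_hat, hJ, hJ, cross_sub] at hΩ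
  have hc : cross (M.Ω t) (∑ j, S.mQ • cross (S.r j) (cross (S.r j) (M.Ω t)))
      = ∑ j, S.mQ • cross (M.Ω t) (cross (S.r j) (cross (S.r j) (M.Ω t))) := by
    rw [cross, act_sum]
    exact Finset.sum_congr rfl fun j _ => by rw [act_smul]; rfl
  -- The inertial moments of the quadrotors are exactly the contribution of `-∑ m_Q r̂_j²` to the
  -- effective inertia; the nonlinear part rests on `r × (Ω × (Ω × r)) = -Ω × (r × (r × Ω))`.
  have key : ∑ j, S.mQ • cross (S.r j) (cross (M.Ω t) (cross (M.Ω t) (S.r j))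
          + cross (M.dΩ t) (S.r j)) =
      -∑ j, S.mQ • cross (S.r j) (cross (S.r j) (M.dΩ t))
      - ∑ j, S.mQ • cross (M.Ω t) (cross (S.r j) (cross (S.r j) (M.Ω t))) := by
    rw [← Finset.sum_neg_distrib, ← Finset.sum_sub_distrib]
    refine Finset.sum_congr rfl fun j _ => ?_
    simp only [E3.ext_iff, cross_zero_apply, cross_one_apply, cross_two_apply, PiLp.add_apply,
      PiLp.sub_apply, PiLp.smul_apply, PiLp.neg_apply, smul_eq_mul]
    refine ⟨?_, ?_, ?_⟩ <;> ring
  rw [hc, key] at hΩ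
  rw [← sub_eq_zero] at hΩ ⊢
  rw [← hΩ]; abel

end ClosedLoop

/-! ### The right inverse of the grasp matrix and the distribution among the cables. -/

section Distribution

variable (S : Params)

/-- The right inverse `Pᵀ (P Pᵀ)⁻¹` of the grasp matrix. -/
def graspInv : Matrix (Fin 4 × Fin 3) (Fin 3 ⊕ Fin 3) ℝ :=
  (grasp S.r)ᵀ * (grasp S.r * (grasp S.r)ᵀ)⁻¹

/-- `P Pᵀ` has the rank of `P`, hence full rank `6`, and is invertible. The two block rows of this
identity yield `sum_share` and `sum_cross_share`. -/
theorem grasp_mul_graspInv : grasp S.r * graspInv S = 1 := by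
  have hr : (grasp S.r * (grasp S.r)ᵀ).rank = 6 := by
    rw [Matrix.rank_self_mul_transpose, S.rank_grasp]
  have hu : IsUnit (grasp S.r * (grasp S.r)ᵀ) := by
    rw [← Matrix.mulVec_surjective_iff_isUnit]
    have ht : LinearMap.range (grasp S.r * (grasp S.r)ᵀ).mulVecLin = ⊤ := by
      apply Submodule.eq_top_of_finrank_eq
      rw [show Module.finrank ℝ
        (LinearMap.range (grasp S.r * (grasp S.r)ᵀ).mulVecLin) = 6 from hr]
      simp
    exact LinearMap.range_eq_top.1 ht
  rw [graspInv, ← Matrix.mul_assoc]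
  exact Matrix.mul_nonsing_inv _ ((Matrix.isUnit_iff_isUnit_det _).1 hu)

/-- The share of cable `j` in the minimum-norm distribution of a force and a moment. -/
def share (j : Fin 4) : E3 × E3 →ₗ[ℝ] E3 where
  toFun p := WithLp.toLp 2 fun i => (graspInv S *ᵥ Sum.elim p.1.ofLp p.2.ofLp) (j, i)
  map_add' p p' := by
    have : Sum.elim (p + p').1.ofLp (p + p').2.ofLp
        = Sum.elim p.1.ofLp p.2.ofLp + Sum.elim p'.1.ofLp p'.2.ofLp := by
      ext i; cases i <;> simp
    ext i
    simp only [this, Matrix.mulVec_add]; rfl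
  map_smul' k p := by
    have : Sum.elim (k • p).1.ofLp (k • p).2.ofLp = k • Sum.elim p.1.ofLp p.2.ofLp := by
      ext i; cases i <;> simp
    ext i
    simp only [this, Matrix.mulVec_smul]; rfl

theorem sum_share (p : E3 × E3) : ∑ j, share S j p = p.1 := by
  have h : grasp S.r *ᵥ (graspInv S *ᵥ Sum.elim p.1.ofLp p.2.ofLp)
      = Sum.elim p.1.ofLp p.2.ofLp := by
    rw [Matrix.mulVec_mulVec, grasp_mul_graspInv, Matrix.one_mulVec]
  ext i
  have hi := congrFun h (Sum.inl i)
  simp only [Matrix.mulVec, dotProduct, grasp, Sum.elim_inl, Matrix.of_apply,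
    Fintype.sum_prod_type, Matrix.one_apply, ite_mul, one_mul, zero_mul, Finset.sum_ite_eq,
    Finset.mem_univ, if_true] at hi
  rw [← hi]
  simp [share, Matrix.mulVec, dotProduct]

theorem sum_cross_share (p : E3 × E3) : ∑ j, cross (S.r j) (share S j p) = p.2 := by
  have h : grasp S.r *ᵥ (graspInv S *ᵥ Sum.elim p.1.ofLp p.2.ofLp)
      = Sum.elim p.1.ofLp p.2.ofLp := by
    rw [Matrix.mulVec_mulVec, grasp_mul_graspInv, Matrix.one_mulVec]
  ext i
  have hi := congrFun h (Sum.inr i)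
  rw [Sum.elim_inr] at hi
  rw [← hi, Matrix.mulVec, dotProduct, Fintype.sum_prod_type]
  simp only [WithLp.ofLp_sum, Finset.sum_apply]
  refine Finset.sum_congr rfl fun j _ => ?_
  simp [cross, act, share, grasp, Matrix.mulVec, dotProduct]

theorem exists_norm_share_le :
    ∃ C : ℝ, 0 < C ∧ ∀ j p, ‖share S j p‖ ≤ C * (‖p.1‖ + ‖p.2‖) := by
  choose c hc hb using fun j => (LinearMap.toContinuousLinearMap (share S j)).bound
  refine ⟨∑ j, c j, Finset.sum_pos (fun j _ => hc j) Finset.univ_nonempty, fun j p => ?_⟩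
  have h1 : ‖p‖ ≤ ‖p.1‖ + ‖p.2‖ := by
    rw [Prod.norm_def]
    exact max_le (by linarith [norm_nonneg p.2]) (by linarith [norm_nonneg p.1])
  calc ‖share S j p‖ ≤ c j * ‖p‖ := hb j p
    _ ≤ (∑ j, c j) * (‖p.1‖ + ‖p.2‖) := by
        apply mul_le_mul _ h1 (norm_nonneg _) (Finset.sum_nonneg fun j _ => (hc j).le)
        exact Finset.single_le_sum (fun j _ => (hc j).le) (Finset.mem_univ j)

theorem hasDerivWithinAt_share {f g : ℝ → E3} {f' g' : E3} {I : Set ℝ} {t : ℝ} (j : Fin 4)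
    (hf : HasDerivWithinAt f f' I t) (hg : HasDerivWithinAt g g' I t) :
    HasDerivWithinAt (fun s => share S j (f s, g s)) (share S j (f', g')) I t :=
  (LinearMap.toContinuousLinearMap (share S j)).hasFDerivAt.comp_hasDerivWithinAt t
    (hf.prodMk hg)

end Distribution

/-! ### Error dynamics of the load. -/

section Errors

variable {S : Params} {D : Desired} {K : Gains} {M : Motion} {δx δR : ℝ → E3}
  {δq : Fin 4 → ℝ → E3} {t₀ t₁ t : ℝ}

theorem desTension_eq (j : Fin 4) :
    desTension S D K M j t =
      act (M.R t) (share S j (act (M.R t)ᵀ (desForce S D K M t), desMoment S D K M t)) := rfl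

theorem desMoment_eq :
    desMoment S D K M t = -(K.kR • errR D M t) - K.kΩ • errΩ D M t
      + cross (transportedΩ D M t) (act S.J (transportedΩ D M t))
      + act S.J (act (relRot D M t)ᵀ (deriv D.Ω t)) := by
  rw [desMoment, relRot_transpose, Matrix.mul_assoc, act_mul]

theorem hat_sub (a b : E3) : hat (a - b) = hat a - hat b := by
  ext i j; fin_cases i <;> fin_cases j <;> simp [hat] <;> ring

theorem Desired.hasDerivAt_v (D : Desired) (t : ℝ) :
    HasDerivAt (deriv D.x) (iteratedDeriv 2 D.x t) t := by
  have h := (D.x_smooth.differentiable_iteratedDeriv 1 (by norm_num)) t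
  have := h.hasDerivAt
  rwa [← iteratedDeriv_succ, iteratedDeriv_one] at this

theorem Desired.hasDerivAt_dv (D : Desired) (t : ℝ) :
    HasDerivAt (iteratedDeriv 2 D.x) (iteratedDeriv 3 D.x t) t := by
  have h := (D.x_smooth.differentiable_iteratedDeriv 2 (by norm_num)) t
  have := h.hasDerivAt
  rwa [← iteratedDeriv_succ] at this

theorem Desired.hasDerivAt_x (D : Desired) (t : ℝ) : HasDerivAt D.x (deriv D.x t) t :=
  ((D.x_smooth.differentiable (by norm_num)) t).hasDerivAt

theorem Desired.hasDerivAt_Ω (D : Desired) (t : ℝ) : HasDerivAt D.Ω (deriv D.Ω t) t :=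
  ((D.Ω_smooth.differentiable (by norm_num)) t).hasDerivAt

theorem Desired.hasDerivAt_dΩ (D : Desired) (t : ℝ) :
    HasDerivAt (deriv D.Ω) (iteratedDeriv 2 D.Ω t) t := by
  have h := (D.Ω_smooth.differentiable_iteratedDeriv 1 (by norm_num)) t
  have := h.hasDerivAt
  rwa [← iteratedDeriv_succ, iteratedDeriv_one] at this

variable (h : IsTrajectory S D K M δx δR δq (Set.Ico t₀ t₁)) (ht : t ∈ Set.Ico t₀ t₁)
include h ht

theorem sum_desTension : ∑ j, desTension S D K M j t = desForce S D K M t := by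
  simp only [desTension_eq]
  rw [← act_sum, sum_share, ← act_mul, rot_mul_transpose (h.R_mem t ht), one_act]

theorem sum_cross_desTension :
    ∑ j, cross (S.r j) (act (M.R t)ᵀ (desTension S D K M j t)) = desMoment S D K M t := by
  simp only [desTension_eq, ← act_mul, rot_transpose_mul (h.R_mem t ht), one_act]
  rw [sum_cross_share]

theorem errX_deriv : HasDerivWithinAt (errX D M) (errV D M t) (Set.Ico t₀ t₁) t :=
  (h.x_kin t ht).sub (D.hasDerivAt_x t).hasDerivWithinAt

theorem errV_deriv :
    HasDerivWithinAt (errV D M) (-(K.kx • errX D M t) - K.kv • errV D M t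
      + (1 / S.mL) • (∑ j, cablePert S D K M δq j t + δx t)) (Set.Ico t₀ t₁) t := by
  refine ((h.v_deriv t ht).sub (D.hasDerivAt_v t).hasDerivWithinAt).congr_deriv ?_
  have hf := load_force h ht
  rw [sum_desTension h ht, desForce] at hf
  have hm := S.mL_pos.ne'
  have := congrArg (fun y => (1 / S.mL) • y) hf
  simp only [smul_add (1 / S.mL) (S.mL • _), smul_smul, one_div_mul_cancel hm, one_smul] at this
  rw [← sub_eq_zero] at this ⊢
  rw [← this]; module

/-- Conjugating the desired angular velocity by the relative rotation moves it to the right of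
`relRot`, where it combines with the actual one to `errΩ`. Thus the attitude error obeys the plain
kinematics of a rotation. -/
theorem relRot_deriv (i k : Fin 3) :
    HasDerivWithinAt (fun s => relRot D M s i k) ((relRot D M t * hat (errΩ D M t)) i k)
      (Set.Ico t₀ t₁) t := by
  have h1 := hasDerivWithinAt_matrix_mul
    (hasDerivWithinAt_transpose fun i k => (D.R_kin t i k).hasDerivWithinAt) (h.R_kin t ht) i k
  refine h1.congr_deriv ?_
  have e : (D.R t * hat (D.Ω t))ᵀ * M.R t + (D.R t)ᵀ * (M.R t * hat (M.Ω t))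
      = relRot D M t * hat (errΩ D M t) := by
    rw [errΩ, hat_sub, mul_sub, transportedΩ_eq, rot_mul_hat (relRot_mem h ht) (act _ _), ← act_mul,
      rot_mul_transpose (relRot_mem h ht), one_act, Matrix.transpose_mul, hat_transpose, relRot]
    simp only [Matrix.mul_assoc, neg_mul]
    abel
  rw [e]

theorem errR_deriv :
    HasDerivWithinAt (errR D M) (rotErrDeriv (relRot D M t) (errΩ D M t)) (Set.Ico t₀ t₁) t := by
  have e : errR D M = fun s => rotErr (relRot D M s) := funext fun s => errR_eq
  rw [e]
  exact rotErr_hasDeriv (relRot_deriv h ht)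

theorem ΨR_deriv :
    HasDerivWithinAt (ΨR D M) (dot (errR D M t) (errΩ D M t)) (Set.Ico t₀ t₁) t := by
  rw [errR_eq]
  exact rotΨ_hasDeriv (relRot_deriv h ht)

theorem transportedΩ_deriv :
    HasDerivWithinAt (transportedΩ D M) (-cross (errΩ D M t) (transportedΩ D M t)
      + act (relRot D M t)ᵀ (deriv D.Ω t)) (Set.Ico t₀ t₁) t := by
  have e : transportedΩ D M = fun s => act (relRot D M s)ᵀ (D.Ω s) :=
    funext fun s => transportedΩ_eq
  rw [e]
  exact hasDerivWithinAt_act_rot_transpose (relRot_deriv h ht) (D.hasDerivAt_Ω t).hasDerivWithinAt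

theorem transported_dΩ_deriv :
    HasDerivWithinAt (fun s => act (relRot D M s)ᵀ (deriv D.Ω s))
      (-cross (errΩ D M t) (act (relRot D M t)ᵀ (deriv D.Ω t))
      + act (relRot D M t)ᵀ (iteratedDeriv 2 D.Ω t)) (Set.Ico t₀ t₁) t :=
  hasDerivWithinAt_act_rot_transpose (relRot_deriv h ht) (D.hasDerivAt_dΩ t).hasDerivWithinAt

/-- The derivative of the angular velocity error. -/
def derrΩ (D : Desired) (M : Motion) (t : ℝ) : E3 :=
  M.dΩ t - (-cross (errΩ D M t) (transportedΩ D M t) + act (relRot D M t)ᵀ (deriv D.Ω t))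

theorem errΩ_deriv : HasDerivWithinAt (errΩ D M) (derrΩ D M t) (Set.Ico t₀ t₁) t :=
  (h.Ω_deriv t ht).sub (transportedΩ_deriv h ht)

/-- The feedforward terms of `desMoment` cancel all terms free of errors. Besides the cable
perturbation and the disturbance, each remaining term contains `errR` or `errΩ`. -/
theorem J_derrΩ :
    act S.J (derrΩ D M t) = -(K.kR • errR D M t) - K.kΩ • errΩ D M t
      - cross (errΩ D M t) (act S.J (errΩ D M t))
      - cross (errΩ D M t) (act S.J (transportedΩ D M t))
      - cross (transportedΩ D M t) (act S.J (errΩ D M t))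
      + act S.J (cross (errΩ D M t) (transportedΩ D M t))
      + (∑ j, cross (S.r j) (act (M.R t)ᵀ (cablePert S D K M δq j t)) + δR t) := by
  have hm := load_moment h ht
  rw [sum_cross_desTension h ht, desMoment_eq] at hm
  have hΩ : M.Ω t = errΩ D M t + transportedΩ D M t := by rw [errΩ]; abel
  rw [hΩ, act_add, cross_add, add_cross, add_cross] at hm
  rw [derrΩ, act_sub, act_add, act_neg]
  rw [← sub_eq_zero] at hm ⊢
  rw [← hm]; abel

end Errors

/-! ### Linear differential inequalities and the barrier argument. -/

section Comparison

variable {t₀ t₁ : ℝ}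

/-- Comparison with a scalar linear differential inequality, on the closed interval `[t₀, τ]`. -/
theorem le_exp_decay {W W' : ℝ → ℝ} {σ d τ : ℝ} (hσ : 0 < σ) (h0 : t₀ ≤ τ) (h1 : τ < t₁)
    (hd : ∀ t ∈ Set.Ico t₀ t₁, HasDerivWithinAt W (W' t) (Set.Ico t₀ t₁) t)
    (hW : ∀ t ∈ Set.Ico t₀ τ, W' t ≤ -σ * W t + d) :
    W τ ≤ d / σ + (W t₀ - d / σ) * Real.exp (-(σ * (τ - t₀))) := by
  have hsub : Set.Icc t₀ τ ⊆ Set.Ico t₀ t₁ := fun s hs => ⟨hs.1, hs.2.trans_lt h1⟩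
  have hf : ∀ s ∈ Set.Ico t₀ t₁, HasDerivWithinAt
      (fun s => Real.exp (σ * (s - t₀)) * (W s - d / σ))
      (Real.exp (σ * (s - t₀)) * (σ * 1) * (W s - d / σ) + Real.exp (σ * (s - t₀)) * W' s)
      (Set.Ico t₀ t₁) s := fun s hs =>
    ((((hasDerivWithinAt_id s _).sub_const t₀).const_mul σ).exp).mul ((hd s hs).sub_const _)
  have hint : interior (Set.Icc t₀ τ) = Set.Ioo t₀ τ := interior_Icc
  have hanti := antitoneOn_of_hasDerivWithinAt_nonpos (convex_Icc t₀ τ)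
    (f := fun s => Real.exp (σ * (s - t₀)) * (W s - d / σ))
    (f' := fun s => Real.exp (σ * (s - t₀)) * (σ * 1) * (W s - d / σ)
      + Real.exp (σ * (s - t₀)) * W' s)
    (fun s hs => ((hf s (hsub hs)).continuousWithinAt).mono hsub)
    (fun s hs => (hf s (hsub (interior_subset hs))).mono (interior_subset.trans hsub))
    (fun s hs => by
      rw [hint] at hs
      have hb := hW s ⟨hs.1.le, hs.2⟩
      have e : Real.exp (σ * (s - t₀)) * (σ * 1) * (W s - d / σ)
          + Real.exp (σ * (s - t₀)) * W' s
          = Real.exp (σ * (s - t₀)) * (σ * W s - d + W' s) := by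
        field_simp
      rw [e]
      exact mul_nonpos_of_nonneg_of_nonpos (Real.exp_pos _).le (by linarith))
  have := hanti (Set.left_mem_Icc.2 h0) (Set.right_mem_Icc.2 h0) h0
  simp only [sub_self, mul_zero, Real.exp_zero, one_mul] at this
  have hp := Real.exp_pos (-(σ * (τ - t₀)))
  have hm := mul_le_mul_of_nonneg_right this hp.le
  have he : Real.exp (σ * (τ - t₀)) * Real.exp (-(σ * (τ - t₀))) = 1 := by
    rw [← Real.exp_add]; simp
  have : Real.exp (σ * (τ - t₀)) * (W τ - d / σ) * Real.exp (-(σ * (τ - t₀))) = W τ - d / σ := by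
    rw [mul_right_comm, he, one_mul]
  linarith

/-- A finite family of functions that satisfy dissipation inequalities as long as all of them stay
below their levels, and whose equilibrium values are below the levels, stay below the levels. -/
theorem barrier {ι : Type*} [Finite ι] {W W' : ι → ℝ → ℝ} {σ d C : ι → ℝ} (hσ : ∀ i, 0 < σ i)
    (hd : ∀ i, ∀ t ∈ Set.Ico t₀ t₁, HasDerivWithinAt (W i) (W' i t) (Set.Ico t₀ t₁) t)
    (h0 : ∀ i, W i t₀ < C i) (hD : ∀ i, d i < σ i * C i)
    (hW : ∀ t ∈ Set.Ico t₀ t₁, (∀ i, W i t < C i) → ∀ i, W' i t ≤ -σ i * W i t + d i) :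
    ∀ t ∈ Set.Ico t₀ t₁, ∀ i, W i t < C i := by
  by_contra! hcon
  obtain ⟨t, ht, i₀, hi₀⟩ := hcon
  have hsub : Set.Icc t₀ t ⊆ Set.Ico t₀ t₁ := fun s hs => ⟨hs.1, hs.2.trans_lt ht.2⟩
  have hcont : ∀ i, ContinuousOn (W i) (Set.Icc t₀ t) := fun i s hs =>
    ((hd i s (hsub hs)).continuousWithinAt).mono hsub
  set A : Set ℝ := ⋃ i, {s ∈ Set.Icc t₀ t | C i ≤ W i s} with hA
  have hclosed : IsClosed A := isClosed_iUnion_of_finite fun i =>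
    isClosed_Icc.isClosed_le continuousOn_const (hcont i)
  have hne : A.Nonempty := ⟨t, Set.mem_iUnion.2 ⟨i₀, Set.right_mem_Icc.2 ht.1, hi₀⟩⟩
  have hbdd : BddBelow A := ⟨t₀, fun s hs => by
    obtain ⟨i, hi⟩ := Set.mem_iUnion.1 hs
    exact hi.1.1⟩
  -- The infimum of the closed set `A` is attained: it is the first time at which some level is
  -- reached, and every dissipation inequality holds before it.
  obtain ⟨i, hτ, hi⟩ := Set.mem_iUnion.1 (hclosed.csInf_mem hne hbdd)
  set τ := sInf A
  have hbelow : ∀ s ∈ Set.Ico t₀ τ, ∀ k, W k s < C k := fun s hs k => by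
    by_contra! hk
    exact absurd (csInf_le hbdd (Set.mem_iUnion.2 ⟨k, ⟨hs.1, hs.2.le.trans hτ.2⟩, hk⟩))
      (not_le.2 hs.2)
  have hτ1 : τ < t₁ := hτ.2.trans_lt ht.2
  have hle := le_exp_decay (hσ i) hτ.1 hτ1 (hd i)
    (fun s hs => hW s ⟨hs.1, hs.2.trans hτ1⟩ (hbelow s hs) i)
  have hp := Real.exp_pos (-(σ i * (τ - t₀)))
  have hp1 : Real.exp (-(σ i * (τ - t₀))) ≤ 1 :=
    Real.exp_le_one_iff.2 (by have := mul_nonneg (hσ i).le (sub_nonneg.2 hτ.1); linarith)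
  have hdC : d i / σ i < C i := by
    rw [div_lt_iff₀ (hσ i), mul_comm]; exact hD i
  -- The bound for `W i τ` is a convex combination of the initial value and `d i / σ i`. Both are
  -- strictly below `C i`, contradicting `hi`.
  nlinarith [h0 i, mul_nonneg (sub_nonneg.2 hp1) (sub_nonneg.2 hdC.le),
    mul_pos hp (sub_pos.2 (h0 i))]

end Comparison

/-- The lower bound is the minimum of the positive quadratic form on the compact unit sphere,
extended by homogeneity. -/
theorem exists_inertia_bounds (S : Params) : ∃ jm jM : ℝ, 0 < jm ∧ 0 < jM ∧
    (∀ a, jm * ‖a‖ ^ 2 ≤ dot a (act S.J a)) ∧ ∀ a, ‖act S.J a‖ ≤ jM * ‖a‖ := by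
  obtain ⟨jM, hM, hb⟩ := exists_norm_act_le S.J
  have hpos : ∀ a : E3, a ≠ 0 → 0 < dot a (act S.J a) := by
    intro a ha
    have h := S.J_posDef.dotProduct_mulVec_pos (x := a.ofLp) (by simpa using ha)
    rw [dot_eq]
    simpa [dotProduct, Fin.sum_univ_three, act] using h
  have hcont : Continuous fun a : E3 => dot a (act S.J a) := by
    have : Continuous fun a : E3 => act S.J a :=
      (LinearMap.toContinuousLinearMap (actLin S.J)).continuous
    exact continuous_id.inner this
  obtain ⟨z, hz, hmin⟩ := (isCompact_sphere (0 : E3) 1).exists_isMinOn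
    (NormedSpace.sphere_nonempty.2 zero_le_one) hcont.continuousOn
  have hz1 : ‖z‖ = 1 := by simpa using hz
  refine ⟨dot z (act S.J z), jM, hpos z (fun h => by simp [h] at hz1), hM, fun a => ?_, hb⟩
  by_cases ha : a = 0
  · simp [ha, dot]
  have hn : ‖a‖ ≠ 0 := norm_ne_zero_iff.2 ha
  have hu : ‖a‖⁻¹ • a ∈ Metric.sphere (0 : E3) 1 := by
    simp [norm_smul, inv_mul_cancel₀ hn]
  have := hmin hu
  simp only [Set.mem_ofPred_eq, act_smul, smul_dot, dot_smul] at this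
  calc dot z (act S.J z) * ‖a‖ ^ 2 ≤ ‖a‖⁻¹ * (‖a‖⁻¹ * dot a (act S.J a)) * ‖a‖ ^ 2 := by gcongr
    _ = dot a (act S.J a) := by field_simp

theorem dot_J_comm (S : Params) (a b : E3) : dot a (act S.J b) = dot (act S.J a) b := by
  have : S.Jᵀ = S.J := by simpa using S.J_posDef.isHermitian.eq
  rw [dot_act, this]

/-! ### Error dynamics of the cables. -/

section CableErrors

variable {S : Params} {D : Desired} {K : Gains} {M : Motion} {δx δR : ℝ → E3}
  {δq : Fin 4 → ℝ → E3} {t₀ t₁ t : ℝ}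

theorem norm_desCable {j : Fin 4} (hμ : desTension S D K M j t ≠ 0) :
    ‖desCable S D K M j t‖ = 1 := by
  rw [desCable, norm_neg, norm_smul, norm_inv, norm_norm, inv_mul_cancel₀ (norm_ne_zero_iff.2 hμ)]

theorem norm_desCable_le (j : Fin 4) : ‖desCable S D K M j t‖ ≤ 1 := by
  by_cases hμ : desTension S D K M j t = 0
  · simp [desCable, hμ]
  · exact (norm_desCable hμ).le

theorem desTension_eq_smul (j : Fin 4) :
    desTension S D K M j t = -(‖desTension S D K M j t‖ • desCable S D K M j t) := by
  by_cases hμ : desTension S D K M j t = 0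
  · simp [hμ]
  · rw [desCable, smul_neg, neg_neg, smul_smul, mul_inv_cancel₀ (norm_ne_zero_iff.2 hμ), one_smul]

/-- The time derivative of the cable angular velocity error along closed-loop trajectories. -/
def derrω (S : Params) (D : Desired) (K : Gains) (M : Motion) (δq : Fin 4 → ℝ → E3) (j : Fin 4)
    (t : ℝ) : E3 :=
  -(K.kq • errQ S D K M j t) - K.kω • errω M j t + δq j t
    + dot (cross (M.ω j t) (M.q j t)) (M.ωd j t) • M.q j t

/-- The time derivative of the cable direction error along closed-loop trajectories. -/
def derrQ (S : Params) (D : Desired) (K : Gains) (M : Motion) (j : Fin 4) (t : ℝ) : E3 :=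
  cross (M.ωd j t) (errQ S D K M j t)
    + cross (desCable S D K M j t) (cross (errω M j t) (M.q j t))

variable (h : IsTrajectory S D K M δx δR δq (Set.Ico t₀ t₁)) (ht : t ∈ Set.Ico t₀ t₁)
include h ht

/-- The terms of the control law with `ωd` and `dωd` cancel the derivative of `q̂² ω̃` up to a
multiple of `q`. That multiple is harmless, since both cable errors are orthogonal to `q`. -/
theorem errω_deriv (j : Fin 4) :
    HasDerivWithinAt (errω M j) (derrω S D K M δq j t) (Set.Ico t₀ t₁) t := by
  have e : errω M j = fun s => M.ω j s + cross (M.q j s) (cross (M.q j s) (M.ωd j s)) :=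
    funext fun s => errω_eq j
  rw [e]
  have hq := h.q_kin t ht j
  refine ((h.ω_deriv t ht j).add (hasDerivWithinAt_cross hq
    (hasDerivWithinAt_cross hq (h.ωd_deriv t ht j)))).congr_deriv ?_
  have hp : dot (M.q j t) (cross (M.ω j t) (M.q j t)) = 0 := dot_cross_self_right _ _
  rw [dω_eq h ht, cableCmd, derrω, cross_add, cross_cross _ (M.q j t) (M.ωd j t),
    cross_cross _ (cross (M.ω j t) (M.q j t)) (M.ωd j t), dot_comm _ (M.q j t), hp]
  module

/-- The cable moves with the desired direction up to the error: `ω × q = e_ω × q + ω̃ × q`. By the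
Jacobi identity the two terms with `ω̃` merge into a rotation of the error vector. -/
theorem errQ_deriv (j : Fin 4) :
    HasDerivWithinAt (errQ S D K M j) (derrQ S D K M j t) (Set.Ico t₀ t₁) t := by
  refine (hasDerivWithinAt_cross (h.desCable_deriv t ht j) (h.q_kin t ht j)).congr_deriv ?_
  have hω : M.ω j t = errω M j t - cross (M.q j t) (cross (M.q j t) (M.ωd j t)) := by
    rw [errω_eq]; abel
  have hωq : cross (M.ω j t) (M.q j t)
      = cross (errω M j t) (M.q j t) + cross (M.ωd j t) (M.q j t) := by
    rw [hω, sub_cross, cross_cross, dot_self, h.q_norm t ht j, one_pow, one_smul, sub_cross,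
      smul_cross, cross_self]
    module
  rw [hωq, derrQ, errQ]
  simp only [E3.ext_iff, cross_zero_apply, cross_one_apply, cross_two_apply, PiLp.add_apply]
  refine ⟨?_, ?_, ?_⟩ <;> ring

theorem dot_errQ_errω (j : Fin 4) :
    dot (errQ S D K M j t) (errω M j t)
      = dot (errQ S D K M j t) (M.ω j t) - dot (errQ S D K M j t) (M.ωd j t) := by
  have : dot (errQ S D K M j t) (M.q j t) = 0 := by
    rw [dot_comm]; exact dot_cross_self_right _ _
  rw [errω_eq, cross_cross, dot_add, dot_sub, dot_smul, dot_smul, this, dot_self,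
    h.q_norm t ht j]
  ring

theorem Ψq_deriv (j : Fin 4) :
    HasDerivWithinAt (Ψq S D K M j) (dot (errQ S D K M j t) (errω M j t)) (Set.Ico t₀ t₁) t := by
  refine ((hasDerivWithinAt_dot (h.desCable_deriv t ht j) (h.q_kin t ht j)).const_sub
    1).congr_deriv ?_
  rw [dot_errQ_errω h ht, errQ]
  simp only [dot_eq, cross_zero_apply, cross_one_apply, cross_two_apply]
  ring

theorem norm_errQ_sq {j : Fin 4} (hμ : desTension S D K M j t ≠ 0) :
    ‖errQ S D K M j t‖ ^ 2 = Ψq S D K M j t * (2 - Ψq S D K M j t) := by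
  rw [errQ, norm_cross_sq, norm_desCable hμ, h.q_norm t ht j, Ψq]; ring

theorem Ψq_nonneg (j : Fin 4) : 0 ≤ Ψq S D K M j t := by
  have h1 := dot_le (desCable S D K M j t) (M.q j t)
  rw [h.q_norm t ht j] at h1
  rw [Ψq]; linarith [norm_desCable_le (S := S) (D := D) (K := K) (M := M) (t := t) j]

/-- As `μ̃` is antiparallel to the desired direction, `‖q × μ̃‖` equals `‖μ̃‖` times the length of
the direction error; the second cross product with the unit vector `q` does not increase it. -/
theorem norm_cablePert_le (j : Fin 4) :
    ‖cablePert S D K M δq j t‖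
      ≤ ‖desTension S D K M j t‖ * ‖errQ S D K M j t‖ + S.mQ * S.L * ‖δq j t‖ := by
  have hmL := mul_pos S.mQ_pos S.L_pos
  have hq := h.q_norm t ht j
  have h1 : ‖cross (M.q j t) (desTension S D K M j t)‖
      = ‖desTension S D K M j t‖ * ‖errQ S D K M j t‖ := by
    conv_lhs => rw [desTension_eq_smul, cross_neg, cross_smul, norm_neg, norm_smul, norm_norm,
      cross_anticomm, norm_neg]
    rfl
  refine (norm_add_le _ _).trans (add_le_add ?_ ?_)
  · refine (norm_cross_le _ _).trans ?_
    rw [hq, one_mul, h1]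
  · rw [norm_smul, Real.norm_of_nonneg hmL.le]
    refine mul_le_mul_of_nonneg_left ((norm_cross_le _ _).trans ?_) hmL.le
    rw [hq, mul_one]

end CableErrors

/-! ### Pointwise dissipation inequalities and bounds for the Lyapunov functions. -/

section VectorEstimates

/-- The core of `cable_decay` after division by `ν`: `Y = ‖e_ω‖`, `η = ν ‖e_q‖`, `Q = ν² Ψ`, `D = d
/ ν`. In these variables the gain disappears, so the constants hold for every `ν`. -/
theorem cable_decay_real {Y η Q D : ℝ} (h : Q ≤ η ^ 2) :
    -Y ^ 2 + Y * D + 1 / 8 * (2 * (η * Y) + Y ^ 2 - η ^ 2 + η * D)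
      ≤ -(1 / 64) * (1 / 2 * Y ^ 2 + Q + 1 / 8 * (η * Y)) + 3 * D ^ 2 := by
  linarith [sq_nonneg (Y - 2 * D), sq_nonneg (η - 4 * D), sq_nonneg (η - 3 * Y), sq_nonneg Y,
    sq_nonneg η, sq_nonneg D]

/-- The core of `rot_decay` with `Y = ‖e_Ω‖`, `η = ρ ‖e_R‖`, `Q = ρ² Ψ`. The cross term supplies
damping in `η`; the smallness of `ε` lets the damping `-Y²` pay for its side effects. -/
theorem rot_decay_real {ε jM Y η Q N : ℝ} (hε : 0 < ε) (hε4 : ε ≤ 1 / 4)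
    (hεY : ε * (5 * jM + 2) ≤ 1 / 2) (hη : Q / 2 ≤ η ^ 2) (hN2 : N ^ 2 = Y ^ 2 + Q) :
    ε * (5 * jM * Y ^ 2 - η ^ 2 + 2 * (η * Y)) - Y ^ 2 ≤ -(ε / 4) * N ^ 2 := by
  have a1 : 2 * (η * Y) ≤ η ^ 2 / 2 + 2 * Y ^ 2 := by
    linarith [sq_nonneg (η - 2 * Y)]
  have a2 := mul_le_mul_of_nonneg_left a1 hε.le
  have a3 := mul_le_mul_of_nonneg_right hεY (sq_nonneg Y)
  have a4 := mul_le_mul_of_nonneg_left hη hε.le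
  have a5 := mul_le_mul_of_nonneg_right hε4 (sq_nonneg Y)
  rw [hN2]
  linarith [sq_nonneg Y]

/-- Dissipation of the translational energy with a cross term. -/
theorem trans_decay {ex ev w : E3} {lam b N : ℝ} (hl : 0 < lam) (hw : ‖w‖ ≤ b) (hN : 0 ≤ N)
    (hN2 : N ^ 2 = lam ^ 2 * ‖ex‖ ^ 2 + ‖ev‖ ^ 2) :
    lam ^ 2 * dot ex ev + dot ev (-(lam ^ 2 • ex) - lam • ev + w)
      + lam / 2 * (dot ev ev + dot ex (-(lam ^ 2 • ex) - lam • ev + w))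
      ≤ -(lam / 4) * N ^ 2 + 3 / 2 * N * b := by
  have hb : 0 ≤ b := (norm_nonneg _).trans hw
  simp only [dot_add, dot_sub, dot_neg, dot_smul, dot_self]
  rw [dot_comm ev ex]
  have h1 : dot ev w ≤ ‖ev‖ * b :=
    (dot_le _ _).trans (mul_le_mul_of_nonneg_left hw (norm_nonneg _))
  have h2 : dot ex w ≤ ‖ex‖ * b :=
    (dot_le _ _).trans (mul_le_mul_of_nonneg_left hw (norm_nonneg _))
  have h3 := neg_le_dot ex ev
  have hV : ‖ev‖ ≤ N := by
    apply le_of_sq_le_sq _ hN; rw [hN2]; nlinarith [sq_nonneg (lam * ‖ex‖)]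
  have hX : lam * ‖ex‖ ≤ N := by
    apply le_of_sq_le_sq _ hN; rw [hN2]; nlinarith [sq_nonneg ‖ev‖]
  have h4 : dot ev w ≤ N * b := h1.trans (mul_le_mul_of_nonneg_right hV hb)
  have h5 : lam * dot ex w ≤ N * b := by
    calc lam * dot ex w ≤ lam * (‖ex‖ * b) := mul_le_mul_of_nonneg_left h2 hl.le
      _ = lam * ‖ex‖ * b := by ring
      _ ≤ N * b := mul_le_mul_of_nonneg_right hX hb
  have h6 : -(lam * dot ex ev) ≤ N ^ 2 / 2 := by
    have : -(lam * dot ex ev) ≤ lam * ‖ex‖ * ‖ev‖ := by nlinarith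
    nlinarith [sq_nonneg (lam * ‖ex‖ - ‖ev‖)]
  have h7 := mul_le_mul_of_nonneg_left h6 hl.le
  have e : lam * N ^ 2 = lam * (lam ^ 2 * ‖ex‖ ^ 2) + lam * ‖ev‖ ^ 2 := by rw [hN2]; ring
  nlinarith

theorem trans_bounds {ex ev : E3} {lam : ℝ} (hl : 0 < lam) :
    (lam ^ 2 * ‖ex‖ ^ 2 + ‖ev‖ ^ 2) / 4 ≤
        lam ^ 2 / 2 * dot ex ex + 1 / 2 * dot ev ev + lam / 2 * dot ex ev ∧
      lam ^ 2 / 2 * dot ex ex + 1 / 2 * dot ev ev + lam / 2 * dot ex ev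
        ≤ 3 / 4 * (lam ^ 2 * ‖ex‖ ^ 2 + ‖ev‖ ^ 2) := by
  rw [dot_self, dot_self]
  have h1 := mul_le_mul_of_nonneg_left (dot_le ex ev) hl.le
  have h2 := mul_le_mul_of_nonneg_left (neg_le_dot ex ev) hl.le
  constructor <;> nlinarith [sq_nonneg (lam * ‖ex‖ - ‖ev‖)]

variable {S : Params} {jm jM : ℝ}

/-- Dissipation of the rotational energy with a cross term, along
`J e' = -ρ² eR - ρ e - e × J e - e × J z - z × J e + J (e × z) + w`. -/
theorem rot_decay (hJ : ∀ a, ‖act S.J a‖ ≤ jM * ‖a‖) (hj : 0 < jM) {er er' e e' z w : E3}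
    {ρ ε B b N Ψ : ℝ} (hε : 0 < ε) (hεj : ε * (10 * jM + 4) ≤ 1) (hB : ‖z‖ ≤ B)
    (hρ : 3 * jM * B ≤ ρ) (hρ0 : 0 < ρ) (hw : ‖w‖ ≤ b) (hΨ : 0 ≤ Ψ) (hΨ1 : Ψ ≤ 3 / 2)
    (her : ‖er‖ ^ 2 = Ψ * (2 - Ψ)) (her' : ‖er'‖ ≤ 4 * ‖e‖)
    (he' : act S.J e' = -(ρ ^ 2 • er) - ρ • e - cross e (act S.J e) - cross e (act S.J z)
      - cross z (act S.J e) + act S.J (cross e z) + w)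
    (hN : 0 ≤ N) (hN2 : N ^ 2 = ‖e‖ ^ 2 + ρ ^ 2 * Ψ) :
    1 / 2 * (dot e' (act S.J e) + dot e (act S.J e')) + ρ ^ 2 * dot er e
      + ε * ρ * (dot er' (act S.J e) + dot er (act S.J e')) ≤ -(ε / 4) * ρ * N ^ 2 + 2 * N * b := by
  have hb : 0 ≤ b := (norm_nonneg _).trans hw
  have hB0 : 0 ≤ B := (norm_nonneg _).trans hB
  have hY := norm_nonneg e
  have hE := norm_nonneg er
  have hE1 : ‖er‖ ≤ 1 := by
    apply le_of_sq_le_sq _ zero_le_one; rw [her]; linarith [sq_nonneg (Ψ - 1)]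
  have hsym : dot e' (act S.J e) = dot e (act S.J e') := by rw [dot_J_comm, dot_comm]
  -- With this symmetry all gyroscopic terms drop out of the energy balance. They survive only in
  -- the cross term, where `ρ ≥ 3 jM B` dominates those that contain `z`.
  have hcancel : dot e (act S.J (cross e z)) = dot e (cross z (act S.J e)) := by
    rw [dot_J_comm, dot_cross_rotate]
  have h1 : dot e (act S.J e') = -(ρ ^ 2 * dot er e) - ρ * ‖e‖ ^ 2 + dot e w := by
    rw [he']
    simp only [dot_add, dot_sub, dot_neg, dot_smul, dot_cross_self_left, hcancel, dot_self]
    rw [dot_comm e er]; ring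
  have c1 : ‖cross e (act S.J e)‖ ≤ jM * ‖e‖ ^ 2 := (norm_cross_le _ _).trans (by
    have := mul_le_mul_of_nonneg_left (hJ e) hY; linarith)
  have c2 : ‖cross e (act S.J z)‖ ≤ jM * B * ‖e‖ := (norm_cross_le _ _).trans (by
    have h := (hJ z).trans (mul_le_mul_of_nonneg_left hB hj.le)
    have := mul_le_mul_of_nonneg_left h hY; linarith)
  have c3 : ‖cross z (act S.J e)‖ ≤ jM * B * ‖e‖ := (norm_cross_le _ _).trans (by
    have := mul_le_mul hB (hJ e) (norm_nonneg _) hB0; linarith)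
  have c4 : ‖act S.J (cross e z)‖ ≤ jM * B * ‖e‖ := (hJ _).trans (by
    have h := (norm_cross_le e z).trans (mul_le_mul_of_nonneg_left hB hY)
    have := mul_le_mul_of_nonneg_left h hj.le; linarith)
  have neg_dot_le : ∀ (v : E3) (k : ℝ), ‖v‖ ≤ k → -dot er v ≤ ‖er‖ * k := fun v k hk => by
    have := neg_le_dot er v
    have := mul_le_mul_of_nonneg_left hk hE
    linarith
  have le_dot : ∀ (v : E3) (k : ℝ), ‖v‖ ≤ k → dot er v ≤ ‖er‖ * k := fun v k hk => by
    have := dot_le er v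
    have := mul_le_mul_of_nonneg_left hk hE
    linarith
  have h2 : dot er (act S.J e') ≤ -(ρ ^ 2 * ‖er‖ ^ 2) + ρ * (‖er‖ * ‖e‖) + jM * ‖e‖ ^ 2
      + ‖er‖ * (3 * jM * B * ‖e‖) + ‖er‖ * b := by
    rw [he']
    simp only [dot_add, dot_sub, dot_neg, dot_smul, dot_self]
    have d0 := mul_le_mul_of_nonneg_left (neg_dot_le e _ le_rfl) hρ0.le
    have d1 := neg_dot_le _ _ c1
    have d1' : ‖er‖ * (jM * ‖e‖ ^ 2) ≤ jM * ‖e‖ ^ 2 :=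
      mul_le_of_le_one_left (by positivity) hE1
    have d2 := neg_dot_le _ _ c2
    have d3 := neg_dot_le _ _ c3
    have d4 := le_dot _ _ c4
    have d5 := le_dot _ _ hw
    linarith
  have h2' : ‖er‖ * (3 * jM * B * ‖e‖) ≤ ρ * (‖er‖ * ‖e‖) := by
    have := mul_le_mul_of_nonneg_right hρ (mul_nonneg hE hY)
    linarith
  have h3 : dot er' (act S.J e) ≤ 4 * jM * ‖e‖ ^ 2 := (dot_le _ _).trans (by
    have := mul_le_mul her' (hJ e) (norm_nonneg _) (by positivity); linarith)
  have h4 : dot e w ≤ ‖e‖ * b := (dot_le _ _).trans (mul_le_mul_of_nonneg_left hw hY)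
  set Y := ‖e‖
  set E := ‖er‖
  have h5 : ε * ρ * (dot er' (act S.J e) + dot er (act S.J e'))
      ≤ ε * ρ * (5 * jM * Y ^ 2 - (ρ * E) ^ 2 + 2 * ((ρ * E) * Y) + E * b) := by
    apply mul_le_mul_of_nonneg_left _ (by positivity)
    linarith
  have hε4 : ε ≤ 1 / 4 := by linarith [mul_pos hε hj]
  have hεY : ε * (5 * jM + 2) ≤ 1 / 2 := by linarith
  have hη : ρ ^ 2 * Ψ / 2 ≤ (ρ * E) ^ 2 := by
    rw [mul_pow, her]; linarith [mul_nonneg (sq_nonneg ρ) (mul_nonneg hΨ (sub_nonneg.2 hΨ1))]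
  have hη2 : (ρ * E) ^ 2 ≤ 2 * (ρ ^ 2 * Ψ) := by
    rw [mul_pow, her]; linarith [mul_nonneg (sq_nonneg ρ) (sq_nonneg Ψ)]
  have hYN : Y ≤ N := by
    apply le_of_sq_le_sq _ hN; rw [hN2]; linarith [mul_nonneg (sq_nonneg ρ) hΨ]
  have hηN : ρ * E ≤ 2 * N := by
    apply le_of_sq_le_sq _ (by positivity)
    rw [mul_pow 2, hN2]; linarith [sq_nonneg Y, mul_nonneg (sq_nonneg ρ) hΨ]
  have h6 : Y * b + ε * (ρ * E * b) ≤ 2 * N * b := by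
    have a1 := mul_le_mul_of_nonneg_right hYN hb
    have a2 := mul_le_mul_of_nonneg_right hηN hb
    have a3 : ε * (ρ * E * b) ≤ 1 / 4 * (ρ * E * b) :=
      mul_le_mul_of_nonneg_right hε4 (by positivity)
    linarith [mul_nonneg hN hb]
  have h7 := rot_decay_real hε hε4 hεY hη hN2
  have h8 := mul_le_mul_of_nonneg_left h7 hρ0.le
  rw [hsym, h1]
  linarith

theorem rot_bounds (hJm : ∀ a, jm * ‖a‖ ^ 2 ≤ dot a (act S.J a))
    (hJ : ∀ a, ‖act S.J a‖ ≤ jM * ‖a‖) (hm : 0 < jm) (hj : 0 < jM) {er e : E3} {ρ ε Ψ : ℝ}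
    (hε : 0 < ε) (hεj : ε * (10 * jM + 4) ≤ 1) (hρ0 : 0 < ρ) (hΨ : 0 ≤ Ψ)
    (her : ‖er‖ ^ 2 = Ψ * (2 - Ψ)) :
    jm / 4 * ‖e‖ ^ 2 + 7 / 8 * (ρ ^ 2 * Ψ) ≤
        1 / 2 * dot e (act S.J e) + ρ ^ 2 * Ψ + ε * ρ * dot er (act S.J e) ∧
      1 / 2 * dot e (act S.J e) + ρ ^ 2 * Ψ + ε * ρ * dot er (act S.J e)
        ≤ 3 / 4 * jM * ‖e‖ ^ 2 + 9 / 8 * (ρ ^ 2 * Ψ) := by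
  have hpos : ∀ a, 0 ≤ dot a (act S.J a) := fun a => (by positivity : 0 ≤ jm * ‖a‖ ^ 2).trans
    (hJm a)
  -- Positivity at `e ± 2 ε ρ er` is Cauchy–Schwarz for the inner product of `J`: the cross term
  -- costs a quarter of `e · J e` and `ε² ρ² er · J er`.
  have h1 := hpos (e + (2 * ε * ρ) • er)
  have h2 := hpos (e - (2 * ε * ρ) • er)
  simp only [act_add, act_sub, act_smul, dot_add, dot_sub, add_dot, sub_dot, dot_smul,
    smul_dot] at h1 h2
  have hsym : dot e (act S.J er) = dot er (act S.J e) := by rw [dot_J_comm, dot_comm]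
  rw [hsym] at h1 h2
  have hJu : ∀ a, dot a (act S.J a) ≤ jM * ‖a‖ ^ 2 := fun a => (dot_le _ _).trans (by
    have := mul_le_mul_of_nonneg_left (hJ a) (norm_nonneg a); nlinarith)
  have hεε : ε ^ 2 * jM ≤ 1 / 40 := by
    have : ε ≤ 1 / 4 := by nlinarith
    have : ε * jM ≤ 1 / 10 := by nlinarith
    nlinarith [mul_pos hε hj]
  have h3 : ε ^ 2 * ρ ^ 2 * dot er (act S.J er) ≤ ρ ^ 2 * Ψ / 20 := by
    calc ε ^ 2 * ρ ^ 2 * dot er (act S.J er) ≤ ε ^ 2 * ρ ^ 2 * (jM * ‖er‖ ^ 2) :=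
          mul_le_mul_of_nonneg_left (hJu er) (by positivity)
      _ = (ε ^ 2 * jM) * (ρ ^ 2 * (Ψ * (2 - Ψ))) := by rw [her]; ring
      _ ≤ 1 / 40 * (ρ ^ 2 * (Ψ * (2 - Ψ))) := by
          apply mul_le_mul_of_nonneg_right hεε
          rw [← her]; positivity
      _ ≤ ρ ^ 2 * Ψ / 20 := by nlinarith [mul_nonneg (sq_nonneg ρ) (sq_nonneg Ψ)]
  have h4 := hJm e
  have h5 := hJu e
  have h6 : 0 ≤ ρ ^ 2 * Ψ := by positivity
  constructor <;> nlinarith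

/-- Dissipation of the cable energy with a cross term. -/
theorem cable_decay {eq e z qd q δ eq' e' : E3} {ν d Ψ k : ℝ} (hν : 0 < ν) (hq : ‖q‖ = 1)
    (hqd : ‖qd‖ = 1) (hz : ‖z‖ ≤ ν) (hδ : ‖δ‖ ≤ d) (hΨ : 0 ≤ Ψ) (hΨ1 : Ψ ≤ 1)
    (heq : ‖eq‖ ^ 2 = Ψ * (2 - Ψ)) (hqe : dot q e = 0) (hqeq : dot q eq = 0)
    (he' : e' = -(ν ^ 2 • eq) - ν • e + δ + k • q)
    (heq' : eq' = cross z eq + cross qd (cross e q)) :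
    dot e e' + ν ^ 2 * dot eq e + ν / 8 * (dot eq' e + dot eq e')
      ≤ -(ν / 64) * (1 / 2 * dot e e + ν ^ 2 * Ψ + ν / 8 * dot eq e) + 3 * d ^ 2 / ν := by
  have hd : 0 ≤ d := (norm_nonneg _).trans hδ
  have hY := norm_nonneg e
  have hE := norm_nonneg eq
  have h1 : dot e e' = -(ν ^ 2 * dot eq e) - ν * ‖e‖ ^ 2 + dot e δ := by
    rw [he']
    simp only [dot_add, dot_sub, dot_neg, dot_smul, dot_self]
    rw [dot_comm e q, hqe, dot_comm e eq]; ring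
  have h2 : dot eq e' = -(ν ^ 2 * ‖eq‖ ^ 2) - ν * dot eq e + dot eq δ := by
    rw [he']
    simp only [dot_add, dot_sub, dot_neg, dot_smul, dot_self]
    rw [dot_comm eq q, hqeq]; ring
  have h3 : dot eq' e ≤ ν * (‖eq‖ * ‖e‖) + ‖e‖ ^ 2 := by
    rw [heq', add_dot]
    have a1 : ‖cross z eq‖ ≤ ν * ‖eq‖ :=
      (norm_cross_le _ _).trans (mul_le_mul_of_nonneg_right hz hE)
    have a2 : ‖cross qd (cross e q)‖ ≤ ‖e‖ := by
      refine (norm_cross_le _ _).trans ?_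
      rw [hqd, one_mul]
      refine (norm_cross_le _ _).trans ?_
      rw [hq, mul_one]
    have b1 := (dot_le (cross z eq) e).trans (mul_le_mul_of_nonneg_right a1 hY)
    have b2 := (dot_le (cross qd (cross e q)) e).trans (mul_le_mul_of_nonneg_right a2 hY)
    nlinarith
  have h4 : dot e δ ≤ ‖e‖ * d := (dot_le _ _).trans (mul_le_mul_of_nonneg_left hδ hY)
  have h5 : dot eq δ ≤ ‖eq‖ * d := (dot_le _ _).trans (mul_le_mul_of_nonneg_left hδ hE)
  have h6 := neg_le_dot eq e
  have h7 := dot_le eq e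
  rw [h1, h2, dot_self]
  set Y := ‖e‖
  set E := ‖eq‖
  set p := dot eq e
  have hη : ν ^ 2 * Ψ ≤ (ν * E) ^ 2 := by
    rw [mul_pow, heq]; nlinarith [mul_nonneg (sq_nonneg ν) (mul_nonneg hΨ (sub_nonneg.2 hΨ1))]
  have hη2 : (ν * E) ^ 2 ≤ 2 * (ν ^ 2 * Ψ) := by
    rw [mul_pow, heq]; nlinarith [mul_nonneg (sq_nonneg ν) (sq_nonneg Ψ)]
  have hdν : 3 * d ^ 2 / ν = ν * (3 * (d / ν) ^ 2) := by field_simp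
  rw [hdν]
  obtain ⟨D, hD⟩ : ∃ D, D = d / ν := ⟨_, rfl⟩
  have hdD : d = ν * D := by rw [hD]; field_simp
  rw [← hD]
  have hpE : -(ν * p) ≤ (ν * E) * Y := by nlinarith
  have hpE2 : ν * p ≤ (ν * E) * Y := by nlinarith
  have key := cable_decay_real (Y := Y) (D := D) hη
  have key' := mul_le_mul_of_nonneg_left key hν.le
  have l1 : ν / 8 * (dot eq' e + (-(ν ^ 2 * E ^ 2) - ν * p + dot eq δ))
      ≤ ν / 8 * (2 * ((ν * E) * Y) + Y ^ 2 - (ν * E) ^ 2 + (ν * E) * D) := by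
    apply mul_le_mul_of_nonneg_left _ (by positivity)
    have : E * d = (ν * E) * D := by rw [hdD]; ring
    linarith
  have l2 : Y * d = ν * (Y * D) := by rw [hdD]; ring
  have l3 : ν / 64 * (ν / 8 * p) ≤ ν / 64 * (1 / 8 * ((ν * E) * Y)) :=
    mul_le_mul_of_nonneg_left (by linarith) (by positivity)
  linarith

theorem cable_bounds {eq e : E3} {ν Ψ : ℝ} (hν : 0 < ν)
    (heq : ‖eq‖ ^ 2 = Ψ * (2 - Ψ)) :
    7 / 16 * ‖e‖ ^ 2 + 7 / 8 * (ν ^ 2 * Ψ)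
        ≤ 1 / 2 * dot e e + ν ^ 2 * Ψ + ν / 8 * dot eq e ∧
      1 / 2 * dot e e + ν ^ 2 * Ψ + ν / 8 * dot eq e
        ≤ 9 / 16 * ‖e‖ ^ 2 + 9 / 8 * (ν ^ 2 * Ψ) := by
  have h1 := mul_le_mul_of_nonneg_left (dot_le eq e) hν.le
  have h2 := mul_le_mul_of_nonneg_left (neg_le_dot eq e) hν.le
  have hη2 : (ν * ‖eq‖) ^ 2 ≤ 2 * (ν ^ 2 * Ψ) := by
    rw [mul_pow, heq]; nlinarith [mul_nonneg (sq_nonneg ν) (sq_nonneg Ψ)]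
  have h3 : (ν * ‖eq‖) * ‖e‖ ≤ ν ^ 2 * Ψ + ‖e‖ ^ 2 / 2 := by
    nlinarith [sq_nonneg (ν * ‖eq‖ - ‖e‖)]
  rw [dot_self]
  constructor <;> nlinarith

end VectorEstimates

/-! ### Lyapunov functions and the size of the commanded forces. -/

/-- Gains of critical-damping type with frequencies `lam`, `ρ`, `ν` for the load position, the load
attitude and the cables. -/
def gains (lam ρ ν : ℝ) : Gains := ⟨lam ^ 2, lam, ρ ^ 2, ρ, ν ^ 2, ν⟩

/-- The weighted norm of the translational errors. -/
def transN (D : Desired) (M : Motion) (lam t : ℝ) : ℝ :=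
  √(lam ^ 2 * ‖errX D M t‖ ^ 2 + ‖errV D M t‖ ^ 2)

/-- The weighted norm of the rotational errors. -/
def rotN (D : Desired) (M : Motion) (ρ t : ℝ) : ℝ := √(‖errΩ D M t‖ ^ 2 + ρ ^ 2 * ΨR D M t)

/-- The translational Lyapunov function. -/
def transV (D : Desired) (M : Motion) (lam t : ℝ) : ℝ :=
  lam ^ 2 / 2 * dot (errX D M t) (errX D M t) + 1 / 2 * dot (errV D M t) (errV D M t)
    + lam / 2 * dot (errX D M t) (errV D M t)

/-- The rotational Lyapunov function. -/
def rotV (S : Params) (D : Desired) (M : Motion) (ε ρ t : ℝ) : ℝ :=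
  1 / 2 * dot (errΩ D M t) (act S.J (errΩ D M t)) + ρ ^ 2 * ΨR D M t
    + ε * ρ * dot (errR D M t) (act S.J (errΩ D M t))

/-- The Lyapunov function of the load. -/
def loadV (S : Params) (D : Desired) (M : Motion) (ε lam ρ t : ℝ) : ℝ :=
  lam / ρ * transV D M lam t + rotV S D M ε ρ t

/-- The Lyapunov function of a cable. -/
def cableV (S : Params) (D : Desired) (K : Gains) (M : Motion) (ν : ℝ) (j : Fin 4) (t : ℝ) : ℝ :=
  1 / 2 * dot (errω M j t) (errω M j t) + ν ^ 2 * Ψq S D K M j t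
    + ν / 8 * dot (errQ S D K M j t) (errω M j t)

section Estimates

variable {S : Params} {D : Desired} {K : Gains} {M : Motion} {δx δR : ℝ → E3}
  {δq : Fin 4 → ℝ → E3} {t₀ t₁ t lam ρ ν : ℝ}

/-- Bounds for the quantities of the desired motion that enter the commanded force and moment. -/
def Desired.BoundedBy (D : Desired) (B : ℝ) : Prop :=
  ∀ t, 0 ≤ t → ‖iteratedDeriv 2 D.x t‖ ≤ B ∧ ‖iteratedDeriv 3 D.x t‖ ≤ B ∧
    ‖D.Ω t‖ ≤ B ∧ ‖deriv D.Ω t‖ ≤ B ∧ ‖iteratedDeriv 2 D.Ω t‖ ≤ B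

theorem norm_e3 : ‖e3‖ = 1 := by
  have : ‖e3‖ ^ 2 = 1 := by rw [norm_sq_eq]; simp [e3]
  nlinarith [norm_nonneg e3]

theorem transN_sq : transN D M lam t ^ 2 = lam ^ 2 * ‖errX D M t‖ ^ 2 + ‖errV D M t‖ ^ 2 :=
  Real.sq_sqrt (by positivity)

theorem lam_errX_le : lam * ‖errX D M t‖ ≤ transN D M lam t :=
  Real.le_sqrt_of_sq_le (by rw [mul_pow]; linarith [sq_nonneg ‖errV D M t‖])

theorem errV_le : ‖errV D M t‖ ≤ transN D M lam t :=
  Real.le_sqrt_of_sq_le (by linarith [mul_nonneg (sq_nonneg lam) (sq_nonneg ‖errX D M t‖)])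

variable (h : IsTrajectory S D K M δx δR δq (Set.Ico t₀ t₁)) (ht : t ∈ Set.Ico t₀ t₁)
include h ht

theorem ΨR_nonneg : 0 ≤ ΨR D M t := rotΨ_nonneg (relRot_mem h ht)

theorem norm_errR_sq : ‖errR D M t‖ ^ 2 = ΨR D M t * (2 - ΨR D M t) := by
  rw [errR_eq]; exact norm_rotErr_sq (relRot_mem h ht)

theorem rotN_sq : rotN D M ρ t ^ 2 = ‖errΩ D M t‖ ^ 2 + ρ ^ 2 * ΨR D M t :=
  Real.sq_sqrt (by have := ΨR_nonneg h ht; positivity)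

theorem errΩ_le : ‖errΩ D M t‖ ≤ rotN D M ρ t :=
  Real.le_sqrt_of_sq_le (by linarith [mul_nonneg (sq_nonneg ρ) (ΨR_nonneg h ht)])

theorem ρ_errR_le : ρ * ‖errR D M t‖ ≤ 2 * rotN D M ρ t := by
  have hN : 0 ≤ rotN D M ρ t := Real.sqrt_nonneg _
  apply le_of_sq_le_sq _ (by positivity)
  rw [mul_pow, mul_pow, rotN_sq h ht, norm_errR_sq h ht]
  have h1 := mul_nonneg (sq_nonneg ρ) (sq_nonneg (ΨR D M t))
  have h2 := mul_nonneg (sq_nonneg ρ) (ΨR_nonneg h ht)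
  linarith [sq_nonneg ‖errΩ D M t‖]

theorem norm_transportedΩ : ‖transportedΩ D M t‖ = ‖D.Ω t‖ := by
  rw [transportedΩ_eq, norm_act_rot (rot_transpose_mem (relRot_mem h ht))]

omit h ht in
theorem norm_desForce_sub_le (hl : 0 ≤ lam) (hx : K.kx = lam ^ 2) (hv : K.kv = lam) :
    ‖desForce S D K M t - S.mL • (iteratedDeriv 2 D.x t + S.g • e3)‖
      ≤ S.mL * (2 * lam * transN D M lam t) := by
  have e : desForce S D K M t - S.mL • (iteratedDeriv 2 D.x t + S.g • e3)
      = S.mL • (-(lam ^ 2 • errX D M t) - lam • errV D M t) := by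
    rw [desForce, hx, hv]; module
  rw [e, norm_smul, Real.norm_of_nonneg S.mL_pos.le]
  refine mul_le_mul_of_nonneg_left ((norm_sub_le _ _).trans ?_) S.mL_pos.le
  rw [norm_neg, norm_smul, norm_smul, Real.norm_of_nonneg hl, Real.norm_of_nonneg (sq_nonneg lam)]
  have h1 := mul_le_mul_of_nonneg_left (lam_errX_le (D := D) (M := M) (t := t) (lam := lam)) hl
  have h2 := mul_le_mul_of_nonneg_left (errV_le (D := D) (M := M) (t := t) (lam := lam)) hl
  linarith

omit h ht in
theorem norm_nominalForce_le {B : ℝ} (hB : D.BoundedBy B) (h0 : 0 ≤ t) :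
    ‖S.mL • (iteratedDeriv 2 D.x t + S.g • e3)‖ ≤ S.mL * (B + S.g) := by
  rw [norm_smul, Real.norm_of_nonneg S.mL_pos.le]
  refine mul_le_mul_of_nonneg_left ((norm_add_le _ _).trans ?_) S.mL_pos.le
  rw [norm_smul, norm_e3, Real.norm_of_nonneg S.g_pos.le, mul_one]
  linarith [(hB t h0).1]

theorem norm_desMoment_sub_le (hρ : 0 ≤ ρ) (hR : K.kR = ρ ^ 2) (hΩ : K.kΩ = ρ) :
    ‖desMoment S D K M t - (cross (transportedΩ D M t) (act S.J (transportedΩ D M t))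
      + act S.J (act (relRot D M t)ᵀ (deriv D.Ω t)))‖ ≤ 3 * ρ * rotN D M ρ t := by
  have e : desMoment S D K M t - (cross (transportedΩ D M t) (act S.J (transportedΩ D M t))
      + act S.J (act (relRot D M t)ᵀ (deriv D.Ω t)))
      = -(ρ ^ 2 • errR D M t) - ρ • errΩ D M t := by
    rw [desMoment_eq, hR, hΩ]; module
  rw [e]
  refine (norm_sub_le _ _).trans ?_
  rw [norm_neg, norm_smul, norm_smul, Real.norm_of_nonneg hρ, Real.norm_of_nonneg (sq_nonneg ρ)]
  have h1 := mul_le_mul_of_nonneg_left (ρ_errR_le (ρ := ρ) h ht) hρ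
  have h2 := mul_le_mul_of_nonneg_left (errΩ_le (ρ := ρ) h ht) hρ
  linarith

theorem norm_transportedMoment_le {B jM : ℝ} (hj : 0 ≤ jM)
    (hJ : ∀ a, ‖act S.J a‖ ≤ jM * ‖a‖) (hB : D.BoundedBy B) (h0 : 0 ≤ t) :
    ‖cross (transportedΩ D M t) (act S.J (transportedΩ D M t))
      + act S.J (act (relRot D M t)ᵀ (deriv D.Ω t))‖ ≤ jM * (B ^ 2 + B) := by
  obtain ⟨-, -, hΩ, hdΩ, -⟩ := hB t h0
  have hB0 : 0 ≤ B := (norm_nonneg _).trans hΩ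
  have hz : ‖transportedΩ D M t‖ ≤ B := (norm_transportedΩ h ht).le.trans hΩ
  have h1 : ‖cross (transportedΩ D M t) (act S.J (transportedΩ D M t))‖ ≤ B * (jM * B) :=
    (norm_cross_le _ _).trans (mul_le_mul hz ((hJ _).trans (mul_le_mul_of_nonneg_left hz hj))
      (norm_nonneg _) hB0)
  have h2 : ‖act S.J (act (relRot D M t)ᵀ (deriv D.Ω t))‖ ≤ jM * B :=
    (hJ _).trans (mul_le_mul_of_nonneg_left
      ((norm_act_rot (rot_transpose_mem (relRot_mem h ht)) _).le.trans hdΩ) hj)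
  calc _ ≤ B * (jM * B) + jM * B := (norm_add_le _ _).trans (add_le_add h1 h2)
    _ = jM * (B ^ 2 + B) := by ring

/-- The feedback forces are of the size `lam * transN` and `ρ * rotN`, the quantities whose squares,
over `ρ`, measure the dissipation of `loadV`. This makes the smallness required of the cable errors
independent of the gains. -/
theorem norm_desTension_le {B jM Cs : ℝ} (hj : 0 ≤ jM) (hCs : 0 ≤ Cs)
    (hJ : ∀ a, ‖act S.J a‖ ≤ jM * ‖a‖) (hB : D.BoundedBy B) (h0 : 0 ≤ t)
    (hshare : ∀ j p, ‖share S j p‖ ≤ Cs * (‖p.1‖ + ‖p.2‖))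
    (hl : 0 ≤ lam) (hρ : 0 ≤ ρ) (hx : K.kx = lam ^ 2) (hv : K.kv = lam)
    (hR : K.kR = ρ ^ 2) (hΩ : K.kΩ = ρ) (j : Fin 4) :
    ‖desTension S D K M j t‖ ≤ Cs * (2 * S.mL * (lam * transN D M lam t)
      + 3 * (ρ * rotN D M ρ t) + (S.mL * (B + S.g) + jM * (B ^ 2 + B))) := by
  rw [desTension_eq, norm_act_rot (h.R_mem t ht)]
  refine (hshare _ _).trans (mul_le_mul_of_nonneg_left ?_ hCs)
  simp only
  rw [norm_act_rot (rot_transpose_mem (h.R_mem t ht))]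
  have h1 := norm_le_insert' (desForce S D K M t) (S.mL • (iteratedDeriv 2 D.x t + S.g • e3))
  have h2 := norm_desForce_sub_le (S := S) (D := D) (M := M) (t := t) hl hx hv
  have h3 := norm_nominalForce_le (S := S) hB h0
  have h4 := norm_le_insert' (desMoment S D K M t)
    (cross (transportedΩ D M t) (act S.J (transportedΩ D M t))
      + act S.J (act (relRot D M t)ᵀ (deriv D.Ω t)))
  have h5 := norm_desMoment_sub_le h ht hρ hR hΩ
  have h6 := norm_transportedMoment_le h ht hj hJ hB h0
  linarith

/-- The commanded cable forces are close to the nominal ones when the weighted errors are small. -/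
theorem nominalTension_sub_le {B jM Cs : ℝ} (hj : 0 ≤ jM) (hCs : 0 ≤ Cs)
    (hJ : ∀ a, ‖act S.J a‖ ≤ jM * ‖a‖) (hB : D.BoundedBy B) (h0 : 0 ≤ t)
    (hshare : ∀ j p, ‖share S j p‖ ≤ Cs * (‖p.1‖ + ‖p.2‖))
    (hl : 0 ≤ lam) (hρ : 0 ≤ ρ) (hx : K.kx = lam ^ 2) (hv : K.kv = lam)
    (hR : K.kR = ρ ^ 2) (hΩ : K.kΩ = ρ) (j : Fin 4) :
    ‖nominalTension S D j t‖ - ‖desTension S D K M j t‖ ≤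
      Cs * (2 * S.mL * (lam * transN D M lam t) + 3 * (ρ * rotN D M ρ t)
        + 2 * √(ΨR D M t) * (S.mL * (B + S.g) + jM * (2 * B ^ 2 + B))) := by
  obtain ⟨-, -, hΩB, hdΩB, -⟩ := hB t h0
  have hB0 : 0 ≤ B := (norm_nonneg _).trans hΩB
  set Q := relRot D M t with hQ
  have hQT := rot_transpose_mem (relRot_mem h ht)
  have hrot : rotΨ (relRot D M t)ᵀ = ΨR D M t := rotΨ_transpose _
  have hclose : ∀ a, ‖act Qᵀ a - a‖ ≤ 2 * √(ΨR D M t) * ‖a‖ := fun a => by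
    rw [← hrot]; exact norm_act_sub_self_le hQT a
  set s := √(ΨR D M t) with hs
  have hs0 : 0 ≤ s := Real.sqrt_nonneg _
  set F₀ := S.mL • (iteratedDeriv 2 D.x t + S.g • e3) with hF₀
  set M₀ := cross (D.Ω t) (act S.J (D.Ω t)) + act S.J (deriv D.Ω t) with hM₀
  have hnomF : desForce S D ⟨0, 0, 0, 0, 0, 0⟩ D.motion t = F₀ := by
    simp [desForce, hF₀]
  have hrel : relRot D D.motion t = 1 := rot_transpose_mul (D.R_mem t)
  have hnomM : desMoment S D ⟨0, 0, 0, 0, 0, 0⟩ D.motion t = M₀ := by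
    rw [desMoment_eq, transportedΩ_eq, hrel, Matrix.transpose_one, one_act, one_act]
    simp [hM₀]
  have hnom : ‖nominalTension S D j t‖ = ‖share S j (act (D.R t)ᵀ F₀, M₀)‖ := by
    rw [nominalTension, desTension_eq, hnomF, hnomM]
    exact norm_act_rot (D.R_mem t) _
  have hact : ‖desTension S D K M j t‖
      = ‖share S j (act (M.R t)ᵀ (desForce S D K M t), desMoment S D K M t)‖ := by
    rw [desTension_eq, norm_act_rot (h.R_mem t ht)]
  rw [hnom, hact]
  refine (norm_sub_norm_le _ _).trans ?_
  rw [← map_sub]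
  refine (hshare _ _).trans (mul_le_mul_of_nonneg_left ?_ hCs)
  simp only [Prod.mk_sub_mk]
  have hF0n := norm_nominalForce_le (S := S) hB h0
  -- The distribution acts in the load frame, so the actual and the nominal force differ there by
  -- the relative rotation besides the feedback; `hclose` turns this into `√Ψ_R`.
  have e1 : act (M.R t)ᵀ F₀ = act Qᵀ (act (D.R t)ᵀ F₀) := by
    rw [hQ, relRot_transpose, ← act_mul, Matrix.mul_assoc, rot_mul_transpose (D.R_mem t), mul_one]
  have h1 : ‖act (D.R t)ᵀ F₀ - act (M.R t)ᵀ (desForce S D K M t)‖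
      ≤ 2 * s * (S.mL * (B + S.g)) + S.mL * (2 * lam * transN D M lam t) := by
    have e2 : act (D.R t)ᵀ F₀ - act (M.R t)ᵀ (desForce S D K M t)
        = -(act Qᵀ (act (D.R t)ᵀ F₀) - act (D.R t)ᵀ F₀)
          - act (M.R t)ᵀ (desForce S D K M t - F₀) := by
      rw [act_sub, e1]; abel
    rw [e2]
    refine (norm_sub_le _ _).trans (add_le_add ?_ ?_)
    · rw [norm_neg]
      refine (hclose _).trans ?_
      rw [norm_act_rot (rot_transpose_mem (D.R_mem t))]
      exact mul_le_mul_of_nonneg_left hF0n (by positivity)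
    · rw [norm_act_rot (rot_transpose_mem (h.R_mem t ht))]
      exact norm_desForce_sub_le hl hx hv
  have h2 : ‖M₀ - desMoment S D K M t‖
      ≤ 2 * s * (jM * (2 * B ^ 2 + B)) + 3 * ρ * rotN D M ρ t := by
    set z := transportedΩ D M t with hz
    have hzB : ‖z‖ ≤ B := (norm_transportedΩ h ht).le.trans hΩB
    have hzd : ‖z - D.Ω t‖ ≤ 2 * s * B := by
      rw [hz, transportedΩ_eq]
      exact (hclose _).trans (mul_le_mul_of_nonneg_left hΩB (by positivity))
    have e3 : M₀ - desMoment S D K M t = -(cross (z - D.Ω t) (act S.J z)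
        + cross (D.Ω t) (act S.J (z - D.Ω t))
        + act S.J (act Qᵀ (deriv D.Ω t) - deriv D.Ω t))
        - (desMoment S D K M t - (cross z (act S.J z) + act S.J (act Qᵀ (deriv D.Ω t)))) := by
      rw [hM₀, sub_cross, act_sub, act_sub, cross_sub]; abel
    rw [e3]
    refine (norm_sub_le _ _).trans (add_le_add ?_ (norm_desMoment_sub_le h ht hρ hR hΩ))
    rw [norm_neg]
    have b1 : ‖cross (z - D.Ω t) (act S.J z)‖ ≤ 2 * s * B * (jM * B) :=
      (norm_cross_le _ _).trans (mul_le_mul hzd ((hJ _).trans (mul_le_mul_of_nonneg_left hzB hj))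
        (norm_nonneg _) (by positivity))
    have b2 : ‖cross (D.Ω t) (act S.J (z - D.Ω t))‖ ≤ B * (jM * (2 * s * B)) :=
      (norm_cross_le _ _).trans (mul_le_mul hΩB ((hJ _).trans (mul_le_mul_of_nonneg_left hzd hj))
        (norm_nonneg _) hB0)
    have b3 : ‖act S.J (act Qᵀ (deriv D.Ω t) - deriv D.Ω t)‖ ≤ jM * (2 * s * B) :=
      (hJ _).trans (mul_le_mul_of_nonneg_left ((hclose _).trans
        (mul_le_mul_of_nonneg_left hdΩB (by positivity))) hj)
    calc _ ≤ 2 * s * B * (jM * B) + B * (jM * (2 * s * B)) + jM * (2 * s * B) :=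
          (norm_add_le _ _).trans (add_le_add ((norm_add_le _ _).trans (add_le_add b1 b2)) b3)
      _ = 2 * s * (jM * (2 * B ^ 2 + B)) := by ring
  linarith

theorem transV_deriv :
    HasDerivWithinAt (fun s => transV D M lam s)
      (lam ^ 2 * dot (errX D M t) (errV D M t) + dot (errV D M t)
          (-(K.kx • errX D M t) - K.kv • errV D M t
            + (1 / S.mL) • (∑ j, cablePert S D K M δq j t + δx t))
        + lam / 2 * (dot (errV D M t) (errV D M t) + dot (errX D M t)
          (-(K.kx • errX D M t) - K.kv • errV D M t
            + (1 / S.mL) • (∑ j, cablePert S D K M δq j t + δx t)))) (Set.Ico t₀ t₁) t := by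
  have hx := errX_deriv h ht
  have hv := errV_deriv h ht
  refine (((hasDerivWithinAt_dot hx hx).const_mul (lam ^ 2 / 2)).add
    ((hasDerivWithinAt_dot hv hv).const_mul (1 / 2)) |>.add
    ((hasDerivWithinAt_dot hx hv).const_mul (lam / 2))).congr_deriv ?_
  generalize -(K.kx • errX D M t) - K.kv • errV D M t
    + (1 / S.mL) • (∑ j, cablePert S D K M δq j t + δx t) = w
  rw [dot_comm (errV D M t) (errX D M t), dot_comm w (errV D M t)]
  ring

theorem rotV_deriv {ε : ℝ} :
    HasDerivWithinAt (fun s => rotV S D M ε ρ s)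
      (1 / 2 * (dot (derrΩ D M t) (act S.J (errΩ D M t))
          + dot (errΩ D M t) (act S.J (derrΩ D M t)))
        + ρ ^ 2 * dot (errR D M t) (errΩ D M t)
        + ε * ρ * (dot (rotErrDeriv (relRot D M t) (errΩ D M t)) (act S.J (errΩ D M t))
          + dot (errR D M t) (act S.J (derrΩ D M t)))) (Set.Ico t₀ t₁) t := by
  have hΩ := errΩ_deriv h ht
  have hJ := hasDerivWithinAt_act_const S.J hΩ
  exact ((hasDerivWithinAt_dot hΩ hJ).const_mul (1 / 2)).add
    ((ΨR_deriv h ht).const_mul (ρ ^ 2)) |>.add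
    ((hasDerivWithinAt_dot (errR_deriv h ht) hJ).const_mul (ε * ρ))

theorem cableV_deriv (j : Fin 4) :
    HasDerivWithinAt (cableV S D K M ν j)
      (dot (errω M j t) (derrω S D K M δq j t) + ν ^ 2 * dot (errQ S D K M j t) (errω M j t)
        + ν / 8 * (dot (derrQ S D K M j t) (errω M j t)
          + dot (errQ S D K M j t) (derrω S D K M δq j t))) (Set.Ico t₀ t₁) t := by
  have hω := errω_deriv h ht j
  refine (((hasDerivWithinAt_dot hω hω).const_mul (1 / 2)).add
    ((Ψq_deriv h ht j).const_mul (ν ^ 2)) |>.add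
    ((hasDerivWithinAt_dot (errQ_deriv h ht j) hω).const_mul (ν / 8))).congr_deriv ?_
  rw [dot_comm _ (errω M j t)]
  ring

end Estimates

/-- Constants of the rigid load: bounds `jm`, `jM` of the inertia and a bound `Cs` of the
distribution of the commanded force and moment among the cables. -/
structure Consts (S : Params) where
  jm : ℝ
  jM : ℝ
  Cs : ℝ
  jm_pos : 0 < jm
  jM_pos : 0 < jM
  Cs_pos : 0 < Cs
  J_ge : ∀ a, jm * ‖a‖ ^ 2 ≤ dot a (act S.J a)
  J_le : ∀ a, ‖act S.J a‖ ≤ jM * ‖a‖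
  share_le : ∀ j p, ‖share S j p‖ ≤ Cs * (‖p.1‖ + ‖p.2‖)

theorem nonempty_consts (S : Params) : Nonempty (Consts S) := by
  obtain ⟨jm, jM, h1, h2, h3, h4⟩ := exists_inertia_bounds S
  obtain ⟨Cs, h5, h6⟩ := exists_norm_share_le S
  exact ⟨⟨jm, jM, Cs, h1, h2, h5, h3, h4, h6⟩⟩

namespace Consts

variable {S : Params} (c : Consts S)

/-- The weight of the cross term in the rotational Lyapunov function. -/
def ε : ℝ := 1 / (10 * c.jM + 4)

/-- The gain from commanded cable forces and disturbances to the total cable perturbation. -/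
def C₀ : ℝ := 4 * c.Cs * (2 * S.mL + 4) + 4 * (S.mQ * S.L) + 1

/-- The gain from weighted errors and disturbances to the load accelerations. -/
def C₂ : ℝ := (1 / S.mL + 1 + ∑ j, ‖S.r j‖) * c.C₀

/-- The upper bound of the Lyapunov function of the load. -/
def C₃ : ℝ := 3 / 4 * c.jM + 9 / 8

/-- The lower bound of the Lyapunov function of the load. -/
def c₄ : ℝ := min (1 / 4) (c.jm / 4)

/-- A bound for the nominal force and moment. -/
def nomB (B : ℝ) : ℝ := S.mL * (B + S.g) + c.jM * (2 * B ^ 2 + B)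

/-- The bound of the accelerations of the load that do not vanish with the errors. -/
def resid (α B d : ℝ) : ℝ := c.C₂ * (α * c.nomB B + d)

/-- The decay rate of the Lyapunov function of the load. -/
def rate (lam : ℝ) : ℝ := c.ε * lam / (16 * c.C₃)

theorem ε_pos : 0 < c.ε := by have := c.jM_pos; unfold ε; positivity

theorem ε_mul : c.ε * (10 * c.jM + 4) = 1 := by
  have := c.jM_pos; unfold ε; field_simp

theorem ε_le : c.ε ≤ 1 / 4 := by nlinarith [c.ε_mul, mul_pos c.ε_pos c.jM_pos]

theorem C₀_pos : 0 < c.C₀ := by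
  have := c.Cs_pos; have := S.mL_pos; have := S.mQ_pos; have := S.L_pos; unfold C₀; positivity

theorem C₂_pos : 0 < c.C₂ := by
  have := c.C₀_pos; have := S.mL_pos; unfold C₂; positivity

theorem C₃_pos : 0 < c.C₃ := by have := c.jM_pos; unfold C₃; positivity

theorem c₄_pos : 0 < c.c₄ := by
  have := c.jm_pos; unfold c₄; positivity

theorem nomB_nonneg {B : ℝ} (hB : 0 ≤ B) : 0 ≤ c.nomB B := by
  have := c.jM_pos; have := S.mL_pos; have := S.g_pos; unfold nomB; positivity

theorem rate_pos {lam : ℝ} (hl : 0 < lam) : 0 < c.rate lam := by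
  have := c.ε_pos; have := c.C₃_pos; unfold rate; positivity

end Consts

/-- Here `ξ = lam * transN`, `ζ = ρ * rotN`, `k = C₂ α` and `h` is the residual. The part `k (ξ +
ζ)` uses up half of the weaker damping `ε / 4`, Young's inequality for `h` half of what is left. -/
theorem load_decay_real {ε k h ξ ζ b : ℝ} (hε : 0 < ε) (hε1 : ε ≤ 1) (hk : 32 * k ≤ ε)
    (hξ : 0 ≤ ξ) (hb : b = k * (ξ + ζ) + h) (hb0 : 0 ≤ b) :
    -(1 / 4) * ξ ^ 2 + 3 / 2 * ξ * b - ε / 4 * ζ ^ 2 + 2 * ζ * b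
      ≤ -(ε / 16) * (ξ ^ 2 + ζ ^ 2) + 32 / ε * h ^ 2 := by
  have h1 : 3 / 2 * ξ * b + 2 * ζ * b ≤ 2 * (ξ + ζ) * b := by
    linarith [mul_nonneg hξ hb0]
  have h2 : 2 * (ξ + ζ) * b = 2 * k * (ξ + ζ) ^ 2 + 2 * ξ * h + 2 * ζ * h := by rw [hb]; ring
  have h3 : 2 * k * (ξ + ζ) ^ 2 ≤ ε / 8 * (ξ ^ 2 + ζ ^ 2) := by
    have a1 := mul_le_mul_of_nonneg_right hk (sq_nonneg (ξ + ζ))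
    have a2 := mul_le_mul_of_nonneg_left
      (show (ξ + ζ) ^ 2 ≤ 2 * (ξ ^ 2 + ζ ^ 2) by linarith [sq_nonneg (ξ - ζ)]) hε.le
    linarith
  have young : ∀ x : ℝ, 2 * x * h ≤ ε / 16 * x ^ 2 + 16 / ε * h ^ 2 := by
    intro x
    have : ε / 16 * x ^ 2 + 16 / ε * h ^ 2 - 2 * x * h = ε / 16 * (x - 16 / ε * h) ^ 2 := by
      field_simp; ring
    have : 0 ≤ ε / 16 * (x - 16 / ε * h) ^ 2 := by positivity
    linarith
  have h4 := young ξ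
  have h5 := young ζ
  have h6 := mul_le_mul_of_nonneg_right hε1 (sq_nonneg ξ)
  have h7 : 32 / ε * h ^ 2 = 16 / ε * h ^ 2 + 16 / ε * h ^ 2 := by ring
  linarith

/-! ### Decay of the Lyapunov functions along trajectories. -/

section LoadEstimates

variable {S : Params} (c : Consts S) {D : Desired} {K : Gains} {M : Motion} {δx δR : ℝ → E3}
  {δq : Fin 4 → ℝ → E3} {t₀ t₁ t lam ρ ν α B d : ℝ}
variable (h : IsTrajectory S D K M δx δR δq (Set.Ico t₀ t₁)) (ht : t ∈ Set.Ico t₀ t₁)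
include h ht

/-- The misalignment contributes `α` times the commanded forces. The errors in those forces give a
term that the dissipation absorbs, while their nominal part and the disturbances form `resid`. -/
theorem norm_pert_le (hB : D.BoundedBy B) (h0 : 0 ≤ t) (hl : 0 ≤ lam) (hρ : 0 ≤ ρ)
    (hx : K.kx = lam ^ 2) (hv : K.kv = lam) (hR : K.kR = ρ ^ 2) (hΩ : K.kΩ = ρ)
    (hδ : ‖δx t‖ ≤ d ∧ ‖δR t‖ ≤ d ∧ ∀ j, ‖δq j t‖ ≤ d)
    (hα : ∀ j, ‖errQ S D K M j t‖ ≤ α) :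
    ‖(1 / S.mL) • (∑ j, cablePert S D K M δq j t + δx t)‖
        ≤ c.C₂ * α * (lam * transN D M lam t + ρ * rotN D M ρ t) + c.resid α B d ∧
      ‖∑ j, cross (S.r j) (act (M.R t)ᵀ (cablePert S D K M δq j t)) + δR t‖
        ≤ c.C₂ * α * (lam * transN D M lam t + ρ * rotN D M ρ t) + c.resid α B d := by
  obtain ⟨h1, h2, h3⟩ := hδ
  have hd0 : 0 ≤ d := (norm_nonneg _).trans h1
  have hα0 : 0 ≤ α := (norm_nonneg _).trans (hα 0)
  have hB0 : 0 ≤ B := (norm_nonneg _).trans (hB t h0).1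
  have hCs := c.Cs_pos
  have hmL := S.mL_pos
  have hQL := mul_pos S.mQ_pos S.L_pos
  set ξ := lam * transN D M lam t with hξ
  set ζ := ρ * rotN D M ρ t with hζ
  have hξ0 : 0 ≤ ξ := mul_nonneg hl (Real.sqrt_nonneg _)
  have hζ0 : 0 ≤ ζ := mul_nonneg hρ (Real.sqrt_nonneg _)
  have hnB := c.nomB_nonneg hB0
  have hμ : ∀ j, ‖desTension S D K M j t‖ ≤ c.Cs * (2 * S.mL * ξ + 3 * ζ + c.nomB B) := fun j =>
    (norm_desTension_le h ht c.jM_pos.le hCs.le c.J_le hB h0 c.share_le hl hρ hx hv hR hΩ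
      j).trans (mul_le_mul_of_nonneg_left (by
        have := mul_nonneg c.jM_pos.le (sq_nonneg B)
        unfold Consts.nomB; linarith) hCs.le)
  set p := c.Cs * (2 * S.mL * ξ + 3 * ζ + c.nomB B) * α + S.mQ * S.L * d with hp
  have hp0 : 0 ≤ p := by positivity
  have hcp : ∀ j, ‖cablePert S D K M δq j t‖ ≤ p := fun j =>
    (norm_cablePert_le h ht j).trans (add_le_add
      (mul_le_mul (hμ j) (hα j) (norm_nonneg _) (by positivity))
      (mul_le_mul_of_nonneg_left (h3 j) hQL.le))
  have hP : 4 * p + d ≤ c.C₀ * (α * (ξ + ζ) + (α * c.nomB B + d)) := by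
    have a1 : 0 ≤ α * ξ := mul_nonneg hα0 hξ0
    have a2 : 0 ≤ α * ζ := mul_nonneg hα0 hζ0
    have a3 : 0 ≤ α * c.nomB B := mul_nonneg hα0 hnB
    have b1 : 0 ≤ c.Cs * S.mL * (α * ζ) := by positivity
    have b2 : 0 ≤ c.Cs * S.mL * (α * c.nomB B) := by positivity
    have b3 : 0 ≤ c.Cs * S.mL * d := by positivity
    have b4 : 0 ≤ S.mQ * S.L * (α * ξ + α * ζ + α * c.nomB B) := by positivity
    have b5 := mul_nonneg hCs.le a1
    have b6 := mul_nonneg hCs.le a2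
    have b7 := mul_nonneg hCs.le a3
    have b8 := mul_nonneg hCs.le hd0
    rw [hp, Consts.C₀]
    linarith
  have hr0 : 0 ≤ ∑ j, ‖S.r j‖ := Finset.sum_nonneg fun j _ => norm_nonneg _
  have hP0 : 0 ≤ 4 * p + d := by positivity
  have hfin : ∀ k, 0 ≤ k → k ≤ 1 / S.mL + 1 + ∑ j, ‖S.r j‖ → k * (4 * p + d)
      ≤ c.C₂ * α * (ξ + ζ) + c.resid α B d := by
    intro k _ hk
    calc k * (4 * p + d) ≤ (1 / S.mL + 1 + ∑ j, ‖S.r j‖)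
          * (c.C₀ * (α * (ξ + ζ) + (α * c.nomB B + d))) :=
          mul_le_mul hk hP hP0 (by positivity)
      _ = c.C₂ * α * (ξ + ζ) + c.resid α B d := by rw [Consts.resid, Consts.C₂]; ring
  have hm1 : 0 < 1 / S.mL := by positivity
  constructor
  · rw [norm_smul, Real.norm_of_nonneg hm1.le]
    refine le_trans (mul_le_mul_of_nonneg_left ?_ hm1.le) (hfin (1 / S.mL) hm1.le (by linarith))
    refine (norm_add_le _ _).trans (add_le_add ?_ h1)
    refine (norm_sum_le _ _).trans ((Finset.sum_le_sum fun j _ => hcp j).trans ?_)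
    simp
  · refine le_trans ?_ (hfin (1 + ∑ j, ‖S.r j‖) (by positivity) (by linarith))
    have a1 : ‖∑ j, cross (S.r j) (act (M.R t)ᵀ (cablePert S D K M δq j t))‖
        ≤ (∑ j, ‖S.r j‖) * p := by
      refine (norm_sum_le _ _).trans ?_
      rw [Finset.sum_mul]
      refine Finset.sum_le_sum fun j _ => (norm_cross_le _ _).trans ?_
      rw [norm_act_rot (rot_transpose_mem (h.R_mem t ht))]
      exact mul_le_mul_of_nonneg_left (hcp j) (norm_nonneg _)
    refine (norm_add_le _ _).trans ((add_le_add a1 h2).trans ?_)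
    have := mul_nonneg hr0 hp0
    have := mul_nonneg hr0 hd0
    linarith

theorem loadV_bounds (hl : 0 < lam) (hρ : 0 < ρ) :
    c.c₄ * (lam / ρ * transN D M lam t ^ 2 + rotN D M ρ t ^ 2) ≤ loadV S D M c.ε lam ρ t ∧
      loadV S D M c.ε lam ρ t
        ≤ c.C₃ * (lam / ρ * transN D M lam t ^ 2 + rotN D M ρ t ^ 2) ∧
      7 / 8 * (ρ ^ 2 * ΨR D M t) ≤ loadV S D M c.ε lam ρ t ∧
      loadV S D M c.ε lam ρ t ≤ 3 / 4 * (lam / ρ * transN D M lam t ^ 2)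
        + 3 / 4 * c.jM * ‖errΩ D M t‖ ^ 2 + 9 / 8 * (ρ ^ 2 * ΨR D M t) := by
  have hΨ := ΨR_nonneg h ht
  have hr := rotN_sq (ρ := ρ) h ht
  have hx := transN_sq (D := D) (M := M) (lam := lam) (t := t)
  obtain ⟨a1, a2⟩ := trans_bounds (ex := errX D M t) (ev := errV D M t) hl
  obtain ⟨b1, b2⟩ := rot_bounds (e := errΩ D M t) c.J_ge c.J_le c.jm_pos c.jM_pos c.ε_pos
    c.ε_mul.le hρ hΨ (norm_errR_sq h ht)
  rw [← hx] at a1 a2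
  have hq : 0 < lam / ρ := by positivity
  have a1' := mul_le_mul_of_nonneg_left a1 hq.le
  have a2' := mul_le_mul_of_nonneg_left a2 hq.le
  have hN0 : 0 ≤ lam / ρ * transN D M lam t ^ 2 := by positivity
  have hY0 := sq_nonneg ‖errΩ D M t‖
  have hP0 : 0 ≤ ρ ^ 2 * ΨR D M t := by positivity
  have hjm := mul_nonneg c.jm_pos.le hY0
  have hjM := mul_nonneg c.jM_pos.le hY0
  have e : loadV S D M c.ε lam ρ t = lam / ρ * transV D M lam t + rotV S D M c.ε ρ t := rfl
  unfold transV rotV at e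
  have m1 : c.c₄ ≤ 1 / 4 := min_le_left _ _
  have m2 : c.c₄ ≤ c.jm / 4 := min_le_right _ _
  refine ⟨?_, ?_, ?_, ?_⟩
  · rw [hr, e]
    have x1 := mul_le_mul_of_nonneg_right m1 hN0
    have x2 := mul_le_mul_of_nonneg_right m2 hY0
    have x3 := mul_le_mul_of_nonneg_right m1 hP0
    linarith
  · rw [hr, e, Consts.C₃]
    have x1 := mul_nonneg c.jM_pos.le hN0
    have x2 := mul_nonneg c.jM_pos.le hP0
    linarith
  · rw [e]; linarith
  · rw [e]; linarith

/-- The derivative exists unconditionally, its bound only while the cable and attitude errors are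
small. The statement is split accordingly, as `barrier` requires. -/
theorem loadV_decay (hB : D.BoundedBy B) (h0 : 0 ≤ t) (hl : 0 < lam) (hlρ : lam ≤ ρ)
    (hρB : 3 * c.jM * B ≤ ρ)
    (hx : K.kx = lam ^ 2) (hv : K.kv = lam) (hR : K.kR = ρ ^ 2) (hΩ : K.kΩ = ρ)
    (hα32 : 32 * (c.C₂ * α) ≤ c.ε)
    (hδ : ‖δx t‖ ≤ d ∧ ‖δR t‖ ≤ d ∧ ∀ j, ‖δq j t‖ ≤ d) :
    ∃ v' : ℝ, HasDerivWithinAt (fun s => loadV S D M c.ε lam ρ s) v' (Set.Ico t₀ t₁) t ∧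
      ((∀ j, ‖errQ S D K M j t‖ ≤ α) → ΨR D M t ≤ 3 / 2 →
        v' ≤ -c.rate lam * loadV S D M c.ε lam ρ t
          + 32 * c.resid α B d ^ 2 / (c.ε * ρ)) := by
  have hρ : 0 < ρ := hl.trans_le hlρ
  refine ⟨_, ((transV_deriv (lam := lam) h ht).const_mul (lam / ρ)).add
    (rotV_deriv (ρ := ρ) (ε := c.ε) h ht), fun hα hΨ => ?_⟩
  obtain ⟨p1, p2⟩ := norm_pert_le c h ht hB h0 hl.le hρ.le hx hv hR hΩ hδ hα
  obtain ⟨-, -, hΩB, -, -⟩ := hB t h0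
  have hB0 : 0 ≤ B := (norm_nonneg _).trans hΩB
  have hα0 : 0 ≤ α := (norm_nonneg _).trans (hα 0)
  have hd0 : 0 ≤ d := (norm_nonneg _).trans hδ.1
  have hz : ‖transportedΩ D M t‖ ≤ B := (norm_transportedΩ h ht).le.trans hΩB
  have hNx : 0 ≤ transN D M lam t := Real.sqrt_nonneg _
  have hNR : 0 ≤ rotN D M ρ t := Real.sqrt_nonneg _
  have e1 := trans_decay (ex := errX D M t) (ev := errV D M t) hl p1 hNx transN_sq
  have hJe := J_derrΩ h ht
  rw [hR, hΩ] at hJe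
  have e2 := rot_decay c.J_le c.jM_pos c.ε_pos c.ε_mul.le hz hρB hρ p2 (ΨR_nonneg h ht) hΨ
    (norm_errR_sq h ht) (norm_rotErrDeriv_le (relRot_mem h ht) _) hJe hNR (rotN_sq h ht)
  rw [hx, hv]
  have hVle := (loadV_bounds c h ht hl hρ).2.1
  set b := c.C₂ * α * (lam * transN D M lam t + ρ * rotN D M ρ t) + c.resid α B d with hb
  have hb0 : 0 ≤ b := (norm_nonneg _).trans p1
  have key := load_decay_real (h := c.resid α B d) c.ε_pos (by linarith [c.ε_le]) hα32
    (mul_nonneg hl.le hNx) hb hb0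
  have e1' := mul_le_mul_of_nonneg_left e1 (show 0 ≤ lam / ρ by positivity)
  refine (add_le_add e1' e2).trans ?_
  set X := transN D M lam t
  set Y := rotN D M ρ t
  -- The weight `lam / ρ` of `transV` is made for this: both dissipations get the common factor `1 /
  -- ρ` in the variables `lam * X` and `ρ * Y`, which also measure the perturbation.
  have f1 : lam / ρ * (-(lam / 4) * X ^ 2 + 3 / 2 * X * b) + (-(c.ε / 4) * ρ * Y ^ 2 + 2 * Y * b)
      = 1 / ρ * (-(1 / 4) * (lam * X) ^ 2 + 3 / 2 * (lam * X) * b - c.ε / 4 * (ρ * Y) ^ 2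
        + 2 * (ρ * Y) * b) := by field_simp; ring
  rw [f1]
  refine (mul_le_mul_of_nonneg_left key (by positivity)).trans ?_
  have f2 : 1 / ρ * (-(c.ε / 16) * ((lam * X) ^ 2 + (ρ * Y) ^ 2)
      + 32 / c.ε * c.resid α B d ^ 2) = -(c.ε / 16 * (lam * (lam / ρ * X ^ 2) + ρ * Y ^ 2))
      + 32 * c.resid α B d ^ 2 / (c.ε * ρ) := by
    have := c.ε_pos; field_simp
  rw [f2]
  refine add_le_add ?_ le_rfl
  rw [neg_mul]
  refine neg_le_neg ?_
  -- The position part decays at a rate proportional to `lam`, the attitude part to `ρ ≥ lam`; only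
  -- the slower rate is kept.
  have f3 : c.rate lam * loadV S D M c.ε lam ρ t ≤ c.ε / 16 * (lam * (lam / ρ * X ^ 2 + Y ^ 2)) := by
    refine (mul_le_mul_of_nonneg_left hVle (c.rate_pos hl).le).trans (le_of_eq ?_)
    have := c.C₃_pos
    unfold Consts.rate; field_simp
  refine f3.trans (mul_le_mul_of_nonneg_left ?_ (by have := c.ε_pos; positivity))
  have := mul_le_mul_of_nonneg_right hlρ (sq_nonneg Y)
  linarith

theorem cableV_bounds {j : Fin 4} (hν : 0 < ν) (hμ : desTension S D K M j t ≠ 0) :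
    7 / 16 * ‖errω M j t‖ ^ 2 + 7 / 8 * (ν ^ 2 * Ψq S D K M j t) ≤ cableV S D K M ν j t ∧
      cableV S D K M ν j t
        ≤ 9 / 16 * ‖errω M j t‖ ^ 2 + 9 / 8 * (ν ^ 2 * Ψq S D K M j t) :=
  cable_bounds hν (norm_errQ_sq h ht hμ)

theorem cableV_decay {j : Fin 4} (hν : 0 < ν) (hkq : K.kq = ν ^ 2) (hkω : K.kω = ν)
    (hδ : ‖δq j t‖ ≤ d) :
    ∃ v' : ℝ, HasDerivWithinAt (cableV S D K M ν j) v' (Set.Ico t₀ t₁) t ∧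
      (desTension S D K M j t ≠ 0 → ‖M.ωd j t‖ ≤ ν → Ψq S D K M j t ≤ 1 →
        v' ≤ -(ν / 64) * cableV S D K M ν j t + 3 * d ^ 2 / ν) := by
  refine ⟨_, cableV_deriv h ht j, fun hμ hωd hΨ => ?_⟩
  refine cable_decay (k := dot (cross (M.ω j t) (M.q j t)) (M.ωd j t)) hν (h.q_norm t ht j)
    (norm_desCable hμ) hωd hδ (Ψq_nonneg h ht j) hΨ (norm_errQ_sq h ht hμ)
    (dot_q_errω h ht j) (dot_cross_self_right _ _) ?_ rfl
  rw [derrω, hkq, hkω]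

end LoadEstimates

/-! ### Rotation rate of the desired cable directions, uniformly in the cable gains. -/

/-- A family of vectors is bounded. -/
def Bdd {ι : Type*} (f : ι → E3) : Prop := ∃ C : ℝ, ∀ i, ‖f i‖ ≤ C

namespace Bdd

variable {ι : Type*} {f g : ι → E3}

theorem of_norm_le_mul (C : ℝ) (hC : 0 ≤ C) (hg : Bdd g) (h : ∀ i, ‖f i‖ ≤ C * ‖g i‖) : Bdd f := by
  obtain ⟨B, hB⟩ := hg
  exact ⟨C * B, fun i => (h i).trans (mul_le_mul_of_nonneg_left (hB i) hC)⟩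

theorem of_norm_eq (hg : Bdd g) (h : ∀ i, ‖f i‖ = ‖g i‖) : Bdd f :=
  of_norm_le_mul 1 zero_le_one hg fun i => by rw [one_mul, h]

theorem const (a : E3) : Bdd fun _ : ι => a := ⟨‖a‖, fun _ => le_rfl⟩

theorem add (hf : Bdd f) (hg : Bdd g) : Bdd fun i => f i + g i := by
  obtain ⟨A, hA⟩ := hf
  obtain ⟨B, hB⟩ := hg
  exact ⟨A + B, fun i => (norm_add_le _ _).trans (add_le_add (hA i) (hB i))⟩

theorem neg (hf : Bdd f) : Bdd fun i => -f i := hf.of_norm_eq fun _ => norm_neg _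

theorem sub (hf : Bdd f) (hg : Bdd g) : Bdd fun i => f i - g i := by
  simpa only [sub_eq_add_neg] using hf.add hg.neg

theorem smul (k : ℝ) (hf : Bdd f) : Bdd fun i => k • f i :=
  of_norm_le_mul |k| (abs_nonneg k) hf fun i => by rw [norm_smul, Real.norm_eq_abs]

theorem cross (hf : Bdd f) (hg : Bdd g) : Bdd fun i => LoadTransport.cross (f i) (g i) := by
  obtain ⟨A, hA⟩ := hf
  obtain ⟨B, hB⟩ := hg
  exact ⟨A * B, fun i => (norm_cross_le _ _).trans
    (mul_le_mul (hA i) (hB i) (norm_nonneg _) ((norm_nonneg _).trans (hA i)))⟩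

theorem act_const (A : M3) (hf : Bdd f) : Bdd fun i => act A (f i) := by
  obtain ⟨C, hC, h⟩ := exists_norm_act_le A
  exact of_norm_le_mul C hC.le hf fun i => h _

theorem act_rot {R : ι → M3} (hR : ∀ i, R i ∈ Matrix.specialOrthogonalGroup (Fin 3) ℝ)
    (hf : Bdd f) : Bdd fun i => act (R i) (f i) :=
  hf.of_norm_eq fun i => norm_act_rot (hR i) _

theorem act_rot_transpose {R : ι → M3}
    (hR : ∀ i, R i ∈ Matrix.specialOrthogonalGroup (Fin 3) ℝ)
    (hf : Bdd f) : Bdd fun i => act (R i)ᵀ (f i) :=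
  hf.of_norm_eq fun i => norm_act_rot (rot_transpose_mem (hR i)) _

theorem share (S : Params) (j : Fin 4) (hf : Bdd f) (hg : Bdd g) :
    Bdd fun i => LoadTransport.share S j (f i, g i) := by
  obtain ⟨C, hC, h⟩ := exists_norm_share_le S
  obtain ⟨A, hA⟩ := hf
  obtain ⟨B, hB⟩ := hg
  exact ⟨C * (A + B), fun i => (h j _).trans
    (mul_le_mul_of_nonneg_left (add_le_add (hA i) (hB i)) hC.le)⟩

theorem sum {κ : Type*} (s : Finset κ) {F : κ → ι → E3} (hF : ∀ k, Bdd (F k)) :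
    Bdd fun i => ∑ k ∈ s, F k i := by
  choose C hC using hF
  exact ⟨∑ k ∈ s, C k, fun i => (norm_sum_le _ _).trans (Finset.sum_le_sum fun k _ => hC k i)⟩

end Bdd

/-- An instant of a closed-loop trajectory at which the load errors are bounded by `n` and the
disturbances by `d`. -/
structure Instant (S : Params) (D : Desired) (lam ρ n d : ℝ) where
  ν : ℝ
  M : Motion
  δx : ℝ → E3
  δR : ℝ → E3
  δq : Fin 4 → ℝ → E3
  t₀ : ℝ
  t₁ : ℝ
  t : ℝ
  traj : IsTrajectory S D (gains lam ρ ν) M δx δR δq (Set.Ico t₀ t₁)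
  mem : t ∈ Set.Ico t₀ t₁
  nonneg : 0 ≤ t
  errX_le : ‖errX D M t‖ ≤ n
  errV_le : ‖errV D M t‖ ≤ n
  errΩ_le : ‖errΩ D M t‖ ≤ n
  dist_le : ‖δx t‖ ≤ d ∧ ‖δR t‖ ≤ d ∧ ∀ j, ‖δq j t‖ ≤ d

section CommandDerivative

variable {S : Params} {D : Desired} {K : Gains} {M : Motion} {δx δR : ℝ → E3}
  {δq : Fin 4 → ℝ → E3} {t₀ t₁ t : ℝ}

/-- The derivative of the velocity error along closed-loop trajectories. -/
def derrV (S : Params) (D : Desired) (K : Gains) (M : Motion) (δx : ℝ → E3)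
    (δq : Fin 4 → ℝ → E3) (t : ℝ) : E3 :=
  -(K.kx • errX D M t) - K.kv • errV D M t
    + (1 / S.mL) • (∑ j, cablePert S D K M δq j t + δx t)

/-- The derivative of the transported angular velocity. -/
def dtransportedΩ (D : Desired) (M : Motion) (t : ℝ) : E3 :=
  -cross (errΩ D M t) (transportedΩ D M t) + act (relRot D M t)ᵀ (deriv D.Ω t)

/-- The derivative of the commanded force. -/
def ddesForce (S : Params) (D : Desired) (K : Gains) (M : Motion) (δx : ℝ → E3)
    (δq : Fin 4 → ℝ → E3) (t : ℝ) : E3 :=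
  S.mL • (-(K.kx • errV D M t) - K.kv • derrV S D K M δx δq t + iteratedDeriv 3 D.x t)

/-- The derivative of the commanded moment. -/
def ddesMoment (S : Params) (D : Desired) (K : Gains) (M : Motion) (t : ℝ) : E3 :=
  -(K.kR • rotErrDeriv (relRot D M t) (errΩ D M t)) - K.kΩ • derrΩ D M t
    + (cross (dtransportedΩ D M t) (act S.J (transportedΩ D M t))
      + cross (transportedΩ D M t) (act S.J (dtransportedΩ D M t)))
    + act S.J (-cross (errΩ D M t) (act (relRot D M t)ᵀ (deriv D.Ω t))
      + act (relRot D M t)ᵀ (iteratedDeriv 2 D.Ω t))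

/-- The derivative of the commanded cable force. -/
def ddesTension (S : Params) (D : Desired) (K : Gains) (M : Motion) (δx : ℝ → E3)
    (δq : Fin 4 → ℝ → E3) (j : Fin 4) (t : ℝ) : E3 :=
  act (M.R t) (cross (M.Ω t)
      (share S j (act (M.R t)ᵀ (desForce S D K M t), desMoment S D K M t))
    + share S j (-cross (M.Ω t) (act (M.R t)ᵀ (desForce S D K M t))
      + act (M.R t)ᵀ (ddesForce S D K M δx δq t), ddesMoment S D K M t))

variable (h : IsTrajectory S D K M δx δR δq (Set.Ico t₀ t₁)) (ht : t ∈ Set.Ico t₀ t₁)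
include h ht

theorem desForce_deriv :
    HasDerivWithinAt (desForce S D K M) (ddesForce S D K M δx δq t) (Set.Ico t₀ t₁) t := by
  have hx := (errX_deriv h ht).const_smul K.kx
  have hv := (errV_deriv h ht).const_smul K.kv
  have ha := (D.hasDerivAt_dv t).hasDerivWithinAt (s := Set.Ico t₀ t₁)
  exact (((hx.neg.sub hv).add ha).add_const (S.g • e3)).const_smul S.mL

theorem desMoment_deriv :
    HasDerivWithinAt (desMoment S D K M) (ddesMoment S D K M t) (Set.Ico t₀ t₁) t := by
  have e : desMoment S D K M = fun s => -(K.kR • errR D M s) - K.kΩ • errΩ D M s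
      + cross (transportedΩ D M s) (act S.J (transportedΩ D M s))
      + act S.J (act (relRot D M s)ᵀ (deriv D.Ω s)) := funext fun s => desMoment_eq
  rw [e]
  have hz := transportedΩ_deriv h ht
  exact ((((errR_deriv h ht).const_smul K.kR).neg.sub ((errΩ_deriv h ht).const_smul K.kΩ)).add
    (hasDerivWithinAt_cross hz (hasDerivWithinAt_act_const S.J hz))).add
    (hasDerivWithinAt_act_const S.J (transported_dΩ_deriv h ht))

theorem desTension_deriv (j : Fin 4) :
    HasDerivWithinAt (desTension S D K M j) (ddesTension S D K M δx δq j t)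
      (Set.Ico t₀ t₁) t :=
  hasDerivWithinAt_act_rot (h.R_kin t ht) (hasDerivWithinAt_share S j
    (hasDerivWithinAt_act_rot_transpose (h.R_kin t ht) (desForce_deriv h ht))
    (desMoment_deriv h ht))

/-- Differentiate `μ̃ = -‖μ̃‖ q̃` and take the scalar product with `q̃'`. As `q̃'` is orthogonal to
`q̃`, the derivative of the norm drops out; and `‖q̃'‖ = ‖ω̃‖` because `ω̃` is orthogonal to `q̃`.
-/
theorem norm_ωd_le {j : Fin 4} (hμ : desTension S D K M j t ≠ 0) :
    ‖desTension S D K M j t‖ * ‖M.ωd j t‖ ≤ ‖ddesTension S D K M δx δq j t‖ := by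
  have hqd := norm_desCable hμ
  set q' := cross (M.ωd j t) (desCable S D K M j t) with hq'
  set μ' := ddesTension S D K M δx δq j t
  have hn : ‖q'‖ = ‖M.ωd j t‖ := by
    have : ‖q'‖ ^ 2 = ‖M.ωd j t‖ ^ 2 := by
      rw [hq', norm_cross_sq, hqd, h.ωd_tangent t ht j]; ring
    exact (pow_left_inj₀ (norm_nonneg _) (norm_nonneg _) two_ne_zero).1 this
  have h1 := h.desCable_deriv t ht j
  have h2 := desTension_deriv h ht j
  have h3 : DifferentiableWithinAt ℝ (fun s => ‖desTension S D K M j s‖) (Set.Ico t₀ t₁) t :=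
    h2.differentiableWithinAt.norm ℝ hμ
  have h4 := (h3.hasDerivWithinAt.smul h1).neg
  have e : desTension S D K M j
      = fun s => -(‖desTension S D K M j s‖ • desCable S D K M j s) :=
    funext fun s => desTension_eq_smul j
  have h5 := (uniqueDiffOn_Ico t₀ t₁ t ht).eq_deriv _ h2
    (h4.congr_of_mem (fun s _ => congrFun e s) ht)
  have h6 := congrArg (dot q') h5
  have hperp : dot q' (desCable S D K M j t) = 0 := by
    rw [dot_comm]; exact dot_cross_self_right _ _
  rw [dot_neg, dot_add, dot_smul, dot_smul, dot_self, hperp] at h6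
  have h7 := neg_le_dot q' μ'
  rw [← hn]
  by_cases hz : ‖q'‖ = 0
  · rw [hz, mul_zero]; exact norm_nonneg _
  · have hp : 0 < ‖q'‖ := lt_of_le_of_ne (norm_nonneg _) (Ne.symm hz)
    refine le_of_mul_le_mul_left ?_ hp
    nlinarith

end CommandDerivative

section Bounded

variable {S : Params} {D : Desired} {B lam ρ n d : ℝ}

/-- The commanded cable forces change at a rate that is bounded uniformly in the cable gains. -/
theorem bdd_ddesTension (hB : D.BoundedBy B) (j : Fin 4) :
    Bdd fun i : Instant S D lam ρ n d =>
      ddesTension S D (gains lam ρ i.ν) i.M i.δx i.δq j i.t := by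
  -- `ν` is a field of `Instant`, whereas `lam`, `ρ`, `n`, `d` are parameters. A bound over this
  -- index type is therefore uniform in `ν`, in the trajectory and in time.
  let Idx := Instant S D lam ρ n d
  obtain ⟨c⟩ := nonempty_consts S
  have hR : ∀ i : Idx, i.M.R i.t ∈ Matrix.specialOrthogonalGroup (Fin 3) ℝ :=
    fun i => i.traj.R_mem _ i.mem
  have hQ : ∀ i : Idx, relRot D i.M i.t ∈ Matrix.specialOrthogonalGroup (Fin 3) ℝ :=
    fun i => relRot_mem i.traj i.mem
  have bX : Bdd fun i : Idx => errX D i.M i.t := ⟨n, fun i => i.errX_le⟩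
  have bV : Bdd fun i : Idx => errV D i.M i.t := ⟨n, fun i => i.errV_le⟩
  have bΩ : Bdd fun i : Idx => errΩ D i.M i.t := ⟨n, fun i => i.errΩ_le⟩
  have bR : Bdd fun i : Idx => errR D i.M i.t := ⟨1, fun i => by
    apply le_of_sq_le_sq _ zero_le_one
    rw [norm_errR_sq i.traj i.mem]; nlinarith [sq_nonneg (ΨR D i.M i.t - 1)]⟩
  have b2 : Bdd fun i : Idx => iteratedDeriv 2 D.x i.t := ⟨B, fun i => (hB _ i.nonneg).1⟩
  have b3 : Bdd fun i : Idx => iteratedDeriv 3 D.x i.t := ⟨B, fun i => (hB _ i.nonneg).2.1⟩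
  have bw : Bdd fun i : Idx => D.Ω i.t := ⟨B, fun i => (hB _ i.nonneg).2.2.1⟩
  have bdw : Bdd fun i : Idx => deriv D.Ω i.t := ⟨B, fun i => (hB _ i.nonneg).2.2.2.1⟩
  have bddw : Bdd fun i : Idx => iteratedDeriv 2 D.Ω i.t := ⟨B, fun i => (hB _ i.nonneg).2.2.2.2⟩
  have bz : Bdd fun i : Idx => transportedΩ D i.M i.t :=
    bw.of_norm_eq fun i => norm_transportedΩ i.traj i.mem
  have bQdw := bdw.act_rot_transpose hQ
  have bdz : Bdd fun i : Idx => dtransportedΩ D i.M i.t := (bΩ.cross bz).neg.add bQdw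
  have bΩL : Bdd fun i : Idx => i.M.Ω i.t := (bΩ.add bz).of_norm_eq fun i => by
    rw [errΩ]; congr 1; abel
  have bF : Bdd fun i : Idx => desForce S D (gains lam ρ i.ν) i.M i.t :=
    (((bX.smul (lam ^ 2)).neg.sub (bV.smul lam)).add b2 |>.add (Bdd.const (S.g • e3))).smul S.mL
  have bM : Bdd fun i : Idx => desMoment S D (gains lam ρ i.ν) i.M i.t :=
    ((((bR.smul (ρ ^ 2)).neg.sub (bΩ.smul ρ)).add (bz.cross (bz.act_const S.J))).add
      (bQdw.act_const S.J)).of_norm_eq fun i => by rw [desMoment_eq]; rfl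
  have bshare : ∀ k, Bdd fun i : Idx => share S k
      (act (i.M.R i.t)ᵀ (desForce S D (gains lam ρ i.ν) i.M i.t),
        desMoment S D (gains lam ρ i.ν) i.M i.t) := fun k =>
    Bdd.share S k (bF.act_rot_transpose hR) bM
  have bμ : ∀ k, Bdd fun i : Idx => desTension S D (gains lam ρ i.ν) i.M k i.t := fun k =>
    (bshare k).act_rot hR
  have bq : ∀ k, Bdd fun i : Idx => i.M.q k i.t :=
    fun k => ⟨1, fun i => (i.traj.q_norm _ i.mem k).le⟩
  have bδq : ∀ k, Bdd fun i : Idx => i.δq k i.t := fun k => ⟨d, fun i => i.dist_le.2.2 k⟩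
  have bδx : Bdd fun i : Idx => i.δx i.t := ⟨d, fun i => i.dist_le.1⟩
  have bδR : Bdd fun i : Idx => i.δR i.t := ⟨d, fun i => i.dist_le.2.1⟩
  have bP : ∀ k, Bdd fun i : Idx => cablePert S D (gains lam ρ i.ν) i.M i.δq k i.t := fun k =>
    ((bq k).cross ((bq k).cross (bμ k))).add (((bδq k).cross (bq k)).smul (S.mQ * S.L))
  have bdV : Bdd fun i : Idx => derrV S D (gains lam ρ i.ν) i.M i.δx i.δq i.t :=
    ((bX.smul (lam ^ 2)).neg.sub (bV.smul lam)).add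
      (((Bdd.sum Finset.univ bP).add bδx).smul (1 / S.mL))
  have bdF : Bdd fun i : Idx => ddesForce S D (gains lam ρ i.ν) i.M i.δx i.δq i.t :=
    (((bV.smul (lam ^ 2)).neg.sub (bdV.smul lam)).add b3).smul S.mL
  have bJdΩ : Bdd fun i : Idx => act S.J (derrΩ D i.M i.t) := by
    refine Bdd.of_norm_eq ((((((((bR.smul (ρ ^ 2)).neg.sub (bΩ.smul ρ)).sub
      (bΩ.cross (bΩ.act_const S.J))).sub (bΩ.cross (bz.act_const S.J))).sub
      (bz.cross (bΩ.act_const S.J))).add ((bΩ.cross bz).act_const S.J)).add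
      ((Bdd.sum Finset.univ fun k =>
        (Bdd.const (S.r k)).cross ((bP k).act_rot_transpose hR)).add bδR))) fun i => ?_
    rw [J_derrΩ i.traj i.mem]; rfl
  -- Coercivity of the inertia converts the bound for `J e'` into one for `e'`.
  have bdΩ : Bdd fun i : Idx => derrΩ D i.M i.t := by
    refine bJdΩ.of_norm_le_mul c.jm⁻¹ (inv_nonneg.2 c.jm_pos.le) fun i => ?_
    have h1 := (c.J_ge (derrΩ D i.M i.t)).trans (dot_le _ _)
    rw [inv_mul_eq_div, le_div_iff₀ c.jm_pos]
    by_cases hz : ‖derrΩ D i.M i.t‖ = 0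
    · rw [hz, zero_mul]; exact norm_nonneg _
    · have hp : 0 < ‖derrΩ D i.M i.t‖ := lt_of_le_of_ne (norm_nonneg _) (Ne.symm hz)
      refine le_of_mul_le_mul_left ?_ hp
      linarith
  have bdR : Bdd fun i : Idx => rotErrDeriv (relRot D i.M i.t) (errΩ D i.M i.t) :=
    bΩ.of_norm_le_mul 4 (by norm_num) fun i => norm_rotErrDeriv_le (hQ i) _
  have bdM : Bdd fun i : Idx => ddesMoment S D (gains lam ρ i.ν) i.M i.t :=
    (((bdR.smul (ρ ^ 2)).neg.sub (bdΩ.smul ρ)).add ((bdz.cross (bz.act_const S.J)).add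
      (bz.cross (bdz.act_const S.J)))).add
      (((bΩ.cross bQdw).neg.add (bddw.act_rot_transpose hQ)).act_const S.J)
  have bRF := bF.act_rot_transpose hR
  exact ((bΩL.cross (bshare j)).add
    (Bdd.share S j ((bΩL.cross bRF).neg.add (bdF.act_rot_transpose hR)) bdM)).act_rot hR

/-- The desired cable directions rotate at a rate that is bounded uniformly in the cable gains. -/
theorem exists_ωd_bound (hB : D.BoundedBy B) {m : ℝ} (hm : 0 < m) :
    ∃ C : ℝ, 0 ≤ C ∧ ∀ (i : Instant S D lam ρ n d) (j : Fin 4),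
      m ≤ ‖desTension S D (gains lam ρ i.ν) i.M j i.t‖ → ‖i.M.ωd j i.t‖ ≤ C := by
  choose C hC using fun j => bdd_ddesTension (S := S) (lam := lam) (ρ := ρ) (n := n) (d := d) hB j
  refine ⟨∑ j, |C j| / m, Finset.sum_nonneg fun j _ => by positivity, fun i j hmj => ?_⟩
  have hμ : desTension S D (gains lam ρ i.ν) i.M j i.t ≠ 0 :=
    norm_ne_zero_iff.1 (hm.trans_le hmj).ne'
  have h1 := (norm_ωd_le i.traj i.mem hμ).trans ((hC j i).trans (le_abs_self _))
  have h2 : ‖i.M.ωd j i.t‖ ≤ |C j| / m := by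
    rw [le_div_iff₀ hm, mul_comm]
    exact (mul_le_mul_of_nonneg_right hmj (norm_nonneg _)).trans h1
  exact h2.trans (Finset.single_le_sum (f := fun j => |C j| / m)
    (fun j _ => by positivity) (Finset.mem_univ j))

end Bounded

/-! ### Cable frequency, waiting time and the invariance argument. -/

theorem eventually_exp_small {σ A η : ℝ} (hσ : 0 < σ) (hη : 0 < η) :
    ∀ᶠ T : ℝ in Filter.atTop, A * Real.exp (-(σ * T)) < η := by
  have h1 : Filter.Tendsto (fun T : ℝ => σ * T) Filter.atTop Filter.atTop :=
    Filter.tendsto_id.const_mul_atTop hσ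
  have h2 := (Real.tendsto_exp_neg_atTop_nhds_zero.comp h1).const_mul A
  rw [mul_zero] at h2
  exact h2.eventually (gt_mem_nhds hη)

theorem eventually_lt_mul {a k : ℝ} (hk : 0 < k) : ∀ᶠ x : ℝ in Filter.atTop, a < k * x :=
  (Filter.tendsto_id.const_mul_atTop hk).eventually_gt_atTop a

/-- The bound after a waiting time `T` that results from exponential decay. -/
theorem le_of_exp_decay {W W' : ℝ → ℝ} {σ d C T t t₀ t₁ : ℝ} (hσ : 0 < σ) (hd0 : 0 ≤ d)
    (hC : 0 ≤ C) (hT : 0 ≤ T)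
    (hd : ∀ t ∈ Set.Ico t₀ t₁, HasDerivWithinAt W (W' t) (Set.Ico t₀ t₁) t)
    (hW : ∀ t ∈ Set.Ico t₀ t₁, W' t ≤ -σ * W t + d) (h0 : W t₀ ≤ C)
    (hTt : t₀ + T ≤ t) (ht : t < t₁) :
    W t ≤ d / σ + C * Real.exp (-(σ * T)) := by
  have h1 := le_exp_decay hσ (by linarith) ht hd fun s hs => hW s ⟨hs.1, hs.2.trans ht⟩
  have h2 : Real.exp (-(σ * (t - t₀))) ≤ Real.exp (-(σ * T)) :=
    Real.exp_le_exp.2 (neg_le_neg (mul_le_mul_of_nonneg_left (by linarith) hσ.le))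
  have h3 : (W t₀ - d / σ) * Real.exp (-(σ * (t - t₀))) ≤ C * Real.exp (-(σ * T)) :=
    mul_le_mul (by have : 0 ≤ d / σ := by positivity
                   linarith) h2 (Real.exp_pos _).le hC
  linarith

section Core

variable {S : Params} {D : Desired} {B lam ρ α m₀ m ex ψR vmax b CL xbar Rbar d : ℝ}
  {qbar ψq : Fin 4 → ℝ}

/-- Uniform ultimate boundedness from an invariant level `CL` of the Lyapunov function of the load
on which the commanded cable forces are bounded away from zero. -/
theorem exists_cable_gain (c : Consts S) (hB : D.BoundedBy B) (hl1 : 1 ≤ lam) (hlρ : lam ≤ ρ)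
    (hρB : 3 * c.jM * B ≤ ρ) (hα0 : 0 ≤ α) (hα32 : 32 * (c.C₂ * α) ≤ c.ε)
    (hψ0 : ∀ j, 0 < ψq j) (hψα : ∀ j, 4 * ψq j ≤ α ^ 2) (hψ1 : ∀ j, 2 * ψq j ≤ 1)
    (hxbar : xbar ≤ d) (hRbar : Rbar ≤ d) (hqbar : ∀ j, qbar j ≤ d)
    (hCL : CL ≤ 5 / 4 * ρ ^ 2)
    (hlevel : 32 * c.resid α B d ^ 2 / (c.ε * ρ) < c.rate lam * CL) (hb : 0 < b)
    (hult : 3 * ρ / (c.c₄ * lam) * (32 * c.resid α B d ^ 2 / (c.ε * ρ) / c.rate lam) < b ^ 2 / 4)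
    (hm : 0 < m)
    (hten : ∀ (ν : ℝ) (M : Motion) (δx δR : ℝ → E3) (δq : Fin 4 → ℝ → E3) (t₀ t₁ t : ℝ),
      IsTrajectory S D (gains lam ρ ν) M δx δR δq (Set.Ico t₀ t₁) → t ∈ Set.Ico t₀ t₁ → 0 ≤ t →
      loadV S D M c.ε lam ρ t < CL →
      (∀ j, m₀ ≤ ‖desTension S D (gains lam ρ ν) M j t‖) →
      ∀ j, m ≤ ‖desTension S D (gains lam ρ ν) M j t‖)
    (hinit : 3 / 4 * (lam / ρ * (lam ^ 2 * ex ^ 2 + vmax ^ 2)) + 3 / 4 * c.jM * vmax ^ 2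
      + 9 / 8 * (ρ ^ 2 * ψR) < CL) :
    ∃ ν : ℝ, 0 < ν ∧
      UniformlyUltimatelyBounded S D (gains lam ρ ν) xbar Rbar qbar m₀ ex ψR ψq vmax b := by
  have hl : 0 < lam := by linarith
  have hρ : 0 < ρ := by linarith
  have hε := c.ε_pos
  have hc4 := c.c₄_pos
  have hσ := c.rate_pos hl
  set dL := 32 * c.resid α B d ^ 2 / (c.ε * ρ) with hdL
  have hdL0 : 0 ≤ dL := by positivity
  have hCL0 : 0 < CL := pos_of_mul_pos_right (hdL0.trans_lt hlevel) hσ.le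
  -- This bounds the load errors below the level `CL`. It does not involve `ν`, so neither does the
  -- bound `Cω` derived from it.
  set n := √(ρ / lam * (CL / c.c₄)) with hn
  have hρl : 1 ≤ ρ / lam := (one_le_div hl).2 hlρ
  -- consequences of a bound on the Lyapunov function of the load
  have hload : ∀ (ν : ℝ) (M : Motion) (δx δR : ℝ → E3) (δq : Fin 4 → ℝ → E3) (t₀ t₁ t : ℝ),
      IsTrajectory S D (gains lam ρ ν) M δx δR δq (Set.Ico t₀ t₁) → t ∈ Set.Ico t₀ t₁ →
      transN D M lam t ^ 2 ≤ ρ / lam * (loadV S D M c.ε lam ρ t / c.c₄) ∧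
      rotN D M ρ t ^ 2 ≤ loadV S D M c.ε lam ρ t / c.c₄ := by
    intro ν M δx δR δq t₀ t₁ t h ht
    have h1 := (loadV_bounds c h ht hl hρ).1
    rw [mul_comm, ← le_div_iff₀ hc4] at h1
    have e : transN D M lam t ^ 2 = ρ / lam * (lam / ρ * transN D M lam t ^ 2) := by field_simp
    constructor
    · rw [e]
      exact mul_le_mul_of_nonneg_left (by linarith [sq_nonneg (rotN D M ρ t)]) (by positivity)
    · have : 0 ≤ lam / ρ * transN D M lam t ^ 2 := by positivity
      linarith
  obtain ⟨Cω, -, hCω⟩ := exists_ωd_bound (S := S) (lam := lam) (ρ := ρ) (n := n) (d := d) hB hm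
  -- In turn: `ν ≤ ν²`; the rotation rate hypothesis of `cableV_decay`; initial and equilibrium
  -- values of `cableV` below its level (`192 = 3 * 64`); an ultimate cable error below its share of
  -- `b` (`9216 = 16 * 3 * 192`).
  obtain ⟨ν, hν1, hνω, hνψ, hνb⟩ : ∃ ν : ℝ, 1 ≤ ν ∧ Cω ≤ ν ∧
      (∀ j, vmax ^ 2 + 192 * d ^ 2 < ψq j * ν) ∧ 9216 * d ^ 2 < b ^ 2 * ν :=
    (((Filter.eventually_ge_atTop 1).and ((Filter.eventually_ge_atTop Cω).and
      ((Filter.eventually_all.2 fun j => eventually_lt_mul (hψ0 j)).and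
        (eventually_lt_mul (by positivity))))).exists)
  have hν : 0 < ν := by linarith
  have hνν : ν ≤ ν ^ 2 := by nlinarith
  have hσq : 0 < ν / 64 := by positivity
  have hdq0 : 0 ≤ 3 * d ^ 2 / ν := by positivity
  obtain ⟨T, hT0, hTL, hTq⟩ : ∃ T : ℝ, 0 ≤ T ∧
      3 * ρ / (c.c₄ * lam) * CL * Real.exp (-(c.rate lam * T)) < b ^ 2 / 4 ∧
      ∀ j, 3 * (7 / 4 * (ν ^ 2 * ψq j)) * Real.exp (-(ν / 64 * T)) < b ^ 2 / 16 :=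
    ((Filter.eventually_ge_atTop 0).and ((eventually_exp_small hσ (by positivity)).and
      (Filter.eventually_all.2 fun j => eventually_exp_small hσq (by positivity)))).exists
  refine ⟨ν, hν, T, hT0, ?_⟩
  intro t₀ t₁ ht0 _ δx δR δq hδ M h hm0 hdom t ht hTt
  have hδ' : ∀ s ∈ Set.Ico t₀ t₁, ‖δx s‖ ≤ d ∧ ‖δR s‖ ≤ d ∧ ∀ j, ‖δq j s‖ ≤ d := fun s hs =>
    ⟨(hδ s hs).1.trans hxbar, (hδ s hs).2.1.trans hRbar,
      fun j => ((hδ s hs).2.2 j).trans (hqbar j)⟩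
  set K := gains lam ρ ν with hK
  have hL : ∀ s, s ∈ Set.Ico t₀ t₁ → _ := fun s hs =>
    loadV_decay c h hs hB (ht0.trans hs.1) hl hlρ hρB rfl rfl rfl rfl hα32 (hδ' s hs)
  have hQ : ∀ j, ∀ s, s ∈ Set.Ico t₀ t₁ → _ := fun j s hs =>
    cableV_decay (j := j) h hs hν (rfl : K.kq = ν ^ 2) (rfl : K.kω = ν) ((hδ' s hs).2.2 j)
  -- Turns the pointwise derivatives into functions of time.
  choose! vL hvL hvL' using hL
  choose! vQ hvQ hvQ' using hQ
  -- the commanded cable forces and the cable errors below the levels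
  have hμ : ∀ s ∈ Set.Ico t₀ t₁, loadV S D M c.ε lam ρ s < CL → ∀ j,
      m ≤ ‖desTension S D K M j s‖ := fun s hs hV =>
    hten ν M δx δR δq t₀ t₁ s h hs (ht0.trans hs.1) hV (hm0 s hs)
  have hμ0 : ∀ s ∈ Set.Ico t₀ t₁, loadV S D M c.ε lam ρ s < CL → ∀ j,
      desTension S D K M j s ≠ 0 := fun s hs hV j =>
    norm_ne_zero_iff.1 (hm.trans_le (hμ s hs hV j)).ne'
  -- The level `7 / 4` is twice the lower constant `7 / 8` of `cableV_bounds`: below it, `Ψ_q` at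
  -- most doubles its admissible initial bound.
  have hΨ : ∀ s ∈ Set.Ico t₀ t₁, loadV S D M c.ε lam ρ s < CL → ∀ j,
      cableV S D K M ν j s < 7 / 4 * (ν ^ 2 * ψq j) → Ψq S D K M j s ≤ 2 * ψq j := by
    intro s hs hV j hW
    have h1 := (cableV_bounds h hs hν (hμ0 s hs hV j)).1
    refine le_of_mul_le_mul_left ?_ (show 0 < ν ^ 2 by positivity)
    linarith [sq_nonneg ‖errω M j s‖]
  have htstart : t₀ ∈ Set.Ico t₀ t₁ := ⟨le_rfl, ht.1.trans_lt ht.2⟩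
  obtain ⟨dx, dR, dq, dv, dΩ, dω⟩ := hdom
  have hstartL : loadV S D M c.ε lam ρ t₀ < CL := by
    refine ((loadV_bounds c h htstart hl hρ).2.2.2.trans ?_).trans_lt hinit
    rw [transN_sq]
    have a1 : ‖errX D M t₀‖ ^ 2 ≤ ex ^ 2 := pow_le_pow_left₀ (norm_nonneg _) dx.le 2
    have a2 : ‖errV D M t₀‖ ^ 2 ≤ vmax ^ 2 := pow_le_pow_left₀ (norm_nonneg _) dv 2
    have a3 : ‖errΩ D M t₀‖ ^ 2 ≤ vmax ^ 2 := pow_le_pow_left₀ (norm_nonneg _) dΩ 2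
    have := c.jM_pos
    gcongr
  have hstartQ : ∀ j, cableV S D K M ν j t₀ < 7 / 4 * (ν ^ 2 * ψq j) := by
    intro j
    refine (cableV_bounds h htstart hν (hμ0 t₀ htstart hstartL j)).2.trans_lt ?_
    have a1 : ‖errω M j t₀‖ ^ 2 ≤ vmax ^ 2 := pow_le_pow_left₀ (norm_nonneg _) (dω j) 2
    have a2 : ν ^ 2 * Ψq S D K M j t₀ ≤ ν ^ 2 * ψq j :=
      mul_le_mul_of_nonneg_left (dq j).le (by positivity)
    have a3 := hνψ j
    have a4 : ψq j * ν ≤ ν ^ 2 * ψq j := by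
      rw [mul_comm]; exact mul_le_mul_of_nonneg_right hνν (hψ0 j).le
    linarith [sq_nonneg d, sq_nonneg vmax]
  -- `none` stands for the load and `some j` for cable `j`.
  let W : Option (Fin 4) → ℝ → ℝ := fun i =>
    i.elim (fun s => loadV S D M c.ε lam ρ s) fun j => cableV S D K M ν j
  let W' : Option (Fin 4) → ℝ → ℝ := fun i => i.elim vL vQ
  let σ : Option (Fin 4) → ℝ := fun i => i.elim (c.rate lam) fun _ => ν / 64
  let δ : Option (Fin 4) → ℝ := fun i => i.elim dL fun _ => 3 * d ^ 2 / ν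
  let C : Option (Fin 4) → ℝ := fun i => i.elim CL fun j => 7 / 4 * (ν ^ 2 * ψq j)
  have hW : ∀ i, ∀ s ∈ Set.Ico t₀ t₁, HasDerivWithinAt (W i) (W' i s) (Set.Ico t₀ t₁) s := by
    rintro (_ | j)
    exacts [hvL, hvQ j]
  have hdiss : ∀ s ∈ Set.Ico t₀ t₁, (∀ i, W i s < C i) → ∀ i, W' i s ≤ -σ i * W i s + δ i := by
    intro s hs hall
    have hV : loadV S D M c.ε lam ρ s < CL := hall none
    have hWq : ∀ j, cableV S D K M ν j s < 7 / 4 * (ν ^ 2 * ψq j) := fun j => hall (some j)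
    have hΨs := fun j => hΨ s hs hV j (hWq j)
    rintro (_ | j)
    -- `‖e_q‖² ≤ 2 Ψ_q ≤ 4 ψ_q ≤ α²`, and `7 / 8 * ρ² Ψ_R < CL ≤ 5 / 4 * ρ²` keeps `Ψ_R` below `3 /
    -- 2`.
    · refine hvL' s hs (fun j => ?_) ?_
      · apply le_of_sq_le_sq _ hα0
        rw [norm_errQ_sq h hs (hμ0 s hs hV j)]
        linarith [hψα j, hΨs j, sq_nonneg (Ψq S D K M j s)]
      · have a1 := (loadV_bounds c h hs hl hρ).2.2.1
        refine le_of_mul_le_mul_left ?_ (show 0 < ρ ^ 2 by positivity)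
        linarith [sq_nonneg ρ]
    · have hN := hload ν M δx δR δq t₀ t₁ s h hs
      have hc : loadV S D M c.ε lam ρ s / c.c₄ ≤ CL / c.c₄ :=
        div_le_div_of_nonneg_right hV.le hc4.le
      have hx : transN D M lam s ≤ n := Real.le_sqrt_of_sq_le
        (hN.1.trans (mul_le_mul_of_nonneg_left hc (by positivity)))
      have hr : rotN D M ρ s ≤ n := Real.le_sqrt_of_sq_le
        ((hN.2.trans hc).trans (le_mul_of_one_le_left (by positivity) hρl))
      have hxl : ‖errX D M s‖ ≤ lam * ‖errX D M s‖ :=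
        le_mul_of_one_le_left (norm_nonneg _) hl1
      exact hvQ' j s hs (hμ0 s hs hV j)
        ((hCω ⟨ν, M, δx, δR, δq, t₀, t₁, s, h, hs, ht0.trans hs.1,
          (hxl.trans lam_errX_le).trans hx, errV_le.trans hx, (errΩ_le h hs).trans hr,
          hδ' s hs⟩ j (hμ s hs hV j)).trans hνω) ((hΨs j).trans (hψ1 j))
  have hstay : ∀ s ∈ Set.Ico t₀ t₁, ∀ i, W i s < C i := by
    refine barrier (σ := σ) (d := δ) ?_ hW ?_ ?_ hdiss
    · rintro (_ | j)
      exacts [hσ, hσq]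
    · rintro (_ | j)
      exacts [hstartL, hstartQ j]
    · rintro (_ | j)
      · exact hlevel
      · change 3 * d ^ 2 / ν < ν / 64 * (7 / 4 * (ν ^ 2 * ψq j))
        rw [div_lt_iff₀ hν]
        have a3 := hνψ j
        have a4 : ψq j * ν ≤ ν ^ 4 * ψq j := by
          rw [mul_comm]
          refine mul_le_mul_of_nonneg_right ?_ (hψ0 j).le
          calc ν = ν ^ 1 := (pow_one ν).symm
            _ ≤ ν ^ 4 := pow_le_pow_right₀ hν1 (by norm_num)
        have e : ν / 64 * (7 / 4 * (ν ^ 2 * ψq j)) * ν = 7 / 256 * (ν ^ 4 * ψq j) := by ring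
        rw [e]
        linarith [sq_nonneg d, sq_nonneg vmax]
  -- the ultimate bound
  have hVt : loadV S D M c.ε lam ρ t < CL := hstay t ht none
  have hVle : loadV S D M c.ε lam ρ t ≤ dL / c.rate lam + CL * Real.exp (-(c.rate lam * T)) :=
    le_of_exp_decay hσ hdL0 hCL0.le hT0 (hW none)
      (fun s hs => hdiss s hs (hstay s hs) none) hstartL.le hTt ht.2
  have hWle : ∀ j, cableV S D K M ν j t ≤ 3 * d ^ 2 / ν / (ν / 64)
      + 7 / 4 * (ν ^ 2 * ψq j) * Real.exp (-(ν / 64 * T)) := fun j =>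
    le_of_exp_decay hσq hdq0 (by have := hψ0 j; positivity) hT0 (hW (some j))
      (fun s hs => hdiss s hs (hstay s hs) (some j)) (hstartQ j).le hTt ht.2
  obtain ⟨hN1, hN2⟩ := hload ν M δx δR δq t₀ t₁ t h ht
  -- The load gets half of `b²` and each cable an eighth. The factor `3` in the hypotheses is one
  -- for the translational errors and two for the rotational ones, as `‖e_R‖² ≤ 2 Ψ_R`.
  have hloadsum : ‖errX D M t‖ ^ 2 + ‖errV D M t‖ ^ 2 + ‖errR D M t‖ ^ 2 + ‖errΩ D M t‖ ^ 2
      ≤ b ^ 2 / 2 := by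
    have a1 : ‖errX D M t‖ ^ 2 ≤ lam ^ 2 * ‖errX D M t‖ ^ 2 :=
      le_mul_of_one_le_left (sq_nonneg _) (one_le_pow₀ hl1)
    have hΨ0 := ΨR_nonneg h ht
    have a2 : ΨR D M t ≤ ρ ^ 2 * ΨR D M t :=
      le_mul_of_one_le_left hΨ0 (one_le_pow₀ (hl1.trans hlρ))
    have a3 := norm_errR_sq h ht
    rw [transN_sq] at hN1
    rw [rotN_sq h ht] at hN2
    have hV0 : 0 ≤ loadV S D M c.ε lam ρ t / c.c₄ :=
      (add_nonneg (sq_nonneg _) (by positivity)).trans hN2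
    have a4 := mul_le_mul_of_nonneg_right hρl hV0
    have a5 : 3 * (ρ / lam * (loadV S D M c.ε lam ρ t / c.c₄))
        = 3 * ρ / (c.c₄ * lam) * loadV S D M c.ε lam ρ t := by field_simp
    have a6 := mul_le_mul_of_nonneg_left hVle (show 0 ≤ 3 * ρ / (c.c₄ * lam) by positivity)
    linarith [sq_nonneg (ΨR D M t), sq_nonneg ‖errΩ D M t‖]
  have hcable : ∀ j, ‖errQ S D K M j t‖ ^ 2 + ‖errω M j t‖ ^ 2 ≤ b ^ 2 / 8 := by
    intro j
    have a1 := (cableV_bounds h ht hν (hμ0 t ht hVt j)).1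
    have a2 := norm_errQ_sq h ht (hμ0 t ht hVt j)
    have hΨ0 := Ψq_nonneg h ht j
    have a3 : Ψq S D K M j t ≤ ν ^ 2 * Ψq S D K M j t :=
      le_mul_of_one_le_left hΨ0 (one_le_pow₀ hν1)
    have a4 : 3 * (3 * d ^ 2 / ν / (ν / 64)) ≤ b ^ 2 / 16 := by
      have e : 3 * (3 * d ^ 2 / ν / (ν / 64)) = 576 * d ^ 2 / ν ^ 2 := by field_simp; ring
      rw [e, div_le_iff₀ (by positivity)]
      linarith [mul_le_mul_of_nonneg_left hνν (sq_nonneg b)]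
    linarith [hWle j, hTq j, sq_nonneg (Ψq S D K M j t), sq_nonneg ‖errω M j t‖]
  rw [errNorm]
  refine Real.sqrt_le_iff.2 ⟨hb.le, ?_⟩
  have hsum : ∑ j, (‖errQ S D K M j t‖ ^ 2 + ‖errω M j t‖ ^ 2) ≤ ∑ _j : Fin 4, b ^ 2 / 8 :=
    Finset.sum_le_sum fun j _ => hcable j
  simp only [Finset.sum_const, Finset.card_univ, Fintype.card_fin, nsmul_eq_mul] at hsum
  push_cast at hsum
  linarith

end Core

/-! ### Load frequencies for large and for small initial errors. -/

section GainChoice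

variable {S : Params} (c : Consts S) {D : Desired} {B lam ρ α d b : ℝ}

theorem exp_level_eq (hl : 0 < lam) (hρ : 0 < ρ) (r : ℝ) :
    32 * r ^ 2 / (c.ε * ρ) / c.rate lam = 512 * c.C₃ * r ^ 2 / (c.ε ^ 2 * (lam * ρ)) := by
  have := c.ε_pos
  have := c.C₃_pos
  unfold Consts.rate
  field_simp
  ring

/-- A frequency that is large enough makes the ultimate bound small. -/
theorem ultimate_lt (hl : 1 ≤ lam) (hρ : 0 < ρ) {r : ℝ}
    (h : 1536 * c.C₃ * r ^ 2 / (c.c₄ * c.ε ^ 2) < b ^ 2 / 4 * lam) :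
    3 * ρ / (c.c₄ * lam) * (32 * r ^ 2 / (c.ε * ρ) / c.rate lam) < b ^ 2 / 4 := by
  have hl0 : 0 < lam := by linarith
  have hε := c.ε_pos
  have hc4 := c.c₄_pos
  rw [exp_level_eq c hl0 hρ]
  -- The factor `ρ / lam` from the conversion of `loadV` into errors and the `1 / (lam * ρ)` of the
  -- equilibrium value leave `1 / lam ^ 2`, independent of `ρ`.
  have e : 3 * ρ / (c.c₄ * lam) * (512 * c.C₃ * r ^ 2 / (c.ε ^ 2 * (lam * ρ)))
      = 1536 * c.C₃ * r ^ 2 / (c.c₄ * c.ε ^ 2) / lam ^ 2 := by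
    field_simp; ring
  rw [e, div_lt_iff₀ (by positivity)]
  refine h.trans_le (mul_le_mul_of_nonneg_left ?_ (by positivity))
  nlinarith

/-- Large errors of the load: the attitude loop has to be faster than the position loop. -/
theorem exists_load_gains_large (hB : D.BoundedBy B) (hα0 : 0 ≤ α)
    (hα32 : 32 * (c.C₂ * α) ≤ c.ε) {ψq qbar : Fin 4 → ℝ} {xbar Rbar ex ψR vmax m : ℝ}
    (hψ0 : ∀ j, 0 < ψq j) (hψα : ∀ j, 4 * ψq j ≤ α ^ 2) (hψ1 : ∀ j, 2 * ψq j ≤ 1)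
    (hex : 0 < ex) (hψR : ψR < 1) (hvmax : 0 < vmax) (hm : 0 < m) (hb : 0 < b) :
    ∃ K : Gains, K.Positive ∧
      UniformlyUltimatelyBounded S D K xbar Rbar qbar m ex ψR ψq vmax b := by
  have hε := c.ε_pos
  have hjM := c.jM_pos
  have hC3 := c.C₃_pos
  -- A common nonnegative bound; the given bounds may have any sign.
  obtain ⟨d, hd⟩ : ∃ d, d = |xbar| + |Rbar| + ∑ j, |qbar j| := ⟨_, rfl⟩
  have hq0 : 0 ≤ ∑ j, |qbar j| := Finset.sum_nonneg fun j _ => abs_nonneg _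
  have hqj : ∀ j, |qbar j| ≤ ∑ j, |qbar j| := fun j =>
    Finset.single_le_sum (f := fun j => |qbar j|) (fun j _ => abs_nonneg _) (Finset.mem_univ j)
  have hx0 := abs_nonneg xbar
  have hR0 := abs_nonneg Rbar
  -- With `ρ = κ * lam`, the attitude uses less than `9 / 8 * ρ²` of the level `5 / 4 * ρ²`. The
  -- remaining `ρ² / 8` must hold the other initial energy, at most `3 / 4 * lam²` times the
  -- bracket; hence the factor `6`.
  obtain ⟨κ, hκ⟩ : ∃ κ, κ = 1 + 6 * (ex ^ 2 + vmax ^ 2 + c.jM * vmax ^ 2) := ⟨_, rfl⟩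
  have hX0 : 0 ≤ ex ^ 2 + vmax ^ 2 + c.jM * vmax ^ 2 := by positivity
  have hκ1 : 1 ≤ κ := by linarith
  have hκ0 : 0 < κ := by linarith
  set r := c.resid α B d with hr
  obtain ⟨lam, hl1, hlB, hlr, hlb⟩ : ∃ lam : ℝ, 1 ≤ lam ∧ 3 * c.jM * B ≤ lam ∧
      32 * r ^ 2 / c.ε < c.ε / (16 * c.C₃) * lam ∧
      1536 * c.C₃ * r ^ 2 / (c.c₄ * c.ε ^ 2) < b ^ 2 / 4 * lam :=
    ((Filter.eventually_ge_atTop 1).and ((Filter.eventually_ge_atTop _).and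
      ((eventually_lt_mul (by positivity)).and (eventually_lt_mul (by positivity))))).exists
  have hl : 0 < lam := by linarith
  have hlρ : lam ≤ κ * lam := le_mul_of_one_le_left hl.le hκ1
  have hρ : 0 < κ * lam := by positivity
  have hκκ : κ ≤ κ ^ 2 := by nlinarith
  have hll : 1 ≤ lam ^ 2 := one_le_pow₀ hl1
  obtain ⟨ν, hν, hU⟩ := exists_cable_gain (m₀ := m) (CL := 5 / 4 * (κ * lam) ^ 2) (d := d)
    (xbar := xbar) (Rbar := Rbar) (qbar := qbar) (ex := ex) (vmax := vmax) (ψR := ψR) c hB hl1 hlρ (hlB.trans hlρ)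
    hα0 hα32 hψ0 hψα hψ1
    (by linarith [le_abs_self xbar]) (by linarith [le_abs_self Rbar])
    (fun j => by linarith [le_abs_self (qbar j), hqj j]) le_rfl
    (by
      have h1 : 32 * r ^ 2 / (c.ε * (κ * lam)) ≤ 32 * r ^ 2 / c.ε :=
        div_le_div_of_nonneg_left (by positivity) hε
          (le_mul_of_one_le_right hε.le (hl1.trans hlρ))
      have h2 : c.ε / (16 * c.C₃) * lam ≤ c.rate lam * (5 / 4 * (κ * lam) ^ 2) := by
        have e : c.rate lam = c.ε / (16 * c.C₃) * lam := by unfold Consts.rate; ring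
        rw [e]
        refine le_mul_of_one_le_right (by positivity) ?_
        have := one_le_pow₀ (hl1.trans hlρ) (n := 2)
        linarith
      exact h1.trans_lt (hlr.trans_le h2))
    hb (ultimate_lt c hl1 hρ hlb) hm
    (fun _ _ _ _ _ _ _ _ _ _ _ _ h => h)
    (by
      have e : lam / (κ * lam) = 1 / κ := by field_simp
      rw [e]
      have h1 : 1 / κ ≤ 1 := (div_le_one hκ0).2 hκ1
      have h2 : 1 / κ * (lam ^ 2 * ex ^ 2 + vmax ^ 2) ≤
          1 * (lam ^ 2 * ex ^ 2 + lam ^ 2 * vmax ^ 2) :=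
        mul_le_mul h1 (by
          have := mul_le_mul_of_nonneg_right hll (sq_nonneg vmax)
          linarith) (by positivity) zero_le_one
      have h3 : c.jM * vmax ^ 2 ≤ lam ^ 2 * (c.jM * vmax ^ 2) :=
        le_mul_of_one_le_left (by positivity) hll
      have h4 : (κ * lam) ^ 2 * ψR ≤ (κ * lam) ^ 2 * 1 :=
        mul_le_mul_of_nonneg_left hψR.le (sq_nonneg _)
      have h5 : (κ * lam) ^ 2 = lam ^ 2 * κ ^ 2 := by ring
      have h6 : lam ^ 2 * (1 + 6 * (ex ^ 2 + vmax ^ 2 + c.jM * vmax ^ 2)) ≤ lam ^ 2 * κ ^ 2 :=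
        mul_le_mul_of_nonneg_left (by linarith) (by positivity)
      rw [h5] at h4 ⊢
      linarith)
  exact ⟨gains lam (κ * lam) ν, ⟨by simp only [gains]; positivity, hl, by
    simp only [gains]; positivity, hρ, by simp only [gains]; positivity, hν⟩, hU⟩

/-- The gain from the residual load acceleration to the deviation of the cable forces from their
nominal values. -/
def Consts.devGain (B : ℝ) : ℝ :=
  c.Cs * (2 * S.mL + 3 + 2 * c.nomB B) * (√(1024 * c.C₃ / c.c₄) / c.ε)

theorem Consts.devGain_nonneg (hB : 0 ≤ B) : 0 ≤ c.devGain B := by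
  have := c.Cs_pos; have := S.mL_pos; have := c.nomB_nonneg hB; have := c.ε_pos
  unfold Consts.devGain; positivity

/-- Small initial errors of the load: the commanded cable forces stay close to the nominal ones. -/
theorem exists_load_gains_small (hB : D.BoundedBy B) (hB0 : 0 ≤ B) (hα0 : 0 ≤ α)
    (hα32 : 32 * (c.C₂ * α) ≤ c.ε) {ψq : Fin 4 → ℝ} {m : ℝ}
    (hψ0 : ∀ j, 0 < ψq j) (hψα : ∀ j, 4 * ψq j ≤ α ^ 2) (hψ1 : ∀ j, 2 * ψq j ≤ 1)
    (hm : 0 < m) (hnom : ∀ t, 0 ≤ t → ∀ j, m ≤ ‖nominalTension S D j t‖) (hd : 0 < d)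
    (hdev : c.devGain B * c.resid α B d ≤ m / 2) (hb : 0 < b) :
    ∃ K : Gains, K.Positive ∧ ∃ v : ℝ, 0 < v ∧
      UniformlyUltimatelyBounded S D K d d (fun _ => d) 0 v v ψq v b := by
  have hε := c.ε_pos
  have hjM := c.jM_pos
  have hC3 := c.C₃_pos
  have hc4 := c.c₄_pos
  have hr0 : 0 < c.resid α B d := by
    have := c.C₂_pos; have := c.nomB_nonneg hB0
    unfold Consts.resid; positivity
  set r := c.resid α B d with hr
  obtain ⟨lam, hl1, hlB, hlr, hlb⟩ : ∃ lam : ℝ, 1 ≤ lam ∧ 3 * c.jM * B ≤ lam ∧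
      1024 * c.C₃ * r ^ 2 / c.ε ^ 2 ≤ lam ∧
      1536 * c.C₃ * r ^ 2 / (c.c₄ * c.ε ^ 2) < b ^ 2 / 4 * lam :=
    ((Filter.eventually_ge_atTop 1).and ((Filter.eventually_ge_atTop _).and
      ((Filter.eventually_ge_atTop _).and (eventually_lt_mul (by positivity))))).exists
  have hl : 0 < lam := by linarith
  have hrate := c.rate_pos hl
  have hll : 1 ≤ lam ^ 2 := one_le_pow₀ hl1
  -- Twice the equilibrium value of `exp_level_eq` for `ρ = lam`: invariant, yet as small as the
  -- residual allows.
  set CL := 1024 * c.C₃ * r ^ 2 / c.ε ^ 2 / lam ^ 2 with hCL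
  have hCL0 : 0 < CL := by positivity
  obtain ⟨A, hA⟩ : ∃ A, A = 3 / 4 * (lam ^ 2 + 1) + 3 / 4 * c.jM + 9 / 8 * lam ^ 2 := ⟨_, rfl⟩
  have hA0 : 0 < A := by rw [hA]; positivity
  obtain ⟨v, hv⟩ : ∃ v, v = min 1 (CL / (2 * A)) := ⟨_, rfl⟩
  have hv0 : 0 < v := by rw [hv]; positivity
  have hv1 : v ≤ 1 := hv ▸ min_le_left _ _
  have hvA : v * A ≤ CL / 2 := by
    have : v ≤ CL / (2 * A) := hv ▸ min_le_right _ _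
    calc v * A ≤ CL / (2 * A) * A := mul_le_mul_of_nonneg_right this hA0.le
      _ = CL / 2 := by field_simp
  have hvv : v ^ 2 ≤ v := by nlinarith
  obtain ⟨ν, hν, hU⟩ := exists_cable_gain (m₀ := 0) (m := m / 2) (CL := CL) (d := d)
    (xbar := d) (Rbar := d) (qbar := fun _ => d) (ex := v) (vmax := v) (ψR := v) c hB hl1 le_rfl hlB
    hα0 hα32 hψ0 hψα hψ1 le_rfl le_rfl (fun _ => le_rfl)
    (by
      rw [hCL, div_le_iff₀ (by positivity)]
      have h1 : lam ≤ lam ^ 2 := by nlinarith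
      have h2 : lam ^ 2 ≤ lam ^ 2 * lam ^ 2 := le_mul_of_one_le_left (by positivity) hll
      linarith)
    (by
      have h1 := exp_level_eq c hl hl r
      rw [div_eq_iff hrate.ne'] at h1
      rw [h1, mul_comm]
      refine mul_lt_mul_of_pos_left ?_ hrate
      have e : CL = 2 * (512 * c.C₃ * r ^ 2 / (c.ε ^ 2 * (lam * lam))) := by
        rw [hCL]; field_simp; norm_num
      have : 0 < 512 * c.C₃ * r ^ 2 / (c.ε ^ 2 * (lam * lam)) := by positivity
      linarith)
    hb (ultimate_lt c hl1 hl hlb) (by positivity)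
    (by
      intro ν M δx δR δq t₀ t₁ t h ht h0 hV _ j
      have h1 := (loadV_bounds c h ht hl hl).1
      rw [div_self hl.ne', one_mul] at h1
      have h2 : transN D M lam t ^ 2 + rotN D M lam t ^ 2 ≤ CL / c.c₄ := by
        rw [le_div_iff₀ hc4, mul_comm]; exact h1.trans hV.le
      -- On this level `lam` times the weighted errors is at most `C₅ * r`, whatever `lam` is.
      -- Raising the gains thus does not increase the bound for the deviation of the cable forces,
      -- so `δ` need not depend on `b`.
      set C₅ := √(1024 * c.C₃ / c.c₄) / c.ε with hC5
      have hC50 : 0 ≤ C₅ := by positivity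
      have h3 : lam ^ 2 * (CL / c.c₄) = (C₅ * r) ^ 2 := by
        rw [mul_pow, hC5, div_pow, Real.sq_sqrt (by positivity), hCL]
        field_simp
      have hsmall : ∀ N : ℝ, N ^ 2 ≤ CL / c.c₄ → lam * N ≤ C₅ * r := fun N hN => by
        apply le_of_sq_le_sq _ (by positivity)
        rw [mul_pow, ← h3]
        exact mul_le_mul_of_nonneg_left hN (by positivity)
      have hx := hsmall _ (by linarith [sq_nonneg (rotN D M lam t)] :
        transN D M lam t ^ 2 ≤ CL / c.c₄)
      have hR := hsmall _ (by linarith [sq_nonneg (transN D M lam t)] :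
        rotN D M lam t ^ 2 ≤ CL / c.c₄)
      have hΨ : √(ΨR D M t) ≤ C₅ * r := by
        refine le_trans ?_ hR
        have hN : 0 ≤ rotN D M lam t := Real.sqrt_nonneg _
        refine le_trans ?_ (le_mul_of_one_le_left hN hl1)
        refine Real.sqrt_le_sqrt ?_
        have := le_mul_of_one_le_left (ΨR_nonneg h ht) hll
        linarith [sq_nonneg ‖errΩ D M t‖]
      have h4 := nominalTension_sub_le h ht hjM.le c.Cs_pos.le c.J_le hB h0 c.share_le hl.le hl.le
        rfl rfl rfl rfl j
      have hnB := c.nomB_nonneg hB0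
      have hmL := S.mL_pos
      have h5 : c.Cs * (2 * S.mL * (lam * transN D M lam t) + 3 * (lam * rotN D M lam t)
          + 2 * √(ΨR D M t) * c.nomB B) ≤ c.devGain B * r := by
        have a1 := mul_le_mul_of_nonneg_left hx (show 0 ≤ 2 * S.mL by positivity)
        have a2 := mul_le_mul_of_nonneg_right hΨ (show 0 ≤ 2 * c.nomB B by positivity)
        calc _ ≤ c.Cs * ((2 * S.mL + 3 + 2 * c.nomB B) * (C₅ * r)) :=
              mul_le_mul_of_nonneg_left (by linarith) c.Cs_pos.le
          _ = c.devGain B * r := by rw [Consts.devGain]; ring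
      have h6 := hnom t h0 j
      unfold Consts.nomB at h5
      linarith)
    (by
      rw [div_self hl.ne', one_mul]
      have h1 := mul_le_mul_of_nonneg_left hvv (sq_nonneg lam)
      have h2 := mul_le_mul_of_nonneg_left hvv hjM.le
      have h3 : 3 / 4 * (lam ^ 2 * v ^ 2 + v ^ 2) + 3 / 4 * c.jM * v ^ 2 + 9 / 8 * (lam ^ 2 * v)
          ≤ v * A := by rw [hA]; linarith
      linarith)
  exact ⟨gains lam lam ν, ⟨by simp only [gains]; positivity, hl, by
    simp only [gains]; positivity, hl, by simp only [gains]; positivity, hν⟩, v, hv0, hU⟩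

end GainChoice

end LoadTransport

end

/-! ### Choice of the bound for the cable errors and conclusion. -/

theorem theorem2 (S : LoadTransport.Params) (D : LoadTransport.Desired) :
    ∃ α₀ : ℝ, 0 < α₀ ∧
      ∀ ψq : Fin 4 → ℝ,
        (∀ j, 0 < ψq j ∧ ψq j < 1 ∧ √(ψq j * (2 - ψq j)) < α₀) →
      (∀ (xbar Rbar : ℝ) (qbar : Fin 4 → ℝ) (ex ψR c m : ℝ),
        0 < ex → 0 < ψR → ψR < 1 → 0 < c → 0 < m →
        ∀ b : ℝ, 0 < b →
          ∃ K : LoadTransport.Gains, K.Positive ∧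
            LoadTransport.UniformlyUltimatelyBounded S D K xbar Rbar qbar m ex ψR ψq c b) ∧
      ((∃ m : ℝ, 0 < m ∧ ∀ t, 0 ≤ t → ∀ j, m ≤ ‖LoadTransport.nominalTension S D j t‖) →
        ∃ δ : ℝ, 0 < δ ∧ ∀ b : ℝ, 0 < b →
          ∃ K : LoadTransport.Gains, K.Positive ∧
            ∃ c : ℝ, 0 < c ∧
              LoadTransport.UniformlyUltimatelyBounded S D K δ δ (fun _ => δ) 0 c c ψq c b) := by
  open LoadTransport in
  obtain ⟨c⟩ := nonempty_consts S
  obtain ⟨B, hB⟩ : ∃ B, D.BoundedBy B := D.bounded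
  have hB0 : 0 ≤ B := (norm_nonneg _).trans (hB 0 le_rfl).1
  obtain ⟨m₁, hm₁, hnom⟩ : ∃ m₁ : ℝ, 0 < m₁ ∧
      ((∃ m : ℝ, 0 < m ∧ ∀ t, 0 ≤ t → ∀ j, m ≤ ‖nominalTension S D j t‖) →
        ∀ t, 0 ≤ t → ∀ j, m₁ ≤ ‖nominalTension S D j t‖) := by
    by_cases h : ∃ m : ℝ, 0 < m ∧ ∀ t, 0 ≤ t → ∀ j, m ≤ ‖nominalTension S D j t‖
    · obtain ⟨m, hm, hmt⟩ := h
      exact ⟨m, hm, fun _ => hmt⟩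
    · exact ⟨1, one_pos, fun h' => absurd h' h⟩
  have hε := c.ε_pos
  have hC2 := c.C₂_pos
  have hnB := c.nomB_nonneg hB0
  have hG := c.devGain_nonneg hB0
  set G := c.devGain B * c.C₂ with hGdef
  have hG0 : 0 ≤ G := by positivity
  -- The three terms give `2 ψ_q ≤ 1`, the absorption condition for `α = 2 * α₀`, and a quarter of
  -- `m₁` as bound for the deviation of the cable forces caused by misalignment. A disturbance `δ`
  -- may cause another quarter.
  obtain ⟨α₀, hα₀⟩ : ∃ α₀, α₀ = min (1 / 4) (min (c.ε / (64 * c.C₂))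
      (m₁ / (8 * (G * c.nomB B + 1)))) := ⟨_, rfl⟩
  have hα0 : 0 < α₀ := by rw [hα₀]; positivity
  have hα1 : α₀ ≤ 1 / 4 := hα₀ ▸ min_le_left _ _
  have hα2 : α₀ ≤ c.ε / (64 * c.C₂) := hα₀ ▸ (min_le_right _ _).trans (min_le_left _ _)
  have hα3 : α₀ ≤ m₁ / (8 * (G * c.nomB B + 1)) :=
    hα₀ ▸ (min_le_right _ _).trans (min_le_right _ _)
  rw [le_div_iff₀ (by positivity)] at hα2 hα3
  have hα32 : 32 * (c.C₂ * (2 * α₀)) ≤ c.ε := by linarith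
  refine ⟨α₀, hα0, fun ψq hψ => ?_⟩
  have hψ0 : ∀ j, 0 < ψq j := fun j => (hψ j).1
  have hψα' : ∀ j, ψq j ≤ α₀ ^ 2 := fun j => by
    obtain ⟨h1, h2, h3⟩ := hψ j
    have h4 := (Real.sqrt_lt' hα0).1 h3
    nlinarith
  have hψα : ∀ j, 4 * ψq j ≤ (2 * α₀) ^ 2 := fun j => by linarith [hψα' j]
  have hψ1 : ∀ j, 2 * ψq j ≤ 1 := fun j => by nlinarith [hψα' j]
  refine ⟨fun xbar Rbar qbar ex ψR v m hex _ hψR hv hm b hb =>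
    exists_load_gains_large c hB (by positivity) hα32 hψ0 hψα hψ1 hex hψR hv hm hb,
    fun hn => ⟨m₁ / (4 * (G + 1)), by positivity, fun b hb =>
      exists_load_gains_small c hB hB0 (by positivity) hα32 hψ0 hψα hψ1 hm₁ (hnom hn)
        (by positivity) ?_ hb⟩⟩
  have h1 : G * (m₁ / (4 * (G + 1))) ≤ m₁ / 4 := by
    rw [mul_div_assoc', div_le_div_iff₀ (by positivity) (by positivity)]
    nlinarith
  have h2 : G * (2 * α₀ * c.nomB B) ≤ m₁ / 4 := by linarith
  have e : c.devGain B * c.resid (2 * α₀) B (m₁ / (4 * (G + 1)))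
      = G * (2 * α₀ * c.nomB B) + G * (m₁ / (4 * (G + 1))) := by
    rw [Consts.resid, hGdef]; ring
  linarith
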